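/- Let $\mathbf F_q$ be the field with $q$ elements. A random variable $\xi\in\mathbf F_q$ is called near uniform with constant $C\ge 1$ if $\mathbf P(\xi=a)\le C/q$ for every $a\in\mathbf F_q$. Let $Q_{sym,\infty}$ be the random variable on $\{0,1,2,\dots\}$ with $$\mathbf P(Q_{sym,\infty}=k)=\frac{\prod_{i=0}^{\infty}(1-q^{-2i-1})}{\prod_{l=1}^{k}(q^{l}-1)},$$ and for a random $n\times n$ matrix $M$ let $Q(M)=n-\operatorname{rank}(M)$ be its corank. Write $\|X-Y\|_{TV}=\sup_{A}|\mathbf P(X\in A)-\mathbf P(Y\in A)|$. **Theorem.** There is an absolute constant $\alpha_0>0$ such that for every $0<\alpha<\alpha_0$ and every $C\ge 1$ there are constants $C',c>0$, depending only on $C$ and $\alpha$, with the following property. Let $n\ge 0$, let $q$ be a prime power, and let $F_1,\dots,F_n\subseteq[n]$ satisfy $|F_i|<\alpha n$ for all $i$, and $i\in F_j\iff j\in F_i$ for all $i,j$. If $q$ is even, assume moreover that $i\notin F_i$ for every $i$. Let $M_n$ be a random symmetric $n\times n$ matrix over $\mathbf F_q$ such that the entries $M_n(ij)$ with $i\le j$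 and $j\notin F_i$ are mutually independent and near uniform with constant $C$, while the family of entries with $i\le j$ and $j\in F_i$ is arbitrary (with any joint distribution, in particular possibly deterministic), independent of the former entries. Then $$\|Q(M_n)-Q_{sym,\infty}\|_{TV}\le\Big(\frac{C'}{q}\Big)^{cn}.$$ -/

import Mathlib

open MeasureTheory ProbabilityTheory

/-- The corank `n - rank A` of an `n × n` matrix. -/
noncomputable def corank {n : ℕ} {K : Type*} [Field K] (A : Matrix (Fin n) (Fin n) K) : ℕ :=
  n - A.rank

/-- The probability of the value `k` under the limiting corank law `Q_{sym,∞}` of symmetric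
matrices over a field with `q` elements:
`∏_{i ≥ 0} (1 - q^{-(2i+1)}) / ∏_{l=1}^k (q^l - 1)`. -/
noncomputable def symLimitProb (q k : ℕ) : ℝ :=
  (∏' i : ℕ, (1 - ((q : ℝ) ^ (2 * i + 1))⁻¹)) / ∏ l ∈ Finset.Icc 1 k, ((q : ℝ) ^ l - 1)

/-- The limiting corank law `Q_{sym,∞}` as a measure on `ℕ`. -/
noncomputable def symLimitLaw (q : ℕ) : Measure ℕ :=
  Measure.sum fun k => ENNReal.ofReal (symLimitProb q k) • Measure.dirac k

/-- The total variation distance `sup_A |μ(A) - ν(A)|` of two probability laws on `ℕ`. -/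
noncomputable def tvDist (μ ν : Measure ℕ) : ℝ :=
  ⨆ A : Set ℕ, |μ.real A - ν.real A|

/-- The positions on or above the diagonal that are not exceptional; position `(i, j)` is
exceptional when `j ∈ F i`. -/
abbrev RegularPos {n : ℕ} (F : Fin n → Finset (Fin n)) : Type :=
  {p : Fin n × Fin n // p.1 ≤ p.2 ∧ p.2 ∉ F p.1}

/-- The exceptional positions on or above the diagonal. -/
abbrev ExceptionalPos {n : ℕ} (F : Fin n → Finset (Fin n)) : Type :=
  {p : Fin n × Fin n // p.1 ≤ p.2 ∧ p.2 ∈ F p.1}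

/-- `M` is a random symmetric matrix over the finite field `K` whose regular entries on and above
the diagonal are mutually independent and near uniform with constant `C` (every value is taken with
probability at most `C / q`).  The exceptional entries have an arbitrary joint law, and are
independent of the regular ones. -/
structure IsNearUniformSymm {n : ℕ} {K : Type*} [Field K] [Fintype K] [MeasurableSpace K]
    {Ω : Type*} [MeasurableSpace Ω] (C : ℝ) (F : Fin n → Finset (Fin n)) (P : Measure Ω)
    (M : Ω → Matrix (Fin n) (Fin n) K) : Prop where
  measurable : ∀ i j, Measurable fun ω => M ω i j
  isSymm : ∀ ω, (M ω).IsSymm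
  near_uniform : ∀ p : RegularPos F, ∀ a : K,
    P.real {ω | M ω p.1.1 p.1.2 = a} ≤ C / (Fintype.card K : ℝ)
  indep_regular : iIndepFun (fun (p : RegularPos F) (ω : Ω) => M ω p.1.1 p.1.2) P
  indep_exceptional :
    IndepFun (fun (ω : Ω) (p : RegularPos F) => M ω p.1.1 p.1.2)
      (fun (ω : Ω) (p : ExceptionalPos F) => M ω p.1.1 p.1.2) P

/-! ### The limiting corank law -/

/-! The corank is studied through its moments: the expected number of linearly independent
`k`-tuples in the kernel, which is the sum of `P(M W = 0)` over `n × k` matrices `W` with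
independent columns. For the limiting law Euler's product identities give exactly `q ^ (k.choose
2)`. A tuple count vanishes when the corank is below `k`, so the moment equations are triangular; if
about `n / 200` moments agree up to a small relative error, the laws are close in total variation
(`tsum_abs_sub_le_of_moments`).

Fourier inversion writes `q ^ (n * k) * P(M W = 0)` as a sum over `T` of the expectations of `ψ ⟨T
Wᵀ, M⟩`. As `M` is symmetric, a term depends only on the quadratic form `x ↦ (Tᵀ x) ⬝ (Wᵀ x)`,
encoded by an upper triangular `U`. The `T` giving the zero form are `W A` with `A` alternating;
there are `q ^ (k.choose 2)` of them, and they give the main term. Grouping the rest by `U`, the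
error is governed by the sum over `U ≠ 0` of the weight of `U`, a product of moduli of
characteristic functions of regular entries, times the number of `W` through which `U` splits.

Two estimates compete. Let the polar form of `U` have rank `m` and let `U` have rank `r` as a
quadratic form. Splitting through `W` forces `h = r - ⌊m / 2⌋` independent combinations of the
columns of `W` into a space of dimension `r`, so the proportion of such `W` is at most `q ^ (-(n - k
- r) h)`, a gain of about `q ^ (-m n / 2)` (`pow_mul_splitCount_le`). Against this, Parseval bounds
the square sum of each regular characteristic function by `C`, and Cauchy–Schwarz over a block
structure bounds the total weight of symmetric matrices of rank `m` by about `q ^ (m n / 4)`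
(`exists_block`, `IsWeight.sum_offWeight_rank_le`). The gain wins. Diagonals cost only `q ^ m` when
the form vanishes on the radical of its polar form. Otherwise the characteristic is two and `r = m +
1`: the diagonal costs about `q ^ (n / 2)`, using that diagonal entries are regular, and the larger
`h` gains about another `q ^ (-n)`.

If `q` is bounded in terms of `C`, the claimed bound exceeds one. If `n < 200`, there are no
exceptional entries, and a first moment bound shows that both laws are concentrated at corank zero.
-/

theorem one_sub_sum_le_prod_one_sub {ι : Type*} (s : Finset ι) (x : ι → ℝ)
    (h0 : ∀ i ∈ s, 0 ≤ x i) (h1 : ∀ i ∈ s, x i ≤ 1) :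
    1 - ∑ i ∈ s, x i ≤ ∏ i ∈ s, (1 - x i) := by
  classical
  induction s using Finset.induction_on with
  | empty => simp
  | insert a s ha ih =>
    rw [Finset.sum_insert ha, Finset.prod_insert ha]
    have h2 := ih (fun i hi => h0 i (Finset.mem_insert_of_mem hi))
      (fun i hi => h1 i (Finset.mem_insert_of_mem hi))
    have h3 := h0 a (Finset.mem_insert_self a s)
    have h4 := h1 a (Finset.mem_insert_self a s)
    have h5 : 0 ≤ ∑ i ∈ s, x i := Finset.sum_nonneg fun i hi => h0 i (Finset.mem_insert_of_mem hi)
    nlinarith [mul_nonneg h3 h5, mul_le_mul_of_nonneg_left h2 (sub_nonneg.2 h4)]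

/-- The coefficients `1 / ∏_{l=1}^r (q^l - 1)`. -/
noncomputable def eulerCoeff (q : ℝ) (r : ℕ) : ℝ := (∏ l ∈ Finset.Icc 1 r, (q ^ l - 1))⁻¹

theorem eulerCoeff_zero (q : ℝ) : eulerCoeff q 0 = 1 := by simp [eulerCoeff]

theorem eulerCoeff_pos {q : ℝ} (hq : 1 < q) (r : ℕ) : 0 < eulerCoeff q r :=
  inv_pos.2 <| Finset.prod_pos fun l hl => by
    have := one_lt_pow₀ hq (n := l) (by have := (Finset.mem_Icc.1 hl).1; omega)
    linarith

theorem eulerCoeff_succ {q : ℝ} (hq : 1 < q) (r : ℕ) :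
    eulerCoeff q (r + 1) * (q ^ (r + 1) - 1) = eulerCoeff q r := by
  have h : q ^ (r + 1) - 1 ≠ 0 := by
    have := one_lt_pow₀ hq (n := r + 1) (by omega)
    linarith
  rw [eulerCoeff, eulerCoeff, Finset.prod_Icc_succ_top (by omega), mul_inv, mul_assoc,
    inv_mul_cancel₀ h, mul_one]

theorem summable_eulerCoeff_mul_pow {q : ℝ} (hq : 1 < q) (x : ℝ) :
    Summable fun r => eulerCoeff q r * x ^ r := by
  have hlim : Filter.Tendsto (fun r : ℕ => (q ^ (r + 1) - 1)) Filter.atTop Filter.atTop := by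
    have h1 := (tendsto_pow_atTop_atTop_of_one_lt hq).comp (Filter.tendsto_add_atTop_nat 1)
    exact Filter.tendsto_atTop_add_const_right _ (-1) h1
  refine summable_of_ratio_norm_eventually_le (r := 1 / 2) (by norm_num) ?_
  filter_upwards [hlim.eventually_ge_atTop (2 * |x|), hlim.eventually_gt_atTop 0] with r hr hr0
  have h2 := eulerCoeff_succ hq r
  have h3 := eulerCoeff_pos hq (r + 1)
  rw [norm_mul, norm_mul, norm_pow, norm_pow, pow_succ, Real.norm_eq_abs, Real.norm_eq_abs,
    Real.norm_eq_abs, abs_of_pos h3, abs_of_pos (eulerCoeff_pos hq r), ← h2]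
  have h4 : 0 ≤ eulerCoeff q (r + 1) * |x| ^ r := by positivity
  nlinarith [mul_le_mul_of_nonneg_left hr h4]

/-- Euler's series `∑ x^r / ∏_{l=1}^r (q^l - 1)`. -/
noncomputable def eulerSeries (q x : ℝ) : ℝ := ∑' r, eulerCoeff q r * x ^ r

/-- The coefficient recursion says `c (r + 1) * q ^ (r + 1) - c (r + 1) = c r`. Iterating the
resulting functional equation at `x = q⁻¹, q⁻², …` turns the series at `1` into the product of the
`1 + q⁻ⁱ`. -/
theorem eulerSeries_mul {q : ℝ} (hq : 1 < q) (x : ℝ) :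
    eulerSeries q (q * x) = (1 + x) * eulerSeries q x := by
  have h1 := summable_eulerCoeff_mul_pow hq x
  have h2 := summable_eulerCoeff_mul_pow hq (q * x)
  have h3 : eulerSeries q (q * x) - eulerSeries q x = x * eulerSeries q x := by
    rw [eulerSeries, eulerSeries, ← h2.tsum_sub h1, (h2.sub h1).tsum_eq_zero_add, ← tsum_mul_left]
    simp only [pow_zero, sub_self, zero_add]
    refine tsum_congr fun r => ?_
    rw [← eulerCoeff_succ hq r, mul_pow]
    ring
  linarith

theorem eulerSeries_one {q : ℝ} (hq : 1 < q) (N : ℕ) :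
    eulerSeries q 1 =
      (∏ i ∈ Finset.range N, (1 + (q ^ (i + 1))⁻¹)) * eulerSeries q (q ^ N)⁻¹ := by
  induction N with
  | zero => simp
  | succ N ih =>
    have h := eulerSeries_mul hq (q ^ (N + 1))⁻¹
    have h2 : q * (q ^ (N + 1))⁻¹ = (q ^ N)⁻¹ := by
      rw [pow_succ]
      field_simp
    rw [h2] at h
    rw [ih, h, Finset.prod_range_succ]
    ring

theorem eulerSeries_tendsto {q : ℝ} (hq : 1 < q) :
    Filter.Tendsto (fun N : ℕ => eulerSeries q (q ^ N)⁻¹) Filter.atTop (nhds 1) := by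
  have hs : Summable (fun r => eulerCoeff q r) := by simpa using summable_eulerCoeff_mul_pow hq 1
  have hlim : Filter.Tendsto (fun N : ℕ => (q ^ N)⁻¹) Filter.atTop (nhds 0) :=
    (tendsto_pow_atTop_atTop_of_one_lt hq).inv_tendsto_atTop
  have h1 : Filter.Tendsto (fun N : ℕ => 1 + (q ^ N)⁻¹ * ∑' r, eulerCoeff q r) Filter.atTop
      (nhds 1) := by
    simpa using (hlim.mul_const (∑' r, eulerCoeff q r)).const_add 1
  refine tendsto_of_tendsto_of_tendsto_of_le_of_le tendsto_const_nhds h1 (fun N => ?_) fun N => ?_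
  · have h2 := (summable_eulerCoeff_mul_pow hq (q ^ N)⁻¹).le_tsum 0 fun r _ =>
      mul_nonneg (eulerCoeff_pos hq r).le (by positivity)
    simpa [eulerSeries, eulerCoeff_zero] using h2
  · have hx0 : 0 ≤ (q ^ N)⁻¹ := by positivity
    have hx1 : (q ^ N)⁻¹ ≤ 1 := inv_le_one_of_one_le₀ (one_le_pow₀ hq.le)
    rw [eulerSeries, (summable_eulerCoeff_mul_pow hq (q ^ N)⁻¹).tsum_eq_zero_add,
      hs.tsum_eq_zero_add, eulerCoeff_zero, pow_zero, mul_one]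
    have hs' : Summable fun r => eulerCoeff q (r + 1) := (summable_nat_add_iff 1).2 hs
    have h3 : ∑' r, eulerCoeff q (r + 1) * (q ^ N)⁻¹ ^ (r + 1) ≤
        (q ^ N)⁻¹ * ∑' r, eulerCoeff q (r + 1) := by
      rw [← tsum_mul_left]
      refine Summable.tsum_le_tsum (fun r => ?_)
        ((summable_nat_add_iff 1).2 (summable_eulerCoeff_mul_pow hq (q ^ N)⁻¹)) (hs'.mul_left _)
      rw [pow_succ, mul_comm ((q ^ N)⁻¹) (eulerCoeff q (r + 1))]
      refine mul_le_mul_of_nonneg_left ?_ (eulerCoeff_pos hq _).le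
      exact mul_le_of_le_one_left hx0 (pow_le_one₀ hx0 hx1)
    nlinarith

/-- Finite form of Euler's identity between partitions into odd and into distinct parts. Passing
from `N` to `N + 1` moves the window of exponents from `N + 1, …, 2 N` to `N + 2, …, 2 N + 2`, and
the difference of squares supplies the last factor. -/
theorem prod_odd_mul_prod_one_add {q : ℝ} (hq : 1 < q) (N : ℕ) :
    (∏ i ∈ Finset.range N, (1 - (q ^ (2 * i + 1))⁻¹)) *
      (∏ i ∈ Finset.range N, (1 + (q ^ (i + 1))⁻¹)) =
        ∏ i ∈ Finset.range N, (1 - (q ^ (N + i + 1))⁻¹) := by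
  induction N with
  | zero => simp
  | succ N ih =>
    have h0 : (1 - (q ^ (N + 1))⁻¹) ≠ 0 := by
      have := inv_lt_one_of_one_lt₀ (one_lt_pow₀ hq (n := N + 1) (by omega))
      linarith
    have hq0 : q ≠ 0 := by linarith
    have h1 : ∏ i ∈ Finset.range (N + 1), (1 - (q ^ (N + i + 1))⁻¹) =
        (1 - (q ^ (N + 1))⁻¹) * ∏ i ∈ Finset.range N, (1 - (q ^ (N + 1 + i + 1))⁻¹) := by
      rw [Finset.prod_range_succ', mul_comm]
      congr 1
      exact Finset.prod_congr rfl fun i _ => by rw [show N + (i + 1) + 1 = N + 1 + i + 1 by ring]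
    have h2 : ∏ i ∈ Finset.range (N + 1), (1 - (q ^ (N + i + 1))⁻¹) =
        (∏ i ∈ Finset.range N, (1 - (q ^ (N + i + 1))⁻¹)) * (1 - (q ^ (2 * N + 1))⁻¹) := by
      rw [Finset.prod_range_succ, two_mul]
    have h3 : (1 - (q ^ (N + 1))⁻¹) * (1 + (q ^ (N + 1))⁻¹) = 1 - (q ^ (2 * N + 2))⁻¹ := by
      rw [show 2 * N + 2 = (N + 1) * 2 by ring, pow_mul]
      ring
    apply mul_left_cancel₀ h0
    rw [Finset.prod_range_succ, Finset.prod_range_succ]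
    calc _ = ((∏ i ∈ Finset.range N, (1 - (q ^ (2 * i + 1))⁻¹)) *
          (∏ i ∈ Finset.range N, (1 + (q ^ (i + 1))⁻¹))) * (1 - (q ^ (2 * N + 1))⁻¹) *
          ((1 - (q ^ (N + 1))⁻¹) * (1 + (q ^ (N + 1))⁻¹)) := by ring
      _ = _ := by
        rw [ih, ← h2, h1, h3, Finset.prod_range_succ,
          show N + 1 + N + 1 = 2 * N + 2 by ring]
        ring

/-- This is the normalisation of the limiting law. The defect product in the finite identity lies
between `1 - N q⁻ᴺ` and `1`, so it disappears in the limit. -/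
theorem tprod_odd_mul_eulerSeries {q : ℝ} (hq : 1 < q) :
    (∏' i : ℕ, (1 - (q ^ (2 * i + 1))⁻¹)) * eulerSeries q 1 = 1 := by
  have hsum : Summable fun i : ℕ => -(q ^ (2 * i + 1))⁻¹ := by
    refine Summable.neg ?_
    have h := (summable_geometric_of_lt_one (r := q⁻¹) (by positivity)
      (inv_lt_one_of_one_lt₀ hq)).comp_injective (i := fun i : ℕ => 2 * i + 1)
      (fun a b h => by simpa using h)
    simpa [Function.comp_def, inv_pow] using h
  have hmul := (multipliable_one_add_of_summable hsum.norm).hasProd.tendsto_prod_nat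
  simp only [← sub_eq_add_neg] at hmul
  have h1 : Filter.Tendsto (fun N => ∏ i ∈ Finset.range N, (1 - (q ^ (N + i + 1))⁻¹))
      Filter.atTop (nhds 1) := by
    have h2 : Filter.Tendsto (fun N : ℕ => 1 - (N : ℝ) * (q⁻¹) ^ N) Filter.atTop (nhds 1) := by
      simpa using (tendsto_self_mul_const_pow_of_lt_one (r := q⁻¹) (by positivity)
        (inv_lt_one_of_one_lt₀ hq)).const_sub 1
    have hle : ∀ N i : ℕ, (q ^ (N + i + 1))⁻¹ ≤ 1 := fun N i =>
      inv_le_one_of_one_le₀ (one_le_pow₀ hq.le)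
    refine tendsto_of_tendsto_of_tendsto_of_le_of_le h2 tendsto_const_nhds (fun N => ?_) fun N => ?_
    · refine le_trans ?_ (one_sub_sum_le_prod_one_sub (Finset.range N) _
        (fun i _ => by positivity) fun i _ => hle N i)
      have : ∑ i ∈ Finset.range N, (q ^ (N + i + 1))⁻¹ ≤ ∑ i ∈ Finset.range N, (q⁻¹) ^ N := by
        refine Finset.sum_le_sum fun i _ => ?_
        rw [inv_pow]
        exact inv_anti₀ (by positivity) (pow_le_pow_right₀ hq.le (by omega))
      simp only [Finset.sum_const, Finset.card_range, nsmul_eq_mul] at this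
      simp only
      linarith
    · exact Finset.prod_le_one (fun i _ => sub_nonneg.2 (hle N i)) fun i _ => by
        have : 0 ≤ (q ^ (N + i + 1))⁻¹ := by positivity
        linarith
  have h3 := hmul.mul_const (eulerSeries q 1)
  have h4 := h1.mul (eulerSeries_tendsto hq)
  rw [mul_one] at h4
  refine tendsto_nhds_unique h3 (h4.congr fun N => ?_)
  rw [eulerSeries_one hq N, ← mul_assoc, prod_odd_mul_prod_one_add hq]

theorem symLimitProb_eq (q k : ℕ) :
    symLimitProb q k = (∏' i : ℕ, (1 - ((q : ℝ) ^ (2 * i + 1))⁻¹)) * eulerCoeff q k := rfl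

theorem hasSum_symLimitProb {q : ℕ} (hq : 1 < q) : HasSum (symLimitProb q) 1 := by
  have hq' : (1 : ℝ) < q := by exact_mod_cast hq
  have h := (summable_eulerCoeff_mul_pow hq' 1).hasSum.mul_left
    (∏' i : ℕ, (1 - ((q : ℝ) ^ (2 * i + 1))⁻¹))
  have h2 := tprod_odd_mul_eulerSeries hq'
  rw [eulerSeries] at h2
  rw [h2] at h
  simpa [← symLimitProb_eq] using h

theorem symLimitProb_nonneg {q : ℕ} (hq : 1 < q) (k : ℕ) : 0 ≤ symLimitProb q k := by
  have hq' : (1 : ℝ) < q := by exact_mod_cast hq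
  have h2 := tprod_odd_mul_eulerSeries hq'
  have h3 : 0 ≤ eulerSeries q 1 :=
    tsum_nonneg fun r => mul_nonneg (eulerCoeff_pos hq' r).le (by simp)
  rw [symLimitProb_eq]
  refine mul_nonneg ?_ (eulerCoeff_pos hq' k).le
  -- The infinite product times a nonnegative series equals `1`, so it cannot be negative.
  by_contra! h
  nlinarith

/-- The number `∏_{i<k} (q^r - q^i)` of linearly independent `k`-tuples in an `r`-dimensional
space over the field with `q` elements. -/
noncomputable def indepCount (q : ℝ) (k r : ℕ) : ℝ := ∏ i ∈ Finset.range k, (q ^ r - q ^ i)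

theorem indepCount_eq_zero (q : ℝ) {k r : ℕ} (h : r < k) : indepCount q k r = 0 :=
  Finset.prod_eq_zero (Finset.mem_range.2 h) (sub_self _)

theorem indepCount_nonneg {q : ℝ} (hq : 1 ≤ q) (k r : ℕ) : 0 ≤ indepCount q k r := by
  rcases lt_or_ge r k with h | h
  · rw [indepCount_eq_zero q h]
  · exact Finset.prod_nonneg fun i hi =>
      sub_nonneg.2 (pow_le_pow_right₀ hq (by have := Finset.mem_range.1 hi; omega))

/-- After extracting `q ^ i` from each factor, the tuple count is `q ^ (k.choose 2)` times the top
`k` factors of the Euler denominator, which cancel. -/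
theorem eulerCoeff_mul_indepCount {q : ℝ} (hq : 1 < q) (k r : ℕ) :
    eulerCoeff q (r + k) * indepCount q k (r + k) = q ^ (k.choose 2) * eulerCoeff q r := by
  induction k generalizing r with
  | zero => simp [indepCount]
  | succ k ih =>
    have h1 : indepCount q (k + 1) (r + (k + 1)) =
        indepCount q k (r + 1 + k) * (q ^ k * (q ^ (r + 1) - 1)) := by
      rw [indepCount, Finset.prod_range_succ, indepCount, show r + (k + 1) = r + 1 + k by ring]
      congr 1
      rw [pow_add]
      ring
    rw [h1, ← mul_assoc, show r + (k + 1) = r + 1 + k by ring, ih, ← eulerCoeff_succ hq r,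
      show (k + 1).choose 2 = k.choose 2 + k by
        rw [Nat.choose_succ_succ' k 1, Nat.choose_one_right, add_comm], pow_add]
    ring

/-- The terms below `k` vanish, and the remaining ones are `q ^ (k.choose 2)` times the limiting law
shifted by `k`, whose total mass is one. -/
theorem hasSum_symLimitProb_mul_indepCount {q : ℕ} (hq : 1 < q) (k : ℕ) :
    HasSum (fun r => symLimitProb q r * indepCount q k r) ((q : ℝ) ^ (k.choose 2)) := by
  have hq' : (1 : ℝ) < q := by exact_mod_cast hq
  rw [← hasSum_nat_add_iff' k]
  have h0 : ∑ i ∈ Finset.range k, symLimitProb q i * indepCount q k i = 0 :=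
    Finset.sum_eq_zero fun i hi => by rw [indepCount_eq_zero _ (Finset.mem_range.1 hi), mul_zero]
  rw [h0, sub_zero]
  have h := (hasSum_symLimitProb hq).mul_left ((q : ℝ) ^ (k.choose 2))
  rw [mul_one] at h
  refine h.congr_fun fun r => ?_
  simp only [symLimitProb_eq]
  rw [mul_assoc, eulerCoeff_mul_indepCount hq']
  ring

/-! ### Total variation distance on `ℕ` -/

theorem symLimitLaw_real {q : ℕ} (hq : 1 < q) (A : Set ℕ) :
    (symLimitLaw q).real A = ∑' k, A.indicator (symLimitProb q) k := by
  rw [Measure.real, symLimitLaw, Measure.sum_apply _ A.to_countable.measurableSet,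
    ENNReal.tsum_toReal_eq]
  · refine tsum_congr fun k => ?_
    by_cases hk : k ∈ A <;> simp [hk, symLimitProb_nonneg hq k]
  · intro k
    by_cases hk : k ∈ A <;> simp [hk]

theorem hasSum_indicator_real (μ : Measure ℕ) [IsFiniteMeasure μ] (A : Set ℕ) :
    HasSum (A.indicator fun k => μ.real {k}) (μ.real A) := by
  have h1 := Measure.tsum_indicator_apply_singleton μ A A.to_countable.measurableSet
  have h2 : ∀ k, A.indicator (fun k => μ {k}) k ≠ ⊤ := fun k => by
    by_cases hk : k ∈ A <;> simp [hk]
  have h3 : ∀ k, (A.indicator (fun k => μ {k}) k).toReal = A.indicator (fun k => μ.real {k}) k :=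
    fun k => by by_cases hk : k ∈ A <;> simp [hk, Measure.real]
  have h4 : ∑' k, A.indicator (fun k => μ {k}) k ≠ ⊤ := by
    rw [h1]
    exact measure_ne_top μ A
  have h5 := ENNReal.hasSum_toReal h4
  rw [← ENNReal.tsum_toReal_eq h2, h1] at h5
  simp only [h3] at h5
  exact h5

theorem hasSum_real_singleton (μ : Measure ℕ) [IsProbabilityMeasure μ] :
    HasSum (fun k => μ.real {k}) 1 := by
  simpa using hasSum_indicator_real μ Set.univ

theorem abs_real_sub_symLimitLaw_le (μ : Measure ℕ) [IsProbabilityMeasure μ] {q : ℕ} (hq : 1 < q)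
    (A : Set ℕ) :
    |μ.real A - (symLimitLaw q).real A| ≤ ∑' k, |μ.real {k} - symLimitProb q k| := by
  have h1 := hasSum_indicator_real μ A
  have hs := (hasSum_symLimitProb hq).summable
  have habs : Summable fun k => |μ.real {k} - symLimitProb q k| :=
    ((hasSum_real_singleton μ).summable.sub hs).abs
  have h2 := h1.sub (hs.indicator A).hasSum
  rw [symLimitLaw_real hq, ← h2.tsum_eq]
  have hle : ∀ k, |A.indicator (fun k => μ.real {k}) k - A.indicator (symLimitProb q) k| ≤
      |μ.real {k} - symLimitProb q k| := fun k => by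
    by_cases hk : k ∈ A <;> simp [hk]
  have habs' : Summable fun k =>
      |A.indicator (fun k => μ.real {k}) k - A.indicator (symLimitProb q) k| :=
    habs.of_nonneg_of_le (fun _ => abs_nonneg _) hle
  simp only [← Real.norm_eq_abs] at habs' hle habs ⊢
  exact (norm_tsum_le_tsum_norm habs').trans (habs'.tsum_le_tsum hle habs)

theorem tvDist_le_tsum (μ : Measure ℕ) [IsProbabilityMeasure μ] {q : ℕ} (hq : 1 < q) :
    tvDist μ (symLimitLaw q) ≤ ∑' k, |μ.real {k} - symLimitProb q k| := by
  rw [tvDist]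
  exact ciSup_le fun A => abs_real_sub_symLimitLaw_le μ hq A

theorem tvDist_le_one (μ : Measure ℕ) [IsProbabilityMeasure μ] {q : ℕ} (hq : 1 < q) :
    tvDist μ (symLimitLaw q) ≤ 1 := by
  rw [tvDist]
  refine ciSup_le fun A => ?_
  have h1 : (symLimitLaw q).real A ≤ 1 := by
    rw [symLimitLaw_real hq, ← (hasSum_symLimitProb hq).tsum_eq]
    have hle : ∀ k, A.indicator (symLimitProb q) k ≤ symLimitProb q k := fun k => by
      by_cases hk : k ∈ A <;> simp [hk, symLimitProb_nonneg hq k]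
    exact ((hasSum_symLimitProb hq).summable.indicator A).tsum_le_tsum hle
      (hasSum_symLimitProb hq).summable
  have h2 : 0 ≤ (symLimitLaw q).real A := measureReal_nonneg
  have h3 : 0 ≤ μ.real A := measureReal_nonneg
  have h4 : μ.real A ≤ 1 := measureReal_le_one
  rw [abs_le]
  constructor <;> linarith

/-! ### From moments to total variation -/

theorem sum_range_sixteen_pow_le (j : ℕ) :
    ∑ i ∈ Finset.range j, (16 : ℝ) ^ (j - i) ≤ 16 ^ (j + 1) / 15 := by
  induction j with
  | zero => simp; norm_num
  | succ j ih =>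
    rw [Finset.sum_range_succ']
    simp only [Nat.add_sub_add_right, Nat.sub_zero]
    have : (16 : ℝ) ^ (j + 1 + 1) = 16 * 16 ^ (j + 1) := by ring
    linarith

theorem sum_range_pow_le_two {x : ℝ} (h0 : 0 ≤ x) (h1 : x ≤ 1 / 2) (j : ℕ) :
    ∑ i ∈ Finset.range j, x ^ i ≤ 2 := by
  have h := (summable_geometric_of_lt_one h0 (by linarith)).sum_le_tsum (Finset.range j)
    fun i _ => pow_nonneg h0 i
  rw [tsum_geometric_of_lt_one h0 (by linarith)] at h
  refine h.trans ?_
  rw [inv_le_comm₀ (by linarith) (by norm_num)]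
  linarith

/-- Induction on the distance `K - 1 - k` from the top. Allowing growth by `16` per step makes the
feedback sum geometric: it contributes at most `64 x ε ≤ ε` and `(32 / 15) (16 x) ^ (K - k)`, and
`12 + 32 / 15 < 16`. -/
theorem le_of_backward_recursion {x ε : ℝ} (hx0 : 0 ≤ x) (hx : x ≤ 1 / 64) (hε : 0 ≤ ε) (K : ℕ)
    (a : ℕ → ℝ)
    (h : ∀ k < K, a k ≤ 2 * ε + 12 * x ^ (K - k) + 2 * ∑ r ∈ Finset.Ico (k + 1) K, a r * x ^ (r - k)) :
    ∀ k < K, a k ≤ 16 * (ε + (16 * x) ^ (K - k)) := by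
  have key : ∀ j k, k + 1 + j = K → a k ≤ 16 * (ε + (16 * x) ^ (K - k)) := by
    intro j
    induction j using Nat.strong_induction_on with
    | _ j ih =>
    intro k hk
    have h1 : ∑ r ∈ Finset.Ico (k + 1) K, a r * x ^ (r - k) ≤
        ∑ i ∈ Finset.range j, (16 * ε * x * x ^ i + 16 * (x ^ (j + 1) * 16 ^ (j - i))) := by
      rw [Finset.sum_Ico_eq_sum_range, show K - (k + 1) = j by omega]
      refine Finset.sum_le_sum fun i hi => ?_
      have hi' := Finset.mem_range.1 hi
      have h2 := ih (j - 1 - i) (by omega) (k + 1 + i) (by omega)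
      rw [show k + 1 + i - k = i + 1 by omega]
      refine (mul_le_mul_of_nonneg_right h2 (pow_nonneg hx0 _)).trans (le_of_eq ?_)
      rw [show K - (k + 1 + i) = j - i by omega, show x ^ (j + 1) = x ^ (j - i) * x ^ (i + 1) by
        rw [← pow_add]; congr 1; omega, mul_pow]
      ring
    rw [Finset.sum_add_distrib, ← Finset.mul_sum, ← Finset.mul_sum, ← Finset.mul_sum] at h1
    have h2 := sum_range_sixteen_pow_le j
    have h3 := sum_range_pow_le_two hx0 (by linarith) j
    have h4 := h k (by omega)
    rw [show K - k = j + 1 by omega] at h4 ⊢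
    have hxj : 0 ≤ x ^ (j + 1) := by positivity
    have h5 : x ^ (j + 1) * ∑ i ∈ Finset.range j, (16 : ℝ) ^ (j - i) ≤
        x ^ (j + 1) * (16 ^ (j + 1) / 15) := mul_le_mul_of_nonneg_left h2 hxj
    have h6 : 16 * ε * x * ∑ i ∈ Finset.range j, x ^ i ≤ 16 * ε * x * 2 :=
      mul_le_mul_of_nonneg_left h3 (by positivity)
    have h7 : ε * x ≤ ε * (1 / 64) := mul_le_mul_of_nonneg_left hx hε
    have h8 : (1 : ℝ) ≤ 16 ^ (j + 1) := one_le_pow₀ (by norm_num)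
    have h9 : x ^ (j + 1) * 1 ≤ x ^ (j + 1) * 16 ^ (j + 1) := mul_le_mul_of_nonneg_left h8 hxj
    have h10 : (16 * x) ^ (j + 1) = x ^ (j + 1) * 16 ^ (j + 1) := by rw [mul_pow, mul_comm]
    rw [h10]
    linarith
  intro k hk
  exact key (K - (k + 1)) k (by omega)

/-- Each factor is `q ^ K (1 - q ^ (-(K - i)))`, and for `q ≥ 4` the geometric sum of the defects is
at most `1 / 2`. -/
theorem half_pow_le_prod_sub {q : ℝ} (hq : 4 ≤ q) (k K : ℕ) :
    q ^ (K * (K - k)) / 2 ≤ ∏ i ∈ Finset.Ico k K, (q ^ K - q ^ i) := by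
  have hq0 : 0 < q := by linarith
  have hx : q⁻¹ ≤ 1 / 4 := by
    rw [inv_le_comm₀ hq0 (by norm_num)]
    simpa using hq
  have h1 : ∏ i ∈ Finset.Ico k K, (q ^ K - q ^ i) =
      q ^ (K * (K - k)) * ∏ i ∈ Finset.Ico k K, (1 - q⁻¹ ^ (K - i)) := by
    rw [pow_mul, ← Nat.card_Ico k K, ← Finset.prod_const, ← Finset.prod_mul_distrib]
    refine Finset.prod_congr rfl fun i hi => ?_
    have hi' := Finset.mem_Ico.1 hi
    rw [mul_sub, mul_one]
    congr 1
    rw [inv_pow, eq_mul_inv_iff_mul_eq₀ (by positivity), ← pow_add]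
    congr 1
    omega
  have hx0 : 0 ≤ q⁻¹ := by positivity
  have h2 := one_sub_sum_le_prod_one_sub (Finset.Ico k K) (fun i => q⁻¹ ^ (K - i))
    (fun i _ => by positivity) (fun i _ => pow_le_one₀ hx0 (by linarith))
  have h3 : ∑ i ∈ Finset.Ico k K, q⁻¹ ^ (K - i) ≤ 1 / 2 := by
    calc ∑ i ∈ Finset.Ico k K, q⁻¹ ^ (K - i)
        ≤ ∑ i ∈ Finset.range K, q⁻¹ ^ (K - i) :=
          Finset.sum_le_sum_of_subset_of_nonneg (fun i hi => by
            simp only [Finset.mem_Ico, Finset.mem_range] at hi ⊢; omega) fun i _ _ => by positivity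
      _ = ∑ i ∈ Finset.range K, q⁻¹ * q⁻¹ ^ i := by
          rw [← Finset.sum_range_reflect]
          refine Finset.sum_congr rfl fun i hi => ?_
          have := Finset.mem_range.1 hi
          rw [← pow_succ']
          congr 1
          omega
      _ ≤ 1 / 2 := by
          rw [← Finset.mul_sum]
          have := sum_range_pow_le_two hx0 (by linarith) K
          nlinarith
  rw [h1]
  have h4 : 0 < q ^ (K * (K - k)) := by positivity
  nlinarith

theorem half_pow_le_indepCount_self {q : ℝ} (hq : 4 ≤ q) (k : ℕ) :
    q ^ (k * k) / 2 ≤ indepCount q k k := by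
  rw [indepCount, Finset.range_eq_Ico]
  exact half_pow_le_prod_sub hq 0 k

theorem indepCount_le_pow {q : ℝ} (hq : 1 ≤ q) {k r : ℕ} (h : k ≤ r) :
    indepCount q k r ≤ q ^ (r * k) := by
  rw [pow_mul, ← Finset.card_range k, ← Finset.prod_const, Finset.card_range]
  refine Finset.prod_le_prod (fun i hi => ?_) fun i _ => ?_
  · exact sub_nonneg.2 (pow_le_pow_right₀ hq ((Finset.mem_range.1 hi).le.trans h))
  · have : 0 ≤ q ^ i := by positivity
    linarith

/-- A Markov-type comparison: for values at least `K`, the `k`-th count is dominated by the `K`-th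
one, so the top moment controls the tails of all lower moments. -/
theorem indepCount_mul_le {q : ℝ} (hq : 4 ≤ q) {k K r : ℕ} (hk : k ≤ K) (hr : K ≤ r) :
    q ^ (K * (K - k)) / 2 * indepCount q k r ≤ indepCount q K r := by
  have hq1 : 1 ≤ q := by linarith
  have h1 : indepCount q K r = (∏ i ∈ Finset.Ico k K, (q ^ r - q ^ i)) * indepCount q k r := by
    rw [indepCount, indepCount, ← Finset.prod_range_mul_prod_Ico _ hk, mul_comm]
  rw [h1]
  refine mul_le_mul_of_nonneg_right ?_ (indepCount_nonneg hq1 k r)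
  refine (half_pow_le_prod_sub hq k K).trans (Finset.prod_le_prod (fun i hi => ?_) fun i hi => ?_)
  · exact sub_nonneg.2 (pow_le_pow_right₀ hq1 (Finset.mem_Ico.1 hi).2.le)
  · exact sub_le_sub_right (pow_le_pow_right₀ hq1 hr) _

theorem choose_two_add (k j : ℕ) :
    (k + j).choose 2 = k.choose 2 + j.choose 2 + k * j := by
  induction j with
  | zero => simp
  | succ j ih =>
    have h : ∀ m : ℕ, (m + 1).choose 2 = m.choose 2 + m := fun m => by
      rw [Nat.choose_succ_succ' m 1, Nat.choose_one_right, add_comm]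
    rw [← add_assoc, h, ih, h]
    ring

theorem self_le_choose_two_succ (j : ℕ) : j ≤ (j + 1).choose 2 := by
  rw [choose_two_add]
  simp

theorem choose_two_succ_add (k : ℕ) : (k + 1).choose 2 + k.choose 2 = k * k := by
  induction k with
  | zero => simp
  | succ k ih =>
    have h : ∀ m : ℕ, (m + 1).choose 2 = m.choose 2 + m := fun m => by
      rw [Nat.choose_succ_succ' m 1, Nat.choose_one_right, add_comm]
    have h1 := h k
    have h2 := h (k + 1)
    nlinarith

/-- A probability law on `ℕ` whose first `K` factorial-type moments are close to those of `π` is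
close to `π` in total variation. -/
theorem tsum_abs_sub_le_of_moments {q ε : ℝ} (hq : 64 ≤ q) (hε0 : 0 ≤ ε) (hε1 : ε ≤ 1)
    (p π : ℕ → ℝ) (hp : ∀ r, 0 ≤ p r) (hπ : ∀ r, 0 ≤ π r) (K : ℕ) (m : ℕ → ℝ)
    (hpm : ∀ k ≤ K, HasSum (fun r => p r * indepCount q k r) (m k))
    (hπm : ∀ k ≤ K, HasSum (fun r => π r * indepCount q k r) (q ^ (k.choose 2)))
    (hm : ∀ k ≤ K, |m k - q ^ (k.choose 2)| ≤ ε * q ^ (k.choose 2)) :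
    ∑' r, |p r - π r| ≤ 40 * (ε + (16 * q⁻¹) ^ K) := by
  have hq1 : 1 ≤ q := by linarith
  have hq0 : 0 < q := by linarith
  have hx0 : 0 ≤ q⁻¹ := by positivity
  have hx : q⁻¹ ≤ 1 / 64 := by
    rw [inv_le_comm₀ hq0 (by norm_num)]
    simpa using hq
  have hg := fun k r => indepCount_nonneg hq1 k r
  have hsum : ∀ k ≤ K, Summable fun r => |p r - π r| * indepCount q k r := fun k hk => by
    refine (((hpm k hk).summable.sub (hπm k hk).summable).abs).congr fun r => ?_
    rw [← sub_mul, abs_mul, abs_of_nonneg (hg k r)]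
  -- the contribution of large values
  have htail : ∀ k ≤ K, ∑' r, |p (r + K) - π (r + K)| * indepCount q k (r + K) ≤
      6 * (q ^ (k.choose 2) * q⁻¹ ^ (K - k)) := by
    intro k hk
    have h1 : ∀ r, |p (r + K) - π (r + K)| * indepCount q k (r + K) ≤
        2 * (q ^ (K * (K - k)))⁻¹ *
          (p (r + K) * indepCount q K (r + K) + π (r + K) * indepCount q K (r + K)) := by
      intro r
      have h2 := indepCount_mul_le (by linarith : 4 ≤ q) hk (Nat.le_add_left K r)
      have h3 : |p (r + K) - π (r + K)| ≤ p (r + K) + π (r + K) :=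
        (abs_sub _ _).trans (by rw [abs_of_nonneg (hp _), abs_of_nonneg (hπ _)])
      have h4 : indepCount q k (r + K) ≤ 2 * (q ^ (K * (K - k)))⁻¹ * indepCount q K (r + K) := by
        have h5 : 0 < q ^ (K * (K - k)) := by positivity
        rw [mul_comm 2, mul_assoc, ← div_eq_inv_mul, le_div_iff₀ h5]
        linarith
      calc _ ≤ (p (r + K) + π (r + K)) * (2 * (q ^ (K * (K - k)))⁻¹ * indepCount q K (r + K)) :=
            mul_le_mul h3 h4 (hg _ _) (add_nonneg (hp _) (hπ _))
        _ = _ := by ring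
    have hshift : ∀ (s : ℕ → ℝ) (t : ℝ), HasSum (fun r => s r * indepCount q K r) t →
        HasSum (fun r => s (r + K) * indepCount q K (r + K)) t := by
      intro s t hs
      have h := (hasSum_nat_add_iff' (f := fun r => s r * indepCount q K r) K).2 hs
      rwa [Finset.sum_eq_zero, sub_zero] at h
      intro i hi
      rw [indepCount_eq_zero _ (Finset.mem_range.1 hi), mul_zero]
    have h6 := ((hshift p _ (hpm K le_rfl)).add (hshift π _ (hπm K le_rfl))).mul_left
      (2 * (q ^ (K * (K - k)))⁻¹)
    have h7 := Summable.tsum_le_tsum h1 ((summable_nat_add_iff K).2 (hsum k hk)) h6.summable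
    rw [h6.tsum_eq] at h7
    refine h7.trans ?_
    have h8 : m K ≤ 2 * q ^ (K.choose 2) := by
      have h9 := (abs_le.1 (hm K le_rfl)).2
      have h10 : ε * q ^ (K.choose 2) ≤ 1 * q ^ (K.choose 2) := by gcongr
      linarith
    have h11 : (q ^ (K * (K - k)))⁻¹ * q ^ (K.choose 2) ≤ q ^ (k.choose 2) * q⁻¹ ^ (K - k) := by
      rw [inv_pow, ← div_eq_inv_mul, ← div_eq_mul_inv, div_le_div_iff₀ (by positivity)
        (by positivity), ← pow_add, ← pow_add]
      refine pow_le_pow_right₀ hq1 ?_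
      obtain ⟨j, rfl⟩ := Nat.exists_eq_add_of_le hk
      have h12 := choose_two_add k j
      have h13 := choose_two_succ_add j
      have h14 := self_le_choose_two_succ j
      rw [Nat.add_sub_cancel_left]
      nlinarith
    have h15 : 0 ≤ (q ^ (K * (K - k)))⁻¹ := by positivity
    nlinarith [mul_le_mul_of_nonneg_left h8 h15]
  -- the recursion
  have hrec : ∀ k < K, |p k - π k| * q ^ ((k + 1).choose 2) ≤ 2 * ε + 12 * q⁻¹ ^ (K - k) +
      2 * ∑ r ∈ Finset.Ico (k + 1) K, |p r - π r| * q ^ ((r + 1).choose 2) * q⁻¹ ^ (r - k) := by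
    intro k hk
    have h1 := (hpm k hk.le).sub (hπm k hk.le)
    have h2 := (hasSum_nat_add_iff' K).2 h1
    -- Triangularity: the `k`-th count vanishes below `k`, so the moment difference isolates the
    -- value at `k`, up to values in `(k, K)` and the tail.
    have h3 : ∑ i ∈ Finset.range K, (p i * indepCount q k i - π i * indepCount q k i) =
        (p k - π k) * indepCount q k k +
          ∑ i ∈ Finset.Ico (k + 1) K, (p i - π i) * indepCount q k i := by
      rw [← Finset.sum_range_add_sum_Ico _ hk, Finset.sum_range_succ, Finset.sum_eq_zero, zero_add]
      · simp only [sub_mul]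
      · intro i hi
        rw [indepCount_eq_zero _ (Finset.mem_range.1 hi), mul_zero, mul_zero, sub_zero]
    rw [h3] at h2
    have h4 : |∑' r, (p (r + K) * indepCount q k (r + K) - π (r + K) * indepCount q k (r + K))| ≤
        6 * (q ^ (k.choose 2) * q⁻¹ ^ (K - k)) := by
      refine le_trans ?_ (htail k hk.le)
      have h5 : ∀ r, |p (r + K) - π (r + K)| * indepCount q k (r + K) =
          ‖p (r + K) * indepCount q k (r + K) - π (r + K) * indepCount q k (r + K)‖ := fun r => by
        rw [← sub_mul, Real.norm_eq_abs, abs_mul, abs_of_nonneg (hg _ _)]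
      have h6 := (summable_nat_add_iff K).2 (hsum k hk.le)
      simp only [h5] at h6 ⊢
      exact norm_tsum_le_tsum_norm h6
    rw [h2.tsum_eq] at h4
    have h7 : |∑ i ∈ Finset.Ico (k + 1) K, (p i - π i) * indepCount q k i| ≤
        q ^ (k.choose 2) * ∑ r ∈ Finset.Ico (k + 1) K,
          |p r - π r| * q ^ ((r + 1).choose 2) * q⁻¹ ^ (r - k) := by
      rw [Finset.mul_sum]
      refine (Finset.abs_sum_le_sum_abs _ _).trans (Finset.sum_le_sum fun r hr => ?_)
      have hr' := Finset.mem_Ico.1 hr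
      rw [abs_mul, abs_of_nonneg (hg k r)]
      have h8 : indepCount q k r ≤ q ^ (k.choose 2) * (q ^ ((r + 1).choose 2) * q⁻¹ ^ (r - k)) := by
        refine (indepCount_le_pow hq1 (by omega)).trans ?_
        rw [inv_pow, ← mul_assoc, ← div_eq_mul_inv, le_div_iff₀ (by positivity), ← pow_add,
          ← pow_add]
        refine pow_le_pow_right₀ hq1 ?_
        obtain ⟨j, rfl⟩ := Nat.exists_eq_add_of_le (by omega : k ≤ r)
        have h12 := choose_two_add k (j + 1)
        have h13 := choose_two_succ_add k
        have h14 := self_le_choose_two_succ j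
        have h15 : (k + 1).choose 2 = k.choose 2 + k := by
          rw [Nat.choose_succ_succ' k 1, Nat.choose_one_right, add_comm]
        rw [Nat.add_sub_cancel_left, add_assoc k j 1]
        nlinarith
      calc _ ≤ |p r - π r| * (q ^ (k.choose 2) * (q ^ ((r + 1).choose 2) * q⁻¹ ^ (r - k))) :=
            mul_le_mul_of_nonneg_left h8 (abs_nonneg _)
        _ = _ := by ring
    have h9 : |p k - π k| * indepCount q k k ≤ q ^ (k.choose 2) * (ε + 6 * q⁻¹ ^ (K - k) +
        ∑ r ∈ Finset.Ico (k + 1) K, |p r - π r| * q ^ ((r + 1).choose 2) * q⁻¹ ^ (r - k)) := by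
      rw [← abs_of_nonneg (hg k k), ← abs_mul]
      have h10 := hm k hk.le
      rw [abs_le] at h4 h7 h10 ⊢
      constructor <;> nlinarith
    have h11 := mul_le_mul_of_nonneg_left (half_pow_le_indepCount_self (by linarith : 4 ≤ q) k)
      (abs_nonneg (p k - π k))
    -- Since `k² = (k + 1).choose 2 + k.choose 2`, dividing by the size `q ^ (k.choose 2)` of the
    -- moment leaves the normalisation `q ^ ((k + 1).choose 2)`. The factor `1 / 2` in the lower
    -- bound for the leading count accounts for the constants `2` and `12`.
    have h12 : q ^ (k * k) = q ^ ((k + 1).choose 2) * q ^ (k.choose 2) := by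
      rw [← pow_add, choose_two_succ_add]
    rw [h12] at h11
    have h13 : 0 < q ^ (k.choose 2) := by positivity
    have h14 := h11.trans h9
    refine le_of_mul_le_mul_left ?_ h13
    nlinarith
  have hbound := le_of_backward_recursion hx0 hx hε0 K
    (fun k => |p k - π k| * q ^ ((k + 1).choose 2)) hrec
  have hs0 : Summable fun r => |p r - π r| := by
    simpa [indepCount] using hsum 0 (Nat.zero_le K)
  have ht0 := htail 0 (Nat.zero_le K)
  rw [← hs0.sum_add_tsum_nat_add K]
  simp only [indepCount, Finset.range_zero, Finset.prod_empty, mul_one, Nat.choose_zero_succ,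
    pow_zero, one_mul, Nat.sub_zero] at ht0
  have h1 : ∑ r ∈ Finset.range K, |p r - π r| ≤
      ∑ r ∈ Finset.range K, (16 * ε * q⁻¹ ^ r + 16 * (q⁻¹ ^ K * 16 ^ (K - r))) := by
    refine Finset.sum_le_sum fun r hr => ?_
    have hr' := Finset.mem_range.1 hr
    have h2 := hbound r hr'
    have h3 : |p r - π r| * q ^ r ≤ |p r - π r| * q ^ ((r + 1).choose 2) :=
      mul_le_mul_of_nonneg_left (pow_le_pow_right₀ hq1 (self_le_choose_two_succ r)) (abs_nonneg _)
    have h4 : |p r - π r| = |p r - π r| * q ^ r * q⁻¹ ^ r := by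
      rw [mul_assoc, ← mul_pow, mul_inv_cancel₀ hq0.ne', one_pow, mul_one]
    rw [h4]
    refine (mul_le_mul_of_nonneg_right (h3.trans h2) (by positivity)).trans (le_of_eq ?_)
    rw [show q⁻¹ ^ K = q⁻¹ ^ (K - r) * q⁻¹ ^ r by rw [← pow_add]; congr 1; omega, mul_pow]
    ring
  rw [Finset.sum_add_distrib, ← Finset.mul_sum, ← Finset.mul_sum, ← Finset.mul_sum] at h1
  have h2 := sum_range_sixteen_pow_le K
  have h3 := sum_range_pow_le_two hx0 (by linarith) K
  have hxK : 0 ≤ q⁻¹ ^ K := by positivity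
  have h5 := mul_le_mul_of_nonneg_left h2 hxK
  have h6 := mul_le_mul_of_nonneg_left h3 (by positivity : 0 ≤ 16 * ε)
  have h7 : q⁻¹ ^ K * 1 ≤ q⁻¹ ^ K * 16 ^ K :=
    mul_le_mul_of_nonneg_left (one_le_pow₀ (by norm_num)) hxK
  have h8 : (16 * q⁻¹) ^ K = q⁻¹ ^ K * 16 ^ K := by rw [mul_pow, mul_comm]
  rw [pow_succ] at h5
  rw [h8]
  linarith

/-! ### Fourier analysis over a finite field -/

theorem card_matrix {L ι κ : Type*} [Fintype L] [Fintype ι] [Fintype κ] [DecidableEq ι] [DecidableEq κ] :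
    Fintype.card (Matrix ι κ L) = Fintype.card L ^ (Fintype.card ι * Fintype.card κ) := by
  rw [Fintype.card_congr (Matrix.of (m := ι) (n := κ) (α := L)).symm, Fintype.card_fun,
    Fintype.card_fun, ← pow_mul, mul_comm]

section Fourier

variable {K : Type*} [Field K] [Fintype K]

theorem exists_isPrimitive_addChar (K : Type*) [Field K] [Fintype K] :
    ∃ ψ : AddChar K ℂ, ψ.IsPrimitive := by
  obtain ⟨ψ, hψ⟩ := AddChar.exists_apply_ne_zero.2 (one_ne_zero (α := K))
  refine ⟨ψ, AddChar.IsPrimitive.of_ne_one ?_⟩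
  rintro rfl
  simp at hψ

theorem sum_addChar_mul_sub [DecidableEq K] {ψ : AddChar K ℂ} (hψ : ψ.IsPrimitive) (a b : K) :
    ∑ x, ψ (x * a) * (starRingEnd ℂ) (ψ (x * b)) = if a = b then (Fintype.card K : ℂ) else 0 := by
  have h : ∀ x, ψ (x * a) * (starRingEnd ℂ) (ψ (x * b)) = ψ (x * (a - b)) := fun x => by
    rw [← AddChar.map_neg_eq_conj, ← AddChar.map_add_eq_mul]
    congr 1
    ring
  simp only [h, AddChar.sum_mulShift _ hψ, sub_eq_zero]
  split_ifs <;> simp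

/-- Parseval's identity for the characteristic function of a law on a finite field. -/
theorem sum_norm_sq_charFun {ψ : AddChar K ℂ} (hψ : ψ.IsPrimitive) (p : K → ℝ) :
    ∑ x, ‖∑ a, (p a : ℂ) * ψ (x * a)‖ ^ 2 = Fintype.card K * ∑ a, p a ^ 2 := by
  classical
  have h : ∀ x, ((‖∑ a, (p a : ℂ) * ψ (x * a)‖ ^ 2 : ℝ) : ℂ) =
      ∑ a, ∑ b, (p a : ℂ) * p b * (ψ (x * a) * (starRingEnd ℂ) (ψ (x * b))) := fun x => by
    rw [Complex.ofReal_pow, ← Complex.mul_conj', map_sum, Finset.sum_mul_sum]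
    refine Finset.sum_congr rfl fun a _ => Finset.sum_congr rfl fun b _ => ?_
    rw [map_mul (starRingEnd ℂ), Complex.conj_ofReal]
    ring
  apply Complex.ofReal_injective
  rw [Complex.ofReal_sum]
  simp only [h]
  rw [Finset.sum_comm]
  simp only [Finset.sum_comm (s := (Finset.univ : Finset K)) (t := (Finset.univ : Finset K))
    (f := fun x b => _ * (ψ (x * _) * (starRingEnd ℂ) (ψ (x * b))))]
  simp only [← Finset.mul_sum, sum_addChar_mul_sub hψ]
  push_cast
  rw [Finset.mul_sum]
  refine Finset.sum_congr rfl fun a _ => ?_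
  simp
  ring

/-- The map `T ↦ ψ ⟨T, Y⟩` is an additive character of the matrix space. Testing on matrices with
one nonzero entry, primitivity shows that it is trivial only for `Y = 0`; orthogonality then detects
the event `M W = 0`. -/
theorem sum_addChar_dotProduct {ψ : AddChar K ℂ} (hψ : ψ.IsPrimitive) {ι κ : Type*} [Fintype ι]
    [Fintype κ] [DecidableEq ι] [DecidableEq κ] [DecidableEq K] (Y : Matrix ι κ K) :
    ∑ T : Matrix ι κ K, ψ (∑ i, ∑ l, T i l * Y i l) =
      if Y = 0 then ((Fintype.card K : ℂ) ^ (Fintype.card ι * Fintype.card κ)) else 0 := by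
  let χ : AddChar (Matrix ι κ K) ℂ :=
    { toFun := fun T => ψ (∑ i, ∑ l, T i l * Y i l)
      map_zero_eq_one' := by simp
      map_add_eq_mul' := fun S T => by
        rw [← AddChar.map_add_eq_mul]
        simp [add_mul, Finset.sum_add_distrib] }
  have h1 : ∑ T : Matrix ι κ K, ψ (∑ i, ∑ l, T i l * Y i l) = ∑ T, χ T := rfl
  have h2 : χ = 0 ↔ Y = 0 := by
    constructor
    · intro h
      ext i l
      by_contra hne
      refine hψ hne ?_
      ext x
      have h3 : χ (Matrix.single i l x) = 1 := by rw [h]; rfl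
      have h4 : ∑ i', ∑ l', Matrix.single i l x i' l' * Y i' l' = x * Y i l := by
        rw [Finset.sum_eq_single i, Finset.sum_eq_single l]
        · simp
        · intro l' _ hl'
          simp [Matrix.single_apply_of_ne _ _ _ _ _ (fun h => hl' h.2.symm)]
        · simp
        · intro i' _ hi'
          exact Finset.sum_eq_zero fun l' _ => by
            simp [Matrix.single_apply_of_ne _ _ _ _ _ (fun h => hi' h.1.symm)]
        · simp
      rw [AddChar.mulShift_apply, mul_comm, ← h4]
      exact h3
    · rintro rfl
      ext T
      simp [χ]
  rw [h1, AddChar.sum_eq_ite]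
  simp only [h2]
  split_ifs
  · rw [← Nat.cast_pow]
    congr 1
    rw [card_matrix]
  · rfl

end Fourier

/-! ### Upper triangular representatives -/

section Upper

variable {K : Type*} [Field K] {n : ℕ}

/-- The upper triangular matrix defining the same quadratic form as `A`. -/
def upperPart : Matrix (Fin n) (Fin n) K →ₗ[K] Matrix (Fin n) (Fin n) K where
  toFun A := Matrix.of fun i j => if i < j then A i j + A j i else if i = j then A i j else 0
  map_add' A B := by
    ext i j
    simp only [Matrix.add_apply, Matrix.of_apply]
    split_ifs <;> ring
  map_smul' c A := by
    ext i j
    simp only [Matrix.smul_apply, smul_eq_mul, RingHom.id_apply, Matrix.of_apply]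
    split_ifs <;> ring

theorem upperPart_apply (A : Matrix (Fin n) (Fin n) K) (i j : Fin n) :
    upperPart A i j = if i < j then A i j + A j i else if i = j then A i j else 0 := rfl

/-- The positions on or above the diagonal. -/
def upperPos (n : ℕ) : Finset (Fin n × Fin n) := Finset.univ.filter fun p => p.1 ≤ p.2

/-- Merging the pairs `(i, j)` and `(j, i)` leaves only the entries on and above the diagonal, where
independence is available. No division by two occurs, so even `q` is covered. -/
theorem sum_mul_eq_sum_upperPart (A M : Matrix (Fin n) (Fin n) K) (hM : M.IsSymm) :
    ∑ i, ∑ j, A i j * M i j = ∑ p ∈ upperPos n, upperPart A p.1 p.2 * M p.1 p.2 := by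
  have h : ∀ i j, upperPart A i j * M i j =
      (if i ≤ j then A i j * M i j else 0) + (if i < j then A j i * M j i else 0) := by
    intro i j
    rw [upperPart_apply, hM.apply i j]
    rcases lt_trichotomy i j with h | h | h
    · simp [h, h.le, add_mul]
    · simp [h]
    · simp [h.not_gt, h.not_ge, h.ne']
  have h2 : ∀ i j, A i j * M i j =
      (if i ≤ j then A i j * M i j else 0) + (if j < i then A i j * M i j else 0) := by
    intro i j
    rcases le_or_gt i j with h | h
    · simp [h, h.not_gt]
    · simp [h, h.not_ge]
  have h3 : ∑ p ∈ upperPos n, upperPart A p.1 p.2 * M p.1 p.2 =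
      ∑ i, ∑ j, upperPart A i j * M i j := by
    rw [← Finset.sum_product', Finset.univ_product_univ, upperPos]
    refine Finset.sum_subset (Finset.filter_subset _ _) fun p _ hp => ?_
    have hp' : ¬ p.1 ≤ p.2 := by simpa using hp
    rw [upperPart_apply, if_neg fun h => hp' h.le, if_neg fun h => hp' h.le, zero_mul]
  rw [h3]
  simp only [h]
  rw [Finset.sum_congr rfl fun i _ => Finset.sum_congr rfl fun j _ => h2 i j]
  simp only [Finset.sum_add_distrib]
  congr 1
  exact Finset.sum_comm

theorem upperPart_add_transpose (A : Matrix (Fin n) (Fin n) K) :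
    upperPart A + (upperPart A).transpose = A + A.transpose := by
  ext i j
  simp only [Matrix.add_apply, Matrix.transpose_apply, upperPart_apply]
  rcases lt_trichotomy i j with h | h | h
  · simp [h, h.not_gt, h.ne']
  · simp [h]
  · simp [h, h.not_gt, h.ne', add_comm]

end Upper

/-! ### Weights of quadratic forms and the Fourier expansion of `P(M W = 0)` -/

/-- A family of symmetric weights in `[0, 1]` on the entries of a matrix, of bounded square sum at
the positions outside the exceptional set. -/
structure IsWeight {n : ℕ} {K : Type*} [Fintype K] (C : ℝ) (F : Fin n → Finset (Fin n))
    (f : Fin n → Fin n → K → ℝ) : Prop where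
  nonneg : ∀ i j x, 0 ≤ f i j x
  le_one : ∀ i j x, f i j x ≤ 1
  symm : ∀ i j, f i j = f j i
  sum_sq_le : ∀ i j, j ∉ F i → ∑ x, f i j x ^ 2 ≤ C

/-- The weight of an upper triangular matrix. -/
noncomputable def weightProd {n : ℕ} {K : Type*} (f : Fin n → Fin n → K → ℝ)
    (U : Matrix (Fin n) (Fin n) K) : ℝ :=
  ∏ p ∈ upperPos n, f p.1 p.2 (U p.1 p.2)

/-- The modulus of the characteristic function of an entry, replaced by `1` at exceptional
positions. -/
noncomputable def charWeight {n : ℕ} {K : Type*} [Field K] {Ω : Type*} [MeasurableSpace Ω]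
    (ψ : AddChar K ℂ) (F : Fin n → Finset (Fin n)) (P : Measure Ω)
    (M : Ω → Matrix (Fin n) (Fin n) K) (i j : Fin n) (x : K) : ℝ :=
  if j ∈ F i then 1 else ‖∫ ω, ψ (x * M ω i j) ∂P‖

theorem addChar_map_sum {A : Type*} [AddCommMonoid A] (ψ : AddChar A ℂ) {ι : Type*} (s : Finset ι)
    (g : ι → A) : ψ (∑ i ∈ s, g i) = ∏ i ∈ s, ψ (g i) := by
  classical
  induction s using Finset.induction_on with
  | empty => simp
  | insert a s ha ih => rw [Finset.sum_insert ha, Finset.prod_insert ha, AddChar.map_add_eq_mul, ih]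

theorem sum_mul_mul_apply {n k : ℕ} {K : Type*} [Field K]
    (A : Matrix (Fin n) (Fin n) K) (W T : Matrix (Fin n) (Fin k) K) :
    (∑ i, ∑ l, T i l * (A * W : Matrix (Fin n) (Fin k) K) i l) =
      ∑ i, ∑ j, (T * W.transpose : Matrix (Fin n) (Fin n) K) i j * A i j := by
  simp only [Matrix.mul_apply, Matrix.transpose_apply, Finset.mul_sum, Finset.sum_mul]
  refine Finset.sum_congr rfl fun i _ => ?_
  rw [Finset.sum_comm]
  exact Finset.sum_congr rfl fun j _ => Finset.sum_congr rfl fun l _ => by ring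

namespace IsNearUniformSymm

variable {n : ℕ} {K : Type*} [Field K] [Fintype K] [MeasurableSpace K] {Ω : Type*}
  [MeasurableSpace Ω] {C : ℝ} {F : Fin n → Finset (Fin n)} {P : Measure Ω}
  {M : Ω → Matrix (Fin n) (Fin n) K}

theorem measurable_comp [DiscreteMeasurableSpace K] (hM : IsNearUniformSymm C F P M)
    {β : Type*} [MeasurableSpace β] (G : Matrix (Fin n) (Fin n) K → β) :
    Measurable fun ω => G (M ω) := by
  have h1 : Measurable fun ω => (fun i j => M ω i j : Fin n → Fin n → K) :=
    measurable_pi_iff.2 fun i => measurable_pi_iff.2 fun j => hM.measurable i j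
  have h2 : Measurable fun x : Fin n → Fin n → K => G (Matrix.of x) := Measurable.of_discrete
  exact h2.comp h1

theorem integrable_comp [DiscreteMeasurableSpace K] [IsProbabilityMeasure P]
    (hM : IsNearUniformSymm C F P M) {E : Type*} [NormedAddCommGroup E] [MeasurableSpace E]
    [BorelSpace E] [SecondCountableTopology E] (G : Matrix (Fin n) (Fin n) K → E) :
    Integrable (fun ω => G (M ω)) P := by
  refine Integrable.of_bound (hM.measurable_comp G).aestronglyMeasurable (∑ A, ‖G A‖)
    (Filter.Eventually.of_forall fun ω => ?_)
  exact Finset.single_le_sum (f := fun A => ‖G A‖) (fun _ _ => norm_nonneg _)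
    (Finset.mem_univ (M ω))

theorem prob_entry_le (hM : IsNearUniformSymm C F P M) (hF : ∀ i j, i ∈ F j ↔ j ∈ F i)
    {i j : Fin n} (h : j ∉ F i) (a : K) :
    P.real {ω | M ω i j = a} ≤ C / (Fintype.card K : ℝ) := by
  rcases le_total i j with hij | hij
  · exact hM.near_uniform ⟨(i, j), hij, h⟩ a
  · have h2 := hM.near_uniform ⟨(j, i), hij, fun h' => h ((hF i j).1 h')⟩ a
    simpa only [fun ω => (hM.isSymm ω).apply i j] using h2

theorem integral_addChar_eq [DiscreteMeasurableSpace K] [IsProbabilityMeasure P]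
    (hM : IsNearUniformSymm C F P M) (ψ : AddChar K ℂ) (i j : Fin n) (x : K) :
    ∫ ω, ψ (x * M ω i j) ∂P = ∑ a, (P.real {ω | M ω i j = a} : ℂ) * ψ (x * a) := by
  have hm := hM.measurable i j
  have : IsProbabilityMeasure (P.map fun ω => M ω i j) :=
    Measure.isProbabilityMeasure_map hm.aemeasurable
  rw [← integral_map (φ := fun ω => M ω i j) (f := fun a => ψ (x * a)) hm.aemeasurable
    Measurable.of_discrete.aestronglyMeasurable, integral_fintype (Integrable.of_finite)]
  refine Finset.sum_congr rfl fun a _ => ?_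
  rw [map_measureReal_apply hm (measurableSet_singleton a), Complex.real_smul]
  rfl

/-- By Parseval the square sum is `q ∑ p(a)² ≤ q (C / q) ∑ p(a) = C`. Single values of a
characteristic function may be close to one; only this averaged decay is used. -/
theorem isWeight_charWeight [DiscreteMeasurableSpace K] [IsProbabilityMeasure P]
    (hM : IsNearUniformSymm C F P M) (hF : ∀ i j, i ∈ F j ↔ j ∈ F i)
    {ψ : AddChar K ℂ} (hψ : ψ.IsPrimitive) : IsWeight C F (charWeight ψ F P M) where
  nonneg i j x := by
    rw [charWeight]
    split_ifs <;> positivity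
  le_one i j x := by
    rw [charWeight]
    split_ifs
    · exact le_rfl
    · refine (norm_integral_le_integral_norm _).trans ?_
      simp
  symm i j := by
    ext x
    simp only [charWeight, hF j i, fun ω => (hM.isSymm ω).apply i j]
  sum_sq_le i j h := by
    have h1 : ∀ x, charWeight ψ F P M i j x = ‖∑ a, (P.real {ω | M ω i j = a} : ℂ) * ψ (x * a)‖ :=
      fun x => by rw [charWeight, if_neg h, hM.integral_addChar_eq]
    simp only [h1]
    rw [sum_norm_sq_charFun hψ]
    have hq : (0 : ℝ) < Fintype.card K := by exact_mod_cast Fintype.card_pos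
    have h2 : ∑ a, P.real {ω | M ω i j = a} = 1 := by
      have hm := hM.measurable i j
      have := Measure.isProbabilityMeasure_map (μ := P) hm.aemeasurable
      have h3 := sum_measureReal_singleton (μ := P.map fun ω => M ω i j) Finset.univ
      rw [Finset.coe_univ, probReal_univ] at h3
      rw [← h3]
      refine Finset.sum_congr rfl fun a _ => ?_
      rw [map_measureReal_apply hm (measurableSet_singleton a)]
      rfl
    have h4 : ∑ a, P.real {ω | M ω i j = a} ^ 2 ≤ C / Fintype.card K := by
      calc ∑ a, P.real {ω | M ω i j = a} ^ 2
          ≤ ∑ a, C / Fintype.card K * P.real {ω | M ω i j = a} :=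
            Finset.sum_le_sum fun a _ => by
              rw [sq]
              exact mul_le_mul_of_nonneg_right (hM.prob_entry_le hF h a) measureReal_nonneg
        _ = _ := by rw [← Finset.mul_sum, h2, mul_one]
    calc _ ≤ (Fintype.card K : ℝ) * (C / Fintype.card K) := by gcongr
      _ = C := by field_simp

/-- The exceptional entries form one independent factor of modulus at most one, whatever their joint
law; the regular factor splits into a product by independence. -/
theorem norm_integral_addChar_le [DiscreteMeasurableSpace K] [IsProbabilityMeasure P]
    (hM : IsNearUniformSymm C F P M) (ψ : AddChar K ℂ) (U : Matrix (Fin n) (Fin n) K) :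
    ‖∫ ω, ψ (∑ p ∈ upperPos n, U p.1 p.2 * M ω p.1 p.2) ∂P‖ ≤
      weightProd (charWeight ψ F P M) U := by
  let X : Ω → RegularPos F → K := fun ω p => M ω p.1.1 p.1.2
  let Y : Ω → ExceptionalPos F → K := fun ω p => M ω p.1.1 p.1.2
  let g : (RegularPos F → K) → ℂ := fun x => ∏ p, ψ (U p.1.1 p.1.2 * x p)
  let h : (ExceptionalPos F → K) → ℂ := fun x => ∏ p, ψ (U p.1.1 p.1.2 * x p)
  have hX : Measurable X := measurable_pi_iff.2 fun p => hM.measurable _ _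
  have hY : Measurable Y := measurable_pi_iff.2 fun p => hM.measurable _ _
  have hprod : ∀ t : Fin n × Fin n → ℂ, ∏ p ∈ upperPos n, t p =
      (∏ p : RegularPos F, t p.1) * ∏ p : ExceptionalPos F, t p.1 := by
    intro t
    rw [upperPos, ← Finset.prod_filter_not_mul_prod_filter _ (fun p => p.2 ∈ F p.1),
      Finset.filter_filter, Finset.filter_filter]
    congr 1
    · exact Finset.prod_subtype _ (by simp) t
    · exact Finset.prod_subtype _ (by simp) t
  have hprod' : ∀ t : Fin n × Fin n → ℝ, ∏ p ∈ upperPos n, t p =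
      (∏ p : RegularPos F, t p.1) * ∏ p : ExceptionalPos F, t p.1 := by
    intro t
    rw [upperPos, ← Finset.prod_filter_not_mul_prod_filter _ (fun p => p.2 ∈ F p.1),
      Finset.filter_filter, Finset.filter_filter]
    congr 1
    · exact Finset.prod_subtype _ (by simp) t
    · exact Finset.prod_subtype _ (by simp) t
  have h1 : ∀ ω, ψ (∑ p ∈ upperPos n, U p.1 p.2 * M ω p.1 p.2) = g (X ω) * h (Y ω) := fun ω => by
    rw [addChar_map_sum, hprod]
  simp only [h1]
  rw [hM.indep_exceptional.integral_fun_comp_mul_comp hX.aemeasurable hY.aemeasurable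
    (Measurable.of_discrete.aestronglyMeasurable) (Measurable.of_discrete.aestronglyMeasurable)]
  have h2 : ∫ ω, g (X ω) ∂P = ∏ p : RegularPos F, ∫ ω, ψ (U p.1.1 p.1.2 * M ω p.1.1 p.1.2) ∂P :=
    hM.indep_regular.integral_fun_prod_comp (f := fun p a => ψ (U p.1.1 p.1.2 * a))
      (fun p => (hM.measurable _ _).aemeasurable)
      fun p => Measurable.of_discrete.aestronglyMeasurable
  have h3 : ‖∫ ω, h (Y ω) ∂P‖ ≤ 1 := by
    refine (norm_integral_le_integral_norm _).trans ?_
    simp [h]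
  rw [norm_mul, h2, norm_prod, weightProd, hprod']
  have h4 : ∏ p : ExceptionalPos F, charWeight ψ F P M p.1.1 p.1.2 (U p.1.1 p.1.2) = 1 :=
    Finset.prod_eq_one fun p _ => by rw [charWeight, if_pos p.2.2]
  have h5 : ∏ p : RegularPos F, charWeight ψ F P M p.1.1 p.1.2 (U p.1.1 p.1.2) =
      ∏ p : RegularPos F, ‖∫ ω, ψ (U p.1.1 p.1.2 * M ω p.1.1 p.1.2) ∂P‖ :=
    Finset.prod_congr rfl fun p _ => by rw [charWeight, if_neg p.2.2]
  rw [h4, h5]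
  exact mul_le_mul_of_nonneg_left h3 (Finset.prod_nonneg fun _ _ => norm_nonneg _)

/-- Fourier inversion for the event `M W = 0`: each `T` whose quadratic form vanishes contributes
exactly `1`, and the others are bounded by their weights. -/
theorem abs_pow_mul_prob_sub_le [DiscreteMeasurableSpace K] [IsProbabilityMeasure P]
    [DecidableEq K] (hM : IsNearUniformSymm C F P M) {ψ : AddChar K ℂ} (hψ : ψ.IsPrimitive) {k : ℕ}
    (W : Matrix (Fin n) (Fin k) K) :
    |(Fintype.card K : ℝ) ^ (n * k) * P.real {ω | M ω * W = 0} -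
        (Finset.univ.filter fun T : Matrix (Fin n) (Fin k) K =>
          upperPart (T * W.transpose) = 0).card| ≤
      ∑ T : Matrix (Fin n) (Fin k) K with upperPart (T * W.transpose) ≠ 0,
        weightProd (charWeight ψ F P M) (upperPart (T * W.transpose)) := by
  have h1 : ∫ ω, (∑ T : Matrix (Fin n) (Fin k) K,
      ψ (∑ p ∈ upperPos n, upperPart (T * W.transpose) p.1 p.2 * M ω p.1 p.2)) ∂P =
        ((Fintype.card K : ℝ) ^ (n * k) * P.real {ω | M ω * W = 0} : ℝ) := by
    have h2 : ∀ ω, (∑ T : Matrix (Fin n) (Fin k) K,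
        ψ (∑ p ∈ upperPos n, upperPart (T * W.transpose) p.1 p.2 * M ω p.1 p.2)) =
          {ω | M ω * W = 0}.indicator (fun _ => (Fintype.card K : ℂ) ^ (n * k)) ω := fun ω => by
      simp only [← sum_mul_eq_sum_upperPart _ _ (hM.isSymm ω), ← sum_mul_mul_apply]
      rw [sum_addChar_dotProduct hψ]
      simp [Set.indicator_apply]
    simp only [h2]
    have h3 : MeasurableSet {ω | M ω * W = 0} :=
      measurableSet_setOfPred.2 (hM.measurable_comp fun A => A * W = 0)
    rw [integral_indicator_const _ h3, Complex.real_smul]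
    push_cast
    ring
  rw [integral_finsetSum _ fun T _ => hM.integrable_comp
    fun A => ψ (∑ p ∈ upperPos n, upperPart (T * W.transpose) p.1 p.2 * A p.1 p.2)] at h1
  rw [← Finset.sum_filter_add_sum_filter_not _ (fun T => upperPart (T * W.transpose) = 0)] at h1
  have h4 : ∑ T : Matrix (Fin n) (Fin k) K with upperPart (T * W.transpose) = 0,
      ∫ ω, ψ (∑ p ∈ upperPos n, upperPart (T * W.transpose) p.1 p.2 * M ω p.1 p.2) ∂P =
        ((Finset.univ.filter fun T : Matrix (Fin n) (Fin k) K =>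
          upperPart (T * W.transpose) = 0).card : ℂ) := by
    rw [Finset.card_eq_sum_ones, Nat.cast_sum]
    refine Finset.sum_congr rfl fun T hT => ?_
    rw [(Finset.mem_filter.1 hT).2]
    simp
  rw [h4] at h1
  rw [← Real.norm_eq_abs, ← Complex.norm_real, Complex.ofReal_sub, ← h1, Complex.ofReal_natCast,
    add_sub_cancel_left]
  exact (norm_sum_le _ _).trans (Finset.sum_le_sum fun T _ => hM.norm_integral_addChar_le ψ _)

end IsNearUniformSymm

/-! ### Fibres of additive maps -/

theorem card_fiber_eq_card_kernel {G H : Type*} [AddCommGroup G] [AddCommGroup H] [Fintype G]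
    [DecidableEq H] (g : G →+ H) (x₀ : G) :
    (Finset.univ.filter fun x => g x = g x₀).card = (Finset.univ.filter fun x => g x = 0).card := by
  refine Finset.card_bij' (fun x _ => x - x₀) (fun x _ => x + x₀) ?_ ?_ ?_ ?_
  · intro x hx
    simpa [sub_eq_zero] using hx
  · intro x hx
    simpa using hx
  · intro x _
    simp
  · intro x _
    simp

theorem sum_comp_eq_card_kernel_mul {G H : Type*} [AddCommGroup G] [AddCommGroup H] [Fintype G]
    [DecidableEq H] (g : G →+ H) (Φ : H → ℝ) :
    ∑ x, Φ (g x) = (Finset.univ.filter fun x => g x = 0).card *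
      ∑ y ∈ Finset.univ.image g, Φ y := by
  rw [Finset.sum_comp Φ g, Finset.mul_sum]
  refine Finset.sum_congr rfl fun y hy => ?_
  obtain ⟨x₀, -, rfl⟩ := Finset.mem_image.1 hy
  rw [card_fiber_eq_card_kernel, nsmul_eq_mul]

theorem card_kernel_mul_card {G H : Type*} [AddCommGroup G] [AddCommGroup H] [Fintype G] [Fintype H]
    [DecidableEq H] (g : G →+ H) (hg : Function.Surjective g) :
    (Finset.univ.filter fun x => g x = 0).card * Fintype.card H = Fintype.card G := by
  have h := sum_comp_eq_card_kernel_mul g fun _ => 1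
  rw [Finset.image_univ_of_surjective hg] at h
  simp only [Finset.sum_const, Finset.card_univ, nsmul_eq_mul, mul_one] at h
  exact_mod_cast h.symm

theorem card_mul_sum_comp {G H : Type*} [AddCommGroup G] [AddCommGroup H] [Fintype G] [Fintype H]
    (g : G →+ H) (hg : Function.Surjective g) (Φ : H → ℝ) :
    Fintype.card H * ∑ x, Φ (g x) = Fintype.card G * ∑ y, Φ y := by
  classical
  rw [sum_comp_eq_card_kernel_mul g Φ, Finset.image_univ_of_surjective hg,
    ← card_kernel_mul_card g hg]
  push_cast
  ring

/-! ### Quadratic forms and the kernel of `T ↦ upperPart (T Wᵀ)` -/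

section Kernel

open Matrix

variable {K : Type*} [Field K] {n : ℕ}

theorem dotProduct_mulVec_eq_sum {ι : Type*} [Fintype ι] (A : Matrix ι ι K) (x y : ι → K) :
    x ⬝ᵥ A *ᵥ y = ∑ i, ∑ j, A i j * (x i * y j) := by
  simp only [dotProduct, mulVec, Finset.mul_sum]
  exact Finset.sum_congr rfl fun i _ => Finset.sum_congr rfl fun j _ => by ring

theorem upperPart_upperPart (A : Matrix (Fin n) (Fin n) K) :
    upperPart (upperPart A) = upperPart A := by
  ext i j
  simp only [upperPart_apply]
  rcases lt_trichotomy i j with h | h | h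
  · simp [h, h.not_gt, h.ne']
  · simp [h]
  · simp [h.not_gt, h.ne']

theorem quad_upperPart (A : Matrix (Fin n) (Fin n) K) (x : Fin n → K) :
    x ⬝ᵥ upperPart A *ᵥ x = x ⬝ᵥ A *ᵥ x := by
  have hs : (vecMulVec x x).IsSymm := by
    ext i j
    simp [vecMulVec_apply, mul_comm]
  have h := fun B : Matrix (Fin n) (Fin n) K => sum_mul_eq_sum_upperPart B _ hs
  simp only [vecMulVec_apply] at h
  rw [dotProduct_mulVec_eq_sum, dotProduct_mulVec_eq_sum, h, h, upperPart_upperPart]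

/-- Evaluation at `eᵢ` and `eᵢ + eⱼ` recovers the coefficients of the form. The condition thus means
that `A` is alternating, in every characteristic, and in this form it is visibly stable under
congruence. -/
theorem upperPart_eq_zero_iff (A : Matrix (Fin n) (Fin n) K) :
    upperPart A = 0 ↔ ∀ x, x ⬝ᵥ A *ᵥ x = 0 := by
  constructor
  · intro h x
    rw [← quad_upperPart, h]
    simp
  · intro h
    have hd : ∀ i, A i i = 0 := fun i => by simpa using h (Pi.single i 1)
    ext i j
    rw [upperPart_apply, Matrix.zero_apply]
    split_ifs with h1 h2
    · have h3 := h (Pi.single i 1 + Pi.single j 1)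
      simpa [mulVec_add, hd, add_comm] using h3
    · subst h2
      exact hd i
    · rfl

theorem upperPart_congr_eq_zero {k : ℕ} {A : Matrix (Fin k) (Fin k) K} (hA : upperPart A = 0)
    (X : Matrix (Fin n) (Fin k) K) : upperPart (X * A * Xᵀ) = 0 := by
  rw [upperPart_eq_zero_iff] at hA ⊢
  intro x
  rw [← mulVec_mulVec, ← mulVec_mulVec, dotProduct_mulVec, ← mulVec_transpose]
  exact hA _

theorem eq_neg_transpose_of_upperPart_eq_zero {A : Matrix (Fin n) (Fin n) K}
    (hA : upperPart A = 0) : A = -Aᵀ := by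
  have h := upperPart_add_transpose A
  rw [hA] at h
  simp only [transpose_zero, add_zero] at h
  exact eq_neg_of_add_eq_zero_left h.symm

theorem exists_left_inverse_of_linearIndependent {ι κ : Type*} [Fintype ι] [Fintype κ]
    [DecidableEq ι] [DecidableEq κ] {W : Matrix ι κ K} (hW : LinearIndependent K Wᵀ) :
    ∃ L : Matrix κ ι K, L * W = 1 := by
  have hinj : LinearMap.ker W.mulVecLin = ⊥ := by
    rw [LinearMap.ker_eq_bot]
    exact mulVec_injective_iff.2 hW
  obtain ⟨g, hg⟩ := W.mulVecLin.exists_leftInverse_of_injective hinj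
  refine ⟨LinearMap.toMatrix' g, ?_⟩
  have h2 : W = LinearMap.toMatrix' W.mulVecLin := by
    rw [← toLin'_apply', LinearMap.toMatrix'_toLin']
  conv_lhs => rw [h2]
  rw [← LinearMap.toMatrix'_comp, hg, LinearMap.toMatrix'_id]

variable [Fintype K] [DecidableEq K]

theorem card_strictUpper (k : ℕ) :
    Fintype.card {p : Fin k × Fin k // p.1 < p.2} = k.choose 2 := by
  rw [Fintype.card_subtype, Finset.card_filter, ← Finset.univ_product_univ, Finset.sum_product_right]
  have h : ∀ j : Fin k, ∑ i : Fin k, (if (i, j).1 < (i, j).2 then 1 else 0) = (j : ℕ) := fun j => by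
    rw [← Finset.card_filter]
    simp [Finset.filter_gt_eq_Iio]
  rw [Finset.sum_congr rfl fun j _ => h j, Fin.sum_univ_eq_sum_range (fun j => j), Finset.sum_range_id,
    Nat.choose_two_right]

theorem card_alternating (k : ℕ) :
    (Finset.univ.filter fun A : Matrix (Fin k) (Fin k) K => upperPart A = 0).card =
      Fintype.card K ^ k.choose 2 := by
  rw [← card_strictUpper, ← Fintype.card_fun, ← Finset.card_univ]
  refine Finset.card_bij' (fun A _ p => A p.1.1 p.1.2)
    (fun g _ => Matrix.of fun i j => if h : i < j then g ⟨(i, j), h⟩ else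
      if h : j < i then -g ⟨(j, i), h⟩ else 0) (fun _ _ => Finset.mem_univ _) ?_ ?_ ?_
  · intro g _
    simp only [Finset.mem_filter, Finset.mem_univ, true_and]
    ext i j
    rw [upperPart_apply]
    rcases lt_trichotomy i j with h | h | h
    · simp [h, h.not_gt]
    · simp [h]
    · simp [h.not_gt, h.ne']
  · intro A hA
    have hA' := (Finset.mem_filter.1 hA).2
    have hn := eq_neg_transpose_of_upperPart_eq_zero hA'
    have hd : ∀ i, A i i = 0 := fun i => by
      have := congr_fun₂ hA' i i
      simpa [upperPart_apply] using this
    ext i j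
    rw [of_apply]
    rcases lt_trichotomy i j with h | h | h
    · rw [dif_pos h]
    · rw [dif_neg h.not_lt, dif_neg h.not_gt, h, hd]
    · rw [dif_neg h.not_gt, dif_pos h]
      exact (congr_fun₂ hn i j).symm
  · intro g _
    ext p
    exact dif_pos p.2

/-- If `T Wᵀ` is alternating, then `T Wᵀ = -W Tᵀ`, and cancelling `Wᵀ` puts the columns of `T` in
the column space of `W`. Hence `T = W A` with `A = L T` alternating, and `A` is arbitrary. -/
theorem card_kernel_upperPart_mul_transpose {k : ℕ} {W : Matrix (Fin n) (Fin k) K}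
    (hW : LinearIndependent K Wᵀ) :
    (Finset.univ.filter fun T : Matrix (Fin n) (Fin k) K => upperPart (T * Wᵀ) = 0).card =
      Fintype.card K ^ k.choose 2 := by
  obtain ⟨L, hL⟩ := exists_left_inverse_of_linearIndependent hW
  have hL' : Wᵀ * Lᵀ = 1 := by rw [← transpose_mul, hL, transpose_one]
  rw [← card_alternating]
  refine Finset.card_bij' (fun T _ => L * T) (fun A _ => W * A) ?_ ?_ ?_ ?_
  · intro T hT
    simp only [Finset.mem_filter, Finset.mem_univ, true_and] at hT ⊢
    have h := upperPart_congr_eq_zero hT L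
    rwa [← Matrix.mul_assoc, Matrix.mul_assoc (L * T), hL', Matrix.mul_one] at h
  · intro A hA
    simp only [Finset.mem_filter, Finset.mem_univ, true_and] at hA ⊢
    exact upperPart_congr_eq_zero hA W
  · intro T hT
    simp only [Finset.mem_filter, Finset.mem_univ, true_and] at hT
    have h1 := eq_neg_transpose_of_upperPart_eq_zero hT
    rw [transpose_mul, transpose_transpose] at h1
    have h2 : T = -(W * (Tᵀ * Lᵀ)) := by
      calc T = T * (Wᵀ * Lᵀ) := by rw [hL', Matrix.mul_one]
        _ = _ := by rw [← Matrix.mul_assoc, h1, Matrix.neg_mul, Matrix.mul_assoc]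
    have h3 : W * (L * T) = W * (L * -(W * (Tᵀ * Lᵀ))) := by rw [← h2]
    rw [h3, Matrix.mul_neg, Matrix.mul_neg, ← Matrix.mul_assoc L W, hL, Matrix.one_mul, ← h2]
  · intro A _
    rw [← Matrix.mul_assoc, hL, Matrix.one_mul]

end Kernel

/-! ### Counting the coordinate systems in which a quadratic form splits -/

section Splitting

open Matrix Module

variable {K : Type*} [Field K] {n : ℕ}

/-- The radical of the polar form of `x ↦ xᵀ U x`, cut by the quadric itself. -/
def singularRadical (U : Matrix (Fin n) (Fin n) K) : Submodule K (Fin n → K) where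
  carrier := {x | (U + Uᵀ) *ᵥ x = 0 ∧ x ⬝ᵥ U *ᵥ x = 0}
  zero_mem' := by simp
  add_mem' := by
    rintro x y ⟨hx, hx'⟩ ⟨hy, hy'⟩
    refine ⟨by rw [mulVec_add, hx, hy, add_zero], ?_⟩
    have h : x ⬝ᵥ U *ᵥ y + y ⬝ᵥ U *ᵥ x = 0 := by
      have h2 : x ⬝ᵥ (U + Uᵀ) *ᵥ y = 0 := by rw [hy, dotProduct_zero]
      rw [add_mulVec, dotProduct_add, mulVec_transpose, dotProduct_comm x (y ᵥ* U),
        ← dotProduct_mulVec] at h2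
      exact h2
    rw [mulVec_add, dotProduct_add, add_dotProduct, add_dotProduct, hx', hy']
    linear_combination h
  smul_mem' := by
    rintro c x ⟨hx, hx'⟩
    refine ⟨by rw [mulVec_smul, hx, smul_zero], ?_⟩
    rw [mulVec_smul, dotProduct_smul, smul_dotProduct, hx', smul_zero, smul_zero]

/-- The codimension of the singular radical. -/
noncomputable def quadRank (U : Matrix (Fin n) (Fin n) K) : ℕ :=
  n - finrank K (singularRadical U)

theorem finrank_singularRadical_add (U : Matrix (Fin n) (Fin n) K) :
    finrank K (singularRadical U) + quadRank U = n := by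
  have h := (singularRadical U).finrank_le
  rw [finrank_fin_fun] at h
  rw [quadRank]
  omega

theorem finrank_ker_mulVecLin_add_rank {ι κ : Type*} [Fintype ι] [Fintype κ]
    (A : Matrix ι κ K) :
    A.rank + finrank K (LinearMap.ker A.mulVecLin) = Fintype.card κ := by
  have h := A.mulVecLin.finrank_range_add_finrank_ker
  rwa [finrank_fintype_fun_eq_card] at h

theorem singularRadical_le_ker (U : Matrix (Fin n) (Fin n) K) :
    singularRadical U ≤ LinearMap.ker (U + Uᵀ).mulVecLin := fun _ hx => hx.1

theorem rank_le_quadRank (U : Matrix (Fin n) (Fin n) K) : (U + Uᵀ).rank ≤ quadRank U := by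
  have h1 := Submodule.finrank_mono (singularRadical_le_ker U)
  have h2 := finrank_ker_mulVecLin_add_rank (U + Uᵀ)
  have h3 := finrank_singularRadical_add U
  rw [Fintype.card_fin] at h2
  omega

/-- An isotropic space lies in its orthogonal, whose dimension exceeds `n - dim S` by at most the
dimension `n - rank b` of the radical. -/
theorem two_mul_finrank_le_of_isotropic {b : Matrix (Fin n) (Fin n) K} (hb : b.IsSymm)
    (S : Submodule K (Fin n → K)) (hS : ∀ x ∈ S, ∀ y ∈ S, x ⬝ᵥ b *ᵥ y = 0) :
    2 * finrank K S + b.rank ≤ 2 * n := by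
  have h1 := LinearMap.BilinForm.finrank_add_finrank_orthogonal' (B := toBilin' b) S
  have h2 : S ≤ (toBilin' b).orthogonal S := fun y hy =>
    LinearMap.BilinForm.mem_orthogonal_iff.2 fun x hx => by
      rw [toBilin'_apply']
      exact hS x hx y hy
  have h3 : (toBilin' b).ker ≤ LinearMap.ker b.mulVecLin := fun x hx => by
    rw [LinearMap.mem_ker] at hx ⊢
    ext i
    have h4 := congr_arg (fun g => g (Pi.single i 1)) hx
    simp only [toBilin'_apply', LinearMap.zero_apply] at h4
    rw [dotProduct_mulVec, ← mulVec_transpose, hb.eq, dotProduct_single, mul_one] at h4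
    exact h4
  have h5 := Submodule.finrank_mono h2
  have h6 := Submodule.finrank_mono ((inf_le_right (a := S)).trans h3)
  have h7 := finrank_ker_mulVecLin_add_rank b
  rw [Fintype.card_fin] at h7
  rw [finrank_fin_fun] at h1
  omega

theorem finrank_dotProduct_orthogonal {k : ℕ} (S : Submodule K (Fin k → K)) :
    finrank K S + finrank K ((toBilin' (1 : Matrix (Fin k) (Fin k) K)).orthogonal S) = k := by
  have h1 := LinearMap.BilinForm.finrank_add_finrank_orthogonal'
    (B := toBilin' (1 : Matrix (Fin k) (Fin k) K)) S
  have h2 : (toBilin' (1 : Matrix (Fin k) (Fin k) K)).ker = ⊥ := by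
    rw [eq_bot_iff]
    intro x hx
    rw [LinearMap.mem_ker] at hx
    rw [Submodule.mem_bot]
    ext i
    have h4 := congr_arg (fun g => g (Pi.single i 1)) hx
    simp only [toBilin'_apply', LinearMap.zero_apply, one_mulVec, dotProduct_single, mul_one] at h4
    exact h4
  rw [h2, inf_bot_eq, finrank_bot, finrank_fin_fun] at h1
  exact h1

theorem mem_dotProduct_orthogonal {k : ℕ} {S : Submodule K (Fin k → K)} {y : Fin k → K} :
    y ∈ (toBilin' (1 : Matrix (Fin k) (Fin k) K)).orthogonal S ↔ ∀ x ∈ S, x ⬝ᵥ y = 0 := by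
  simp [LinearMap.BilinForm.mem_orthogonal_iff, toBilin'_apply']

/-- If `x ↦ xᵀ U x` is of the form `(Tᵀ x) ⬝ (Wᵀ x)`, then the image of the singular radical under
`Wᵀ` has large codimension. -/
theorem finrank_map_singularRadical_le {k : ℕ} {W T : Matrix (Fin n) (Fin k) K}
    (hW : LinearIndependent K Wᵀ) {U : Matrix (Fin n) (Fin n) K} (hU : upperPart (T * Wᵀ) = U) :
    finrank K ((singularRadical U).map Wᵀ.mulVecLin) + (quadRank U - (U + Uᵀ).rank / 2) ≤ k ∧
      (U + Uᵀ).rank ≤ 2 * k := by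
  have hb : U + Uᵀ = T * Wᵀ + W * Tᵀ := by
    rw [← hU, upperPart_add_transpose, transpose_mul, transpose_transpose]
  have hsymm : (U + Uᵀ).IsSymm := by
    rw [Matrix.IsSymm, transpose_add, transpose_transpose, add_comm]
  set b := U + Uᵀ with hbdef
  set N := LinearMap.ker Wᵀ.mulVecLin with hN
  set R := LinearMap.ker b.mulVecLin with hR
  have hNmem : ∀ x, x ∈ N ↔ Wᵀ *ᵥ x = 0 := fun _ => Iff.rfl
  have hRmem : ∀ x, x ∈ R ↔ b *ᵥ x = 0 := fun _ => Iff.rfl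
  have hNdim : k + finrank K N = n := by
    have h := finrank_ker_mulVecLin_add_rank Wᵀ
    rwa [LinearIndependent.rank_matrix (M := Wᵀ) hW, Fintype.card_fin, Fintype.card_fin] at h
  have hRdim : b.rank + finrank K R = n := by
    have h := finrank_ker_mulVecLin_add_rank b
    rwa [Fintype.card_fin] at h
  -- The polar form is `T Wᵀ + W Tᵀ`, so the kernel `N` of `Wᵀ` is isotropic; enlarging it by the
  -- radical `R` keeps it isotropic.
  have hNN : ∀ x ∈ N, ∀ y ∈ N, x ⬝ᵥ b *ᵥ y = 0 := by
    intro x hx y hy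
    rw [hNmem] at hx hy
    rw [hb, add_mulVec, ← mulVec_mulVec, hy, mulVec_zero, zero_add, ← mulVec_mulVec,
      dotProduct_mulVec, ← mulVec_transpose, hx, zero_dotProduct]
  have hxR : ∀ x, ∀ y ∈ R, x ⬝ᵥ b *ᵥ y = 0 := by
    intro x y hy
    rw [(hRmem y).1 hy, dotProduct_zero]
  have hRx : ∀ x ∈ R, ∀ y, x ⬝ᵥ b *ᵥ y = 0 := by
    intro x hx y
    rw [dotProduct_mulVec, ← mulVec_transpose, hsymm.eq, (hRmem x).1 hx, zero_dotProduct]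
  have hiso : 2 * finrank K (N ⊔ R : Submodule K (Fin n → K)) + b.rank ≤ 2 * n := by
    refine two_mul_finrank_le_of_isotropic hsymm _ fun x hx y hy => ?_
    obtain ⟨x₁, hx₁, x₂, hx₂, rfl⟩ := Submodule.mem_sup.1 hx
    obtain ⟨y₁, hy₁, y₂, hy₂, rfl⟩ := Submodule.mem_sup.1 hy
    rw [mulVec_add, dotProduct_add, add_dotProduct, add_dotProduct, hNN x₁ hx₁ y₁ hy₁,
      hRx x₂ hx₂, hxR _ y₂ hy₂, hxR _ y₂ hy₂]
    simp
  have hsup := Submodule.finrank_sup_add_finrank_inf_eq N R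
  have hle : N ⊓ R ≤ singularRadical U ⊓ N := by
    rintro x ⟨hx1, hx2⟩
    refine ⟨⟨(hRmem x).1 hx2, ?_⟩, hx1⟩
    rw [← hU, quad_upperPart, ← mulVec_mulVec, (hNmem x).1 hx1, mulVec_zero, dotProduct_zero]
  have hlow := Submodule.finrank_mono (le_sup_left : N ≤ N ⊔ R)
  have hle' := Submodule.finrank_mono hle
  have hmap : finrank K ((singularRadical U).map Wᵀ.mulVecLin) +
      finrank K (singularRadical U ⊓ N : Submodule K (Fin n → K)) =
        finrank K (singularRadical U) := by
    have h := (Wᵀ.mulVecLin.domRestrict (singularRadical U)).finrank_range_add_finrank_ker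
    rw [LinearMap.range_domRestrict, LinearMap.ker_domRestrict] at h
    rw [← h, ← Submodule.map_comap_subtype, Submodule.finrank_map_subtype_eq]
  have hq := finrank_singularRadical_add U
  have hr := rank_le_quadRank U
  rw [← hbdef] at hr
  -- Isotropy of `N + R` gives `dim (N ∩ R) ≥ n - k - ⌊m / 2⌋`, where `m` is the polar rank. The
  -- form vanishes on `N`, so `N ∩ R` lies in the singular radical, of dimension `n - r`, and is
  -- killed by `Wᵀ`; at most `k - (r - ⌊m / 2⌋)` dimensions survive. Isotropy of `N` alone gives `m
  -- ≤ 2 k`.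
  constructor <;> omega

variable [Fintype K]

/-- Independence of the `V i` makes `W ↦ (W V i)ᵢ` surjective, so for uniform `W` these `h` vectors
are independent and uniform in `Kⁿ`. -/
theorem card_columns_mem_le {k h : ℕ} (V : Fin h → Fin k → K) (hV : LinearIndependent K V)
    (S : Submodule K (Fin n → K)) [DecidablePred (· ∈ S)] :
    Fintype.card K ^ (n * h) *
        (Finset.univ.filter fun W : Matrix (Fin n) (Fin k) K => ∀ i, W *ᵥ V i ∈ S).card =
      Fintype.card K ^ (n * k) * (Fintype.card K ^ finrank K S) ^ h := by
  classical
  let g : Matrix (Fin n) (Fin k) K →+ (Fin h → Fin n → K) :=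
    { toFun := fun W i => W *ᵥ V i
      map_zero' := by ext; simp
      map_add' := fun A B => by ext; simp [add_mulVec] }
  obtain ⟨L, hL⟩ := exists_left_inverse_of_linearIndependent (W := (Matrix.of V)ᵀ) hV
  have hg : Function.Surjective g := fun y => by
    refine ⟨(Matrix.of y)ᵀ * L, ?_⟩
    have h1 : (Matrix.of y)ᵀ * L * (Matrix.of V)ᵀ = (Matrix.of y)ᵀ := by
      rw [Matrix.mul_assoc, hL, Matrix.mul_one]
    ext i j
    have h2 := congr_fun₂ h1 j i
    exact h2
  have h1 := card_mul_sum_comp g hg fun y => if ∀ i, y i ∈ S then 1 else 0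
  simp only [Finset.sum_boole] at h1
  have h2 : (Finset.univ.filter fun y : Fin h → Fin n → K => ∀ i, y i ∈ S).card =
      (Fintype.card K ^ finrank K S) ^ h := by
    have h3 : (Finset.univ.filter fun y : Fin h → Fin n → K => ∀ i, y i ∈ S) =
        Fintype.piFinset fun _ => Finset.univ.filter fun x => x ∈ S := by
      ext y
      simp
    rw [h3, Fintype.card_piFinset, Finset.prod_const, Finset.card_univ, Fintype.card_fin,
      ← Module.card_eq_pow_finrank (K := K) (V := S), Fintype.card_subtype]
  rw [h2, card_matrix] at h1
  simp only [Fintype.card_fun, Fintype.card_fin] at h1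
  rw [pow_mul]
  exact_mod_cast h1

open Classical in
/-- The number of `W` with independent columns for which `x ↦ xᵀ U x` splits through `Wᵀ`. -/
noncomputable def splitCount (k : ℕ) (U : Matrix (Fin n) (Fin n) K) : ℕ :=
  (Finset.univ.filter fun W : Matrix (Fin n) (Fin k) K =>
    LinearIndependent K Wᵀ ∧ ∃ T : Matrix (Fin n) (Fin k) K, upperPart (T * Wᵀ) = U).card

theorem exists_of_splitCount_ne_zero {k : ℕ} {U : Matrix (Fin n) (Fin n) K}
    (h : splitCount k U ≠ 0) :
    (quadRank U - (U + Uᵀ).rank / 2) ≤ k ∧ (U + Uᵀ).rank ≤ 2 * k := by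
  classical
  obtain ⟨W, hW⟩ := Finset.card_ne_zero.1 h
  obtain ⟨hW, T, hT⟩ := (Finset.mem_filter.1 hW).2
  have := finrank_map_singularRadical_le hW hT
  omega

/-- When `U` splits through `W`, the image of the singular radical under `Wᵀ` has codimension at
least `h`. Choose `h` independent vectors `V i` orthogonal to this image; then every `W V i` is
orthogonal to the singular radical, hence lies in a space of dimension `quadRank U`. A union bound
over the `q ^ (k h)` families `V` concludes. -/
theorem pow_mul_splitCount_le (k : ℕ) (U : Matrix (Fin n) (Fin n) K) (h : ℕ)
    (hh : h = quadRank U - (U + Uᵀ).rank / 2) :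
    Fintype.card K ^ (n * h) * splitCount k U ≤
      Fintype.card K ^ (n * k + k * h + quadRank U * h) := by
  classical
  set S := (toBilin' (1 : Matrix (Fin n) (Fin n) K)).orthogonal (singularRadical U) with hS
  have hSdim : finrank K S = quadRank U := by
    have h1 := finrank_dotProduct_orthogonal (singularRadical U)
    have h2 := finrank_singularRadical_add U
    rw [← hS] at h1
    omega
  have hsub : (Finset.univ.filter fun W : Matrix (Fin n) (Fin k) K =>
      LinearIndependent K Wᵀ ∧ ∃ T : Matrix (Fin n) (Fin k) K, upperPart (T * Wᵀ) = U) ⊆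
      (Finset.univ.filter fun V : Fin h → Fin k → K => LinearIndependent K V).biUnion fun V =>
        Finset.univ.filter fun W : Matrix (Fin n) (Fin k) K => ∀ i, W *ᵥ V i ∈ S := by
    intro W hW
    obtain ⟨hW, T, hT⟩ := (Finset.mem_filter.1 hW).2
    have h1 := (finrank_map_singularRadical_le hW hT).1
    have h2 := finrank_dotProduct_orthogonal ((singularRadical U).map Wᵀ.mulVecLin)
    obtain ⟨v, hv⟩ := exists_linearIndependent_of_le_finrank (R := K)
      (M := (toBilin' (1 : Matrix (Fin k) (Fin k) K)).orthogonal
        ((singularRadical U).map Wᵀ.mulVecLin)) (n := h) (by omega)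
    refine Finset.mem_biUnion.2 ⟨fun i => (v i : Fin k → K), ?_, ?_⟩
    · simp only [Finset.mem_filter, Finset.mem_univ, true_and]
      exact hv.map' (Submodule.subtype _) (Submodule.ker_subtype _)
    · simp only [Finset.mem_filter, Finset.mem_univ, true_and]
      intro i
      rw [hS, mem_dotProduct_orthogonal]
      intro x hx
      have h3 := mem_dotProduct_orthogonal.1 (v i).2 (Wᵀ *ᵥ x)
        (Submodule.mem_map_of_mem (f := Wᵀ.mulVecLin) hx)
      rwa [mulVec_transpose, ← dotProduct_mulVec] at h3
  have h1 : splitCount k U ≤ _ := (Finset.card_le_card hsub).trans Finset.card_biUnion_le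
  calc Fintype.card K ^ (n * h) * splitCount k U
      ≤ Fintype.card K ^ (n * h) * ∑ V : Fin h → Fin k → K with LinearIndependent K V,
          (Finset.univ.filter fun W : Matrix (Fin n) (Fin k) K => ∀ i, W *ᵥ V i ∈ S).card :=
        Nat.mul_le_mul_left _ h1
    _ = ∑ V : Fin h → Fin k → K with LinearIndependent K V,
          Fintype.card K ^ (n * k) * (Fintype.card K ^ quadRank U) ^ h := by
        rw [Finset.mul_sum]
        refine Finset.sum_congr rfl fun V hV => ?_
        rw [card_columns_mem_le V (Finset.mem_filter.1 hV).2 S, hSdim]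
    _ ≤ ∑ V : Fin h → Fin k → K, Fintype.card K ^ (n * k) * (Fintype.card K ^ quadRank U) ^ h :=
        Finset.sum_le_sum_of_subset (Finset.filter_subset _ _)
    _ = _ := by
        rw [Finset.sum_const, Finset.card_univ, Fintype.card_fun, Fintype.card_fun,
          Fintype.card_fin, Fintype.card_fin, smul_eq_mul, ← pow_mul, ← pow_mul, pow_add, pow_add]
        ring

end Splitting

/-! ### Weighted sums over symmetric matrices of given rank -/

theorem sum_le_sum_of_injOn_of_le {α β : Type*} [Fintype β] (s : Finset α) (φ : α → β)
    (hφ : Set.InjOn φ s) (w : α → ℝ) (Φ : β → ℝ) (hΦ : ∀ d, 0 ≤ Φ d)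
    (h : ∀ a ∈ s, w a ≤ Φ (φ a)) : ∑ a ∈ s, w a ≤ ∑ d, Φ d := by
  classical
  calc ∑ a ∈ s, w a ≤ ∑ a ∈ s, Φ (φ a) := Finset.sum_le_sum h
    _ = ∑ d ∈ s.image φ, Φ d := (Finset.sum_image hφ).symm
    _ ≤ _ := Finset.sum_le_sum_of_subset_of_nonneg (Finset.subset_univ _) fun d _ _ => hΦ d

theorem sum_prod_apply {ι κ : Type*} [Fintype ι] [DecidableEq ι] [Fintype κ]
    (g : ι → κ → ℝ) : ∑ v : ι → κ, ∏ i, g i (v i) = ∏ i, ∑ x, g i x := by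
  rw [Finset.prod_univ_sum, Fintype.piFinset_univ]

theorem prod_le_prod_of_subset_of_mem_unit {α : Type*} {s t : Finset α} (h : s ⊆ t) (g : α → ℝ)
    (h0 : ∀ a ∈ t, 0 ≤ g a) (h1 : ∀ a ∈ t, g a ≤ 1) : ∏ a ∈ t, g a ≤ ∏ a ∈ s, g a := by
  classical
  rw [← Finset.prod_sdiff h]
  refine mul_le_of_le_one_left (Finset.prod_nonneg fun a ha => h0 a (h ha)) ?_
  exact Finset.prod_le_one (fun a ha => h0 a (Finset.sdiff_subset ha))
    fun a ha => h1 a (Finset.sdiff_subset ha)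

section RankSum

variable {K : Type*} [Field K] [Fintype K] {n : ℕ} {C : ℝ} {F : Fin n → Finset (Fin n)}
  {f : Fin n → Fin n → K → ℝ}

/-- The positions strictly above the diagonal. -/
def strictUpperPos (n : ℕ) : Finset (Fin n × Fin n) := Finset.univ.filter fun p => p.1 < p.2

/-- The weight of the off-diagonal part of a symmetric matrix. -/
noncomputable def offWeight {K : Type*} (f : Fin n → Fin n → K → ℝ) (b : Matrix (Fin n) (Fin n) K) : ℝ :=
  ∏ p ∈ strictUpperPos n, f p.1 p.2 (b p.1 p.2)

theorem IsWeight.offWeight_nonneg {K : Type*} [Fintype K] {f : Fin n → Fin n → K → ℝ}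
    (hf : IsWeight C F f) (b : Matrix (Fin n) (Fin n) K) :
    0 ≤ offWeight f b := Finset.prod_nonneg fun _ _ => hf.nonneg _ _ _

/-- Weights are at most one, so factors outside the rectangle can be dropped; disjointness ensures
that each unordered pair is met at most once. -/
theorem IsWeight.offWeight_le {K : Type*} [Fintype K] {f : Fin n → Fin n → K → ℝ}
    (hf : IsWeight C F f) {b : Matrix (Fin n) (Fin n) K} (hb : b.IsSymm) {X Y : Finset (Fin n)} (hXY : Disjoint X Y) :
    offWeight f b ≤ ∏ j ∈ Y, ∏ i ∈ X, f i j (b i j) := by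
  let φ : Fin n × Fin n → Fin n × Fin n := fun p => (min p.1 p.2, max p.1 p.2)
  have hne : ∀ p ∈ Y ×ˢ X, p.1 ≠ p.2 := fun p hp h => by
    obtain ⟨h1, h2⟩ := Finset.mem_product.1 hp
    exact Finset.disjoint_left.1 hXY h2 (h ▸ h1)
  have hinj : Set.InjOn φ (Y ×ˢ X : Finset (Fin n × Fin n)) := by
    rintro ⟨j, i⟩ hp ⟨j', i'⟩ hp' h
    obtain ⟨hj, hi⟩ := Finset.mem_product.1 hp
    obtain ⟨hj', hi'⟩ := Finset.mem_product.1 hp'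
    have h1 : j ≠ i' := fun h => Finset.disjoint_left.1 hXY hi' (h ▸ hj)
    have h2 : j' ≠ i := fun h => Finset.disjoint_left.1 hXY hi (h ▸ hj')
    simp only [φ, Prod.mk.injEq] at h ⊢
    rcases le_total j i with h3 | h3 <;> rcases le_total j' i' with h4 | h4 <;>
      simp only [h3, h4, min_eq_left, min_eq_right, max_eq_left, max_eq_right] at h
    · exact h
    · exact absurd h.1 h1
    · exact absurd h.1.symm h2
    · exact ⟨h.2, h.1⟩
  have hval : ∀ p, f p.2 p.1 (b p.2 p.1) = f (φ p).1 (φ p).2 (b (φ p).1 (φ p).2) := by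
    rintro ⟨j, i⟩
    rcases le_total j i with h | h
    · simp only [φ, min_eq_left h, max_eq_right h]
      rw [hf.symm, hb.apply]
    · simp only [φ, min_eq_right h, max_eq_left h]
  rw [← Finset.prod_product' (f := fun j i => f i j (b i j)),
    Finset.prod_congr rfl fun p _ => hval p,
    ← Finset.prod_image (f := fun p => f p.1 p.2 (b p.1 p.2)) hinj]
  refine prod_le_prod_of_subset_of_mem_unit (fun p hp => ?_) _ (fun p _ => hf.nonneg _ _ _)
    fun p _ => hf.le_one _ _ _
  obtain ⟨p', hp', rfl⟩ := Finset.mem_image.1 hp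
  simp only [strictUpperPos, Finset.mem_filter, Finset.mem_univ, true_and, φ]
  exact min_lt_max.2 (hne p' hp')

/-- The bound for the square sum of the weight at position `(i, j)`. -/
noncomputable def posBound (K : Type*) [Fintype K] (C : ℝ) (F : Fin n → Finset (Fin n))
    (i j : Fin n) : ℝ := C * if j ∈ F i then (Fintype.card K : ℝ) else 1

theorem IsWeight.sum_sq_le_posBound (hf : IsWeight C F f) (hC : 1 ≤ C) (i j : Fin n) :
    ∑ x, f i j x ^ 2 ≤ posBound K C F i j := by
  rw [posBound]
  split_ifs with h
  · calc ∑ x, f i j x ^ 2 ≤ ∑ _x : K, (1 : ℝ) :=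
          Finset.sum_le_sum fun x _ => pow_le_one₀ (hf.nonneg _ _ _) (hf.le_one _ _ _)
      _ = 1 * Fintype.card K := by simp
      _ ≤ C * Fintype.card K := by gcongr
  · rw [mul_one]
    exact hf.sum_sq_le i j h

theorem one_le_posBound (hC : 1 ≤ C) (i j : Fin n) : 1 ≤ posBound K C F i j := by
  have hq : (1 : ℝ) ≤ Fintype.card K := by exact_mod_cast Fintype.card_pos
  rw [posBound]
  split_ifs <;> nlinarith

theorem prod_posBound_le (hC : 1 ≤ C) (X Y : Finset (Fin n)) :
    ∏ j ∈ Y, ∏ i ∈ X, posBound K C F i j ≤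
      C ^ (X.card * n) * (Fintype.card K : ℝ) ^ ∑ i ∈ X, (F i).card := by
  have h1 : ∀ i j, 1 ≤ posBound K C F i j := one_le_posBound hC
  calc ∏ j ∈ Y, ∏ i ∈ X, posBound K C F i j
      ≤ ∏ j, ∏ i ∈ X, posBound K C F i j := by
        rw [← Finset.prod_sdiff (Finset.subset_univ Y)]
        refine le_mul_of_one_le_left (Finset.prod_nonneg fun j _ => Finset.prod_nonneg fun i _ =>
          zero_le_one.trans (h1 i j)) ?_
        exact Finset.one_le_prod fun j _ => Finset.one_le_prod fun i _ => h1 i j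
    _ = ∏ i ∈ X, ∏ j, posBound K C F i j := Finset.prod_comm
    _ = ∏ i ∈ X, C ^ n * (Fintype.card K : ℝ) ^ (F i).card := by
        refine Finset.prod_congr rfl fun i _ => ?_
        simp only [posBound, Finset.prod_mul_distrib, Finset.prod_const, Finset.card_univ,
          Fintype.card_fin, Finset.prod_ite_mem, Finset.univ_inter]
    _ = _ := by
        rw [Finset.prod_mul_distrib, Finset.prod_const, Finset.prod_pow_eq_pow_sum, ← pow_mul,
          mul_comm n]

/-- One column of `b`: its entries in `I` are free and those in `J` are their image under `E`.
Cauchy–Schwarz separates the two products, each having a bounded square sum. Since `E` is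
surjective, the second is only repeated `q ^ (|I| - |J|)` times, so the extra rows `J` improve on
the bound from the rows `I` alone. -/
theorem IsWeight.sum_column_sq_le (hf : IsWeight C F f) (hC : 1 ≤ C) {I J : Finset (Fin n)}
    (E : J → I → K) (hE : LinearIndependent K E) (j : Fin n) :
    (∑ v : I → K, (∏ i : I, f i j (v i)) * ∏ i : J, f i j (∑ l, E i l * v l)) ^ 2 ≤
      (Fintype.card K : ℝ) ^ (I.card - J.card) *
        ((∏ i ∈ I, posBound K C F i j) * ∏ i ∈ J, posBound K C F i j) := by
  have hq : (0 : ℝ) < Fintype.card K := by exact_mod_cast Fintype.card_pos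
  have hJI : J.card ≤ I.card := by
    have := hE.fintype_card_le_finrank
    simpa using this
  refine (Finset.sum_mul_sq_le_sq_mul_sq _ _ _).trans ?_
  have h1 : ∑ v : I → K, (∏ i : I, f i j (v i)) ^ 2 ≤ ∏ i ∈ I, posBound K C F i j := by
    simp only [← Finset.prod_pow]
    rw [sum_prod_apply (fun (i : I) x => f i j x ^ 2), ← Finset.prod_coe_sort I]
    exact Finset.prod_le_prod (fun i _ => Finset.sum_nonneg fun x _ => sq_nonneg _)
      fun i _ => hf.sum_sq_le_posBound hC _ _
  let g : (I → K) →+ (J → K) :=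
    { toFun := fun v i => ∑ l, E i l * v l
      map_zero' := by ext; simp
      map_add' := fun u v => by ext; simp [mul_add, Finset.sum_add_distrib] }
  have hg : Function.Surjective g := fun y => by
    classical
    obtain ⟨L, hL⟩ := exists_left_inverse_of_linearIndependent
      (W := (Matrix.of E).transpose) hE
    have hL' : Matrix.of E * L.transpose = 1 := by
      rw [← Matrix.transpose_one, ← hL, Matrix.transpose_mul, Matrix.transpose_transpose]
    refine ⟨L.transpose.mulVec y, ?_⟩
    have h2 : (Matrix.of E).mulVec (L.transpose.mulVec y) = y := by
      rw [Matrix.mulVec_mulVec, hL', Matrix.one_mulVec]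
    exact h2
  have h2 := card_mul_sum_comp g hg fun y => ∏ i : J, f i j (y i) ^ 2
  rw [sum_prod_apply (fun (i : J) x => f i j x ^ 2), Fintype.card_fun, Fintype.card_fun,
    Fintype.card_coe, Fintype.card_coe] at h2
  have h3 : ∏ i : J, ∑ x, f i j x ^ 2 ≤ ∏ i ∈ J, posBound K C F i j := by
    rw [← Finset.prod_coe_sort J]
    exact Finset.prod_le_prod (fun i _ => Finset.sum_nonneg fun x _ => sq_nonneg _)
      fun i _ => hf.sum_sq_le_posBound hC _ _
  have h4 : ∑ v : I → K, (∏ i : J, f i j (∑ l, E i l * v l)) ^ 2 ≤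
      (Fintype.card K : ℝ) ^ (I.card - J.card) * ∏ i ∈ J, posBound K C F i j := by
    simp only [← Finset.prod_pow]
    have h5 : (0 : ℝ) < (Fintype.card K : ℝ) ^ J.card := by positivity
    refine le_of_mul_le_mul_left ?_ h5
    rw [← mul_assoc, ← pow_add, Nat.add_sub_cancel' hJI]
    push_cast at h2
    exact h2.le.trans (mul_le_mul_of_nonneg_left h3 (by positivity))
  calc _ ≤ (∏ i ∈ I, posBound K C F i j) *
        ((Fintype.card K : ℝ) ^ (I.card - J.card) * ∏ i ∈ J, posBound K C F i j) :=
        mul_le_mul h1 h4 (Finset.sum_nonneg fun _ _ => sq_nonneg _)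
          (Finset.prod_nonneg fun i _ => zero_le_one.trans (one_le_posBound hC i j))
    _ = _ := by ring

theorem IsWeight.sum_entry_sq_le (hf : IsWeight C F f) (hC : 1 ≤ C) (i j : Fin n) :
    (∑ x, f i j x) ^ 2 ≤ Fintype.card K * posBound K C F i j := by
  have h := Finset.sum_mul_sq_le_sq_mul_sq Finset.univ (fun _ : K => (1 : ℝ)) (f i j)
  simp only [one_mul, one_pow, Finset.sum_const, Finset.card_univ, nsmul_eq_mul, mul_one] at h
  exact h.trans (mul_le_mul_of_nonneg_left (hf.sum_sq_le_posBound hC i j) (by positivity))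

/-- A symmetric matrix is determined by a set of rows spanning its row space. -/
theorem symm_eq_of_rows_eq {K : Type*} [Field K] {b b' : Matrix (Fin n) (Fin n) K} (hb : b.IsSymm) (hb' : b'.IsSymm)
    {I : Finset (Fin n)} (hI : ∀ i, b i ∈ Submodule.span K (b '' I))
    (hI' : ∀ i, b' i ∈ Submodule.span K (b' '' I)) (h : ∀ i ∈ I, b i = b' i) : b = b' := by
  have himg : b' '' I = b '' I := Set.image_congr fun i hi => (h i hi).symm
  ext j j'
  have hy : b j - b' j ∈ Submodule.span K (b '' I) :=
    Submodule.sub_mem _ (hI j) (himg ▸ hI' j)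
  set y := b j - b' j with hydef
  have hyI : ∀ i ∈ I, y i = 0 := fun i hi => by
    have h1 := congr_fun (h i hi) j
    have h2 : b j i = b' j i := by rw [← hb.apply, ← hb'.apply, h1]
    simp [hydef, h2]
  -- By symmetry every vector of the row space has the form `b d`. For the difference `y = b d`,
  -- vanishing on `I` says that `d` is orthogonal to the rows in `I`, hence to all rows, so `y = 0`.
  have hz : ∀ z ∈ Submodule.span K (b '' I), ∃ d : Fin n → K, ∀ i, z i = b i ⬝ᵥ d := by
    intro z hz
    induction hz using Submodule.span_induction with
    | mem z hz =>
      obtain ⟨l, -, rfl⟩ := hz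
      refine ⟨Pi.single l 1, fun i => ?_⟩
      rw [dotProduct_single, mul_one, hb.apply]
    | zero => exact ⟨0, by simp⟩
    | add z w _ _ hz hw =>
      obtain ⟨d, hd⟩ := hz
      obtain ⟨e, he⟩ := hw
      exact ⟨d + e, fun i => by rw [Pi.add_apply, hd, he, dotProduct_add]⟩
    | smul c z _ hz =>
      obtain ⟨d, hd⟩ := hz
      exact ⟨c • d, fun i => by rw [Pi.smul_apply, hd, dotProduct_smul]⟩
  obtain ⟨d, hd⟩ := hz y hy
  have hvan : ∀ z ∈ Submodule.span K (b '' I), z ⬝ᵥ d = 0 := by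
    intro z hz
    induction hz using Submodule.span_induction with
    | mem z hz =>
      obtain ⟨l, hl, rfl⟩ := hz
      rw [← hd, hyI l hl]
    | zero => simp
    | add z w _ _ hz hw => rw [add_dotProduct, hz, hw, add_zero]
    | smul c z _ hz => rw [smul_dotProduct, hz, smul_zero]
  have h0 : y j' = 0 := by rw [hd, hvan _ (hI j')]
  rw [hydef, Pi.sub_apply, sub_eq_zero] at h0
  exact h0

end RankSum

section RankSum

variable {K : Type*} [Field K] [Fintype K] {n : ℕ} {C : ℝ} {F : Fin n → Finset (Fin n)}
  {f : Fin n → Fin n → K → ℝ}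

theorem mem_span_image_finset {K V ι : Type*} [Field K] [AddCommGroup V]
    [Module K V] {b : ι → V}
    {I : Finset ι} {v : V} :
    v ∈ Submodule.span K (b '' I) ↔ ∃ e : I → K, v = ∑ l, e l • b l := by
  rw [Set.image_eq_range]
  rw [Submodule.mem_span_range_iff_exists_fun]
  exact ⟨fun ⟨e, he⟩ => ⟨e, he.symm⟩, fun ⟨e, he⟩ => ⟨e, he.symm⟩⟩

/-- Symmetric matrices whose rows in `I` span the row space and whose columns in `J`, restricted to
the rows in `I`, are independent. -/
def LargeBlock (I J : Finset (Fin n)) (b : Matrix (Fin n) (Fin n) K) : Prop :=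
  b.IsSymm ∧ (∀ i, b i ∈ Submodule.span K (b '' I)) ∧
    LinearIndependent K fun (j : J) (l : I) => b l j

/-- Symmetric matrices whose rows in `I` span the row space, such that outside the columns in `I`
these rows are combinations of those in `J ⊆ I`. -/
def SmallBlock (I J : Finset (Fin n)) (b : Matrix (Fin n) (Fin n) K) : Prop :=
  b.IsSymm ∧ (∀ i, b i ∈ Submodule.span K (b '' I)) ∧
    ∃ E : I → J → K, ∀ (l : I), ∀ j ∉ I, b l j = ∑ i, E l i * b i j

open Classical in
-- A matrix is encoded by its `I × I` block, the coefficients `E` of the rows `J` in the rows `I`,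
-- and the entries of the rows `I` in the columns outside `I ∪ J`; symmetry recovers the columns in
-- `J`. A relation among the rows of `E` would be one among the columns `J`, so `E` is independent.
-- The first two data are counted trivially, and the remaining columns factor into column sums.
theorem IsWeight.sum_offWeight_large_le (hf : IsWeight C F f) (hC : 1 ≤ C) {I J : Finset (Fin n)}
    (hIJ : Disjoint I J) :
    ∑ b : Matrix (Fin n) (Fin n) K with LargeBlock I J b, offWeight f b ≤
      (Fintype.card K : ℝ) ^ (I.card * I.card + J.card * I.card) *
        √((Fintype.card K : ℝ) ^ ((I.card - J.card) * n) * (C ^ ((I ∪ J).card * n) *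
          (Fintype.card K : ℝ) ^ ∑ i ∈ I ∪ J, (F i).card)) := by
  have hq : (1 : ℝ) ≤ Fintype.card K := by exact_mod_cast Fintype.card_pos
  set s := Finset.univ.filter fun b : Matrix (Fin n) (Fin n) K => LargeBlock I J b with hs
  set Y := (I ∪ J)ᶜ with hY
  have hmem : ∀ b ∈ s, LargeBlock I J b := fun b hb => (Finset.mem_filter.1 hb).2
  have hex : ∀ b ∈ s, ∀ i, ∃ e : I → K, b i = ∑ l, e l • b l := fun b hb i =>
    mem_span_image_finset.1 ((hmem b hb).2.1 i)
  choose! E hE using hex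
  let D (E : J → I → K) (j : Fin n) : ℝ :=
    ∑ v : I → K, (∏ i : I, f i j (v i)) * ∏ i : J, f i j (∑ l, E i l * v l)
  let φ : Matrix (Fin n) (Fin n) K → (I → I → K) × (J → I → K) × (Y → I → K) :=
    fun b => (fun i l => b i l, fun i => E b i, fun j l => b l j)
  let Φ : (I → I → K) × (J → I → K) × (Y → I → K) → ℝ := fun d =>
    if LinearIndependent K d.2.1 then
      ∏ j : Y, ((∏ i : I, f i j (d.2.2 j i)) * ∏ i : J, f i j (∑ l, d.2.1 i l * d.2.2 j l))
    else 0
  have hcol : ∀ b ∈ s, ∀ i j, b i j = ∑ l : I, E b i l * b l j := fun b hb i j => by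
    have h := congr_fun (hE b hb i) j
    simpa [Finset.sum_apply] using h
  have hinj : Set.InjOn φ s := by
    intro b hb b' hb' h
    obtain ⟨h1, h2⟩ := Prod.mk.inj h
    obtain ⟨h2, h3⟩ := Prod.mk.inj h2
    have hb1 := hmem b hb
    have hb2 := hmem b' hb'
    refine symm_eq_of_rows_eq hb1.1 hb2.1 hb1.2.1 hb2.2.1 fun i hi => ?_
    ext j
    by_cases hjI : j ∈ I
    · exact congr_fun₂ h1 ⟨i, hi⟩ ⟨j, hjI⟩
    by_cases hjJ : j ∈ J
    · rw [← hb1.1.apply, ← hb2.1.apply, hcol b hb, hcol b' hb']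
      refine Finset.sum_congr rfl fun l _ => ?_
      rw [show E b j = E b' j from congr_fun h2 ⟨j, hjJ⟩,
        show b l i = b' l i from congr_fun₂ h1 l ⟨i, hi⟩]
    · have hjY : j ∈ Y := by simp [hY, hjI, hjJ]
      exact congr_fun₂ h3 ⟨j, hjY⟩ ⟨i, hi⟩
  have hD0 : ∀ E j, 0 ≤ D E j := fun E j => Finset.sum_nonneg fun v _ =>
    mul_nonneg (Finset.prod_nonneg fun _ _ => hf.nonneg _ _ _)
      (Finset.prod_nonneg fun _ _ => hf.nonneg _ _ _)
  have hΦ : ∀ d, 0 ≤ Φ d := fun d => by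
    simp only [Φ]
    split_ifs
    · exact Finset.prod_nonneg fun j _ => mul_nonneg (Finset.prod_nonneg fun _ _ => hf.nonneg _ _ _)
        (Finset.prod_nonneg fun _ _ => hf.nonneg _ _ _)
    · exact le_rfl
  have hind : ∀ b ∈ s, LinearIndependent K fun i : J => E b i := by
    intro b hb
    have h := (hmem b hb).2.2
    rw [Fintype.linearIndependent_iff] at h ⊢
    intro c hc
    refine h c ?_
    ext l'
    have h2 : ∑ i : J, c i * b l' i = ∑ l : I, (∑ i : J, c i * E b i l) * b l l' := by
      simp only [Finset.sum_mul]
      rw [Finset.sum_comm]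
      refine Finset.sum_congr rfl fun i _ => ?_
      rw [← (hmem b hb).1.apply, hcol b hb, Finset.mul_sum]
      exact Finset.sum_congr rfl fun l _ => by ring
    have h3 : ∀ l : I, ∑ i : J, c i * E b i l = 0 := fun l => by
      have := congr_fun hc l
      simpa [Finset.sum_apply] using this
    simp only [Finset.sum_apply, Pi.smul_apply, smul_eq_mul, Pi.zero_apply]
    rw [h2]
    exact Finset.sum_eq_zero fun l _ => by rw [h3, zero_mul]
  have hle : ∀ b ∈ s, offWeight f b ≤ Φ (φ b) := by
    intro b hb
    simp only [Φ, φ]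
    rw [if_pos (hind b hb)]
    refine (hf.offWeight_le (hmem b hb).1 (X := I ∪ J) (Y := Y) disjoint_compl_right).trans
      (le_of_eq ?_)
    rw [← Finset.prod_coe_sort Y]
    refine Finset.prod_congr rfl fun j _ => ?_
    rw [Finset.prod_union hIJ, ← Finset.prod_coe_sort I, ← Finset.prod_coe_sort J]
    congr 1
    exact Finset.prod_congr rfl fun i _ => by rw [hcol b hb]
  refine (sum_le_sum_of_injOn_of_le s φ hinj _ Φ hΦ hle).trans ?_
  have hbound : ∀ E : J → I → K, ∑ V : Y → I → K,
      (if LinearIndependent K E then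
        ∏ j : Y, ((∏ i : I, f i j (V j i)) * ∏ i : J, f i j (∑ l, E i l * V j l)) else 0) ≤
        √((Fintype.card K : ℝ) ^ ((I.card - J.card) * n) * (C ^ ((I ∪ J).card * n) *
          (Fintype.card K : ℝ) ^ ∑ i ∈ I ∪ J, (F i).card)) := by
    intro E
    by_cases hE : LinearIndependent K E
    swap
    · simp only [hE, if_false, Finset.sum_const_zero]
      exact Real.sqrt_nonneg _
    simp only [hE, if_true]
    rw [sum_prod_apply (fun (j : Y) (v : I → K) => (∏ i : I, f i j (v i)) *
      ∏ i : J, f i j (∑ l, E i l * v l))]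
    apply Real.le_sqrt_of_sq_le
    rw [← Finset.prod_pow]
    calc ∏ j : Y, (D E j) ^ 2 ≤ ∏ j : Y, ((Fintype.card K : ℝ) ^ (I.card - J.card) *
          ((∏ i ∈ I, posBound K C F i j) * ∏ i ∈ J, posBound K C F i j)) :=
          Finset.prod_le_prod (fun j _ => sq_nonneg _) fun j _ => hf.sum_column_sq_le hC E hE j
      _ = ((Fintype.card K : ℝ) ^ (I.card - J.card)) ^ Y.card *
          ∏ j ∈ Y, ∏ i ∈ I ∪ J, posBound K C F i j := by
          rw [Finset.prod_mul_distrib, Finset.prod_const, Finset.card_univ, Fintype.card_coe,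
            ← Finset.prod_coe_sort Y]
          simp only [Finset.prod_union hIJ]
      _ ≤ _ := by
          refine mul_le_mul ?_ (prod_posBound_le hC (I ∪ J) Y) (Finset.prod_nonneg fun j _ =>
            Finset.prod_nonneg fun i _ => zero_le_one.trans (one_le_posBound hC i j)) (by positivity)
          rw [← pow_mul]
          refine pow_le_pow_right₀ hq (Nat.mul_le_mul_left _ ?_)
          simpa using Finset.card_le_univ Y
  rw [Fintype.sum_prod_type]
  simp only [Fintype.sum_prod_type, Φ]
  refine (Finset.sum_le_sum fun G _ => Finset.sum_le_sum fun E _ => hbound E).trans (le_of_eq ?_)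
  simp only [Finset.sum_const, Finset.card_univ, Fintype.card_fun, Fintype.card_coe, nsmul_eq_mul]
  push_cast
  rw [← pow_mul, ← pow_mul, pow_add, mul_comm J.card I.card]
  ring

open Classical in
-- Outside the columns `I` the matrix is determined by its rows in `J` and by the coefficients `E`.
-- Only the weights on the rows `J` are kept; by Cauchy–Schwarz a regular entry costs `√(q C)`
-- instead of `q`.
theorem IsWeight.sum_offWeight_small_le (hf : IsWeight C F f) (hC : 1 ≤ C) {I J : Finset (Fin n)}
    (hJI : J ⊆ I) :
    ∑ b : Matrix (Fin n) (Fin n) K with SmallBlock I J b, offWeight f b ≤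
      (Fintype.card K : ℝ) ^ (I.card * I.card + J.card * I.card) *
        √((Fintype.card K : ℝ) ^ (J.card * n) * (C ^ (J.card * n) *
          (Fintype.card K : ℝ) ^ ∑ i ∈ J, (F i).card)) := by
  have hq : (1 : ℝ) ≤ Fintype.card K := by exact_mod_cast Fintype.card_pos
  set s := Finset.univ.filter fun b : Matrix (Fin n) (Fin n) K => SmallBlock I J b with hs
  set Y := Iᶜ with hY
  have hmem : ∀ b ∈ s, SmallBlock I J b := fun b hb => (Finset.mem_filter.1 hb).2
  have hex : ∀ b ∈ s, ∃ E : I → J → K, ∀ (l : I), ∀ j ∉ I, b l j = ∑ i, E l i * b i j :=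
    fun b hb => (hmem b hb).2.2
  choose! E hE using hex
  let φ : Matrix (Fin n) (Fin n) K → (I → I → K) × (I → J → K) × (Y → J → K) :=
    fun b => (fun i l => b i l, E b, fun j l => b l j)
  let Φ : (I → I → K) × (I → J → K) × (Y → J → K) → ℝ := fun d =>
    ∏ j : Y, ∏ i : J, f i j (d.2.2 j i)
  have hinj : Set.InjOn φ s := by
    intro b hb b' hb' h
    obtain ⟨h1, h2⟩ := Prod.mk.inj h
    obtain ⟨h2, h3⟩ := Prod.mk.inj h2
    have hb1 := hmem b hb
    have hb2 := hmem b' hb'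
    refine symm_eq_of_rows_eq hb1.1 hb2.1 hb1.2.1 hb2.2.1 fun i hi => ?_
    ext j
    by_cases hjI : j ∈ I
    · exact congr_fun₂ h1 ⟨i, hi⟩ ⟨j, hjI⟩
    · have hjY : j ∈ Y := by simp [hY, hjI]
      have h4 := hE b hb ⟨i, hi⟩ j hjI
      have h5 := hE b' hb' ⟨i, hi⟩ j hjI
      rw [h2] at h4
      refine h4.trans (Eq.trans ?_ h5.symm)
      refine Finset.sum_congr rfl fun l _ => ?_
      rw [show b l j = b' l j from congr_fun₂ h3 ⟨j, hjY⟩ l]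
  have hΦ : ∀ d, 0 ≤ Φ d := fun d =>
    Finset.prod_nonneg fun j _ => Finset.prod_nonneg fun _ _ => hf.nonneg _ _ _
  have hle : ∀ b ∈ s, offWeight f b ≤ Φ (φ b) := by
    intro b hb
    refine (hf.offWeight_le (hmem b hb).1 (X := J) (Y := Y)
      (disjoint_compl_right.mono_left hJI)).trans (le_of_eq ?_)
    rw [← Finset.prod_coe_sort Y]
    exact Finset.prod_congr rfl fun j _ => by rw [← Finset.prod_coe_sort J]
  refine (sum_le_sum_of_injOn_of_le s φ hinj _ Φ hΦ hle).trans ?_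
  have hbound : ∑ V : Y → J → K, ∏ j : Y, ∏ i : J, f i j (V j i) ≤
        √((Fintype.card K : ℝ) ^ (J.card * n) * (C ^ (J.card * n) *
          (Fintype.card K : ℝ) ^ ∑ i ∈ J, (F i).card)) := by
    rw [sum_prod_apply (fun (j : Y) (v : J → K) => ∏ i : J, f i j (v i))]
    rw [Finset.prod_congr rfl fun (j : Y) _ => sum_prod_apply (fun (i : J) x => f i j x)]
    apply Real.le_sqrt_of_sq_le
    simp only [← Finset.prod_pow]
    calc ∏ j : Y, ∏ i : J, (∑ x, f i j x) ^ 2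
        ≤ ∏ j : Y, ∏ i : J, (Fintype.card K * posBound K C F i j) :=
          Finset.prod_le_prod (fun j _ => Finset.prod_nonneg fun i _ => sq_nonneg _) fun j _ =>
            Finset.prod_le_prod (fun i _ => sq_nonneg _) fun i _ => hf.sum_entry_sq_le hC _ _
      _ = ((Fintype.card K : ℝ) ^ J.card) ^ Y.card * ∏ j ∈ Y, ∏ i ∈ J, posBound K C F i j := by
          simp only [Finset.prod_mul_distrib, Finset.prod_const, Finset.card_univ,
            Fintype.card_coe]
          rw [← Finset.prod_coe_sort Y]
          congr 1
          exact Finset.prod_congr rfl fun j _ => by rw [← Finset.prod_coe_sort J]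
      _ ≤ _ := by
          refine mul_le_mul ?_ (prod_posBound_le hC J Y) (Finset.prod_nonneg fun j _ =>
            Finset.prod_nonneg fun i _ => zero_le_one.trans (one_le_posBound hC i j)) (by positivity)
          rw [← pow_mul]
          refine pow_le_pow_right₀ hq (Nat.mul_le_mul_left _ ?_)
          simpa using Finset.card_le_univ Y
  rw [Fintype.sum_prod_type]
  simp only [Fintype.sum_prod_type, Φ]
  refine (Finset.sum_le_sum fun G _ => Finset.sum_le_sum fun E _ => hbound).trans (le_of_eq ?_)
  simp only [Finset.sum_const, Finset.card_univ, Fintype.card_fun, Fintype.card_coe, nsmul_eq_mul]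
  push_cast
  rw [← pow_mul, ← pow_mul, pow_add]
  ring

theorem exists_finset_basis (K : Type*) {V ι : Type*} [Field K] [AddCommGroup V] [Module K V]
    (v : ι → V) (s : Finset ι) :
    ∃ I ⊆ s, (LinearIndependent K fun i : I => v i) ∧
      (∀ i ∈ s, v i ∈ Submodule.span K (v '' I)) ∧
      I.card = Module.finrank K (Submodule.span K (v '' s)) := by
  classical
  obtain ⟨t, hts, -, hspan, hli⟩ := exists_linearIndepOn_extension (v := v)
    (linearIndepOn_empty K v) (Set.empty_subset (s : Set ι))
  obtain ⟨I, rfl⟩ := (s.finite_toSet.subset hts).exists_finset_coe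
  refine ⟨I, by exact_mod_cast hts, hli, fun i hi => hspan ⟨i, hi, rfl⟩, ?_⟩
  have h1 : Submodule.span K (v '' s) = Submodule.span K (v '' I) :=
    le_antisymm (Submodule.span_le.2 hspan) (Submodule.span_mono (Set.image_mono hts))
  have h2 := finrank_span_eq_card (R := K) hli
  rw [h1, Set.image_eq_range]
  exact (h2.trans (Fintype.card_coe I)).symm

/-- Every symmetric matrix has a set `I` of `rank b` rows spanning its row space, and a large
independent block or a small spanning block relative to it. -/
theorem exists_block {K : Type*} [Field K] {b : Matrix (Fin n) (Fin n) K} (hb : b.IsSymm) :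
    ∃ I J : Finset (Fin n), I.card = b.rank ∧
      ((Disjoint I J ∧ J.card ≤ I.card ∧ I.card ≤ 2 * J.card ∧ LargeBlock I J b) ∨
        (J ⊆ I ∧ 2 * J.card ≤ I.card ∧ SmallBlock I J b)) := by
  classical
  obtain ⟨I, -, -, hspan, hIcard⟩ := exists_finset_basis K b.row Finset.univ
  obtain ⟨J, hJ, hJli, -, hJcard⟩ :=
    exists_finset_basis K (fun (j : Fin n) (l : I) => b l j) Iᶜ
  obtain ⟨J', hJ', -, hspan', hJcard'⟩ :=
    exists_finset_basis K (fun (l : Fin n) (j : (Iᶜ : Finset (Fin n))) => b l j) I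
  have hspan₁ : ∀ i, b i ∈ Submodule.span K (b '' I) := fun i => hspan i (Finset.mem_univ i)
  have hrank : I.card = b.rank := by
    rw [Matrix.rank_eq_finrank_span_row, hIcard, Finset.coe_univ, Set.image_univ]
  have hJI : J.card ≤ I.card := by
    have := hJli.fintype_card_le_finrank
    simpa using this
  -- Row rank equals column rank for the block with rows `I` and columns outside `I`. Comparing this
  -- rank with `|I| / 2` decides between the two alternatives.
  have hJJ : J.card = J'.card := by
    let B : Matrix I (Iᶜ : Finset (Fin n)) K := Matrix.of fun l j => b l j
    have h1 : B.rank = J'.card := by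
      rw [Matrix.rank_eq_finrank_span_row, hJcard', Set.image_eq_range]
      rfl
    have h2 : B.transpose.rank = J.card := by
      rw [Matrix.rank_eq_finrank_span_row, hJcard, Set.image_eq_range]
      rfl
    rw [← h1, ← h2, Matrix.rank_transpose]
  by_cases hcase : I.card ≤ 2 * J.card
  · refine ⟨I, J, hrank, Or.inl ⟨?_, hJI, hcase, hb, hspan₁, hJli⟩⟩
    exact (disjoint_compl_right (a := I)).mono_right hJ
  · refine ⟨I, J', hrank, Or.inr ⟨hJ', by omega, hb, hspan₁, ?_⟩⟩
    have h : ∀ l : I, ∃ e : J' → K, (fun j : (Iᶜ : Finset (Fin n)) => b l j) =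
        ∑ i, e i • fun j : (Iᶜ : Finset (Fin n)) => b i j := fun l =>
      mem_span_image_finset.1 (hspan' l l.2)
    choose E hE using h
    refine ⟨E, fun l j hj => ?_⟩
    have := congr_fun (hE l) ⟨j, Finset.mem_compl.2 hj⟩
    simpa [Finset.sum_apply] using this

end RankSum

/-! ### Quadratic forms with a given polar form -/

section Diagonal

open Matrix Module

variable {K : Type*} [Field K] {n : ℕ}

/-- Twice the quadratic form is its polar form on the diagonal, so the form vanishes on the radical.
-/
theorem quadRank_eq_rank_of_two_ne_zero (h2 : (2 : K) ≠ 0) (U : Matrix (Fin n) (Fin n) K) :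
    quadRank U = (U + Uᵀ).rank := by
  have h1 : singularRadical U = LinearMap.ker (U + Uᵀ).mulVecLin := by
    refine le_antisymm (singularRadical_le_ker U) fun x hx => ?_
    have hx' : (U + Uᵀ) *ᵥ x = 0 := hx
    refine ⟨hx', ?_⟩
    have h3 : x ⬝ᵥ (U + Uᵀ) *ᵥ x = 0 := by rw [hx', dotProduct_zero]
    rw [add_mulVec, dotProduct_add, mulVec_transpose, dotProduct_comm x (x ᵥ* U),
      ← dotProduct_mulVec, ← two_mul] at h3
    exact (mul_eq_zero.1 h3).resolve_left h2
  have h3 := finrank_ker_mulVecLin_add_rank (U + Uᵀ)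
  have h4 := finrank_singularRadical_add U
  rw [h1] at h4
  rw [Fintype.card_fin] at h3
  omega

/-- In characteristic two the form is additive on the radical of its polar form and satisfies `Q(c
x) = c² Q(x)`. Every scalar of a finite field is then a square, so any two values can be matched by
scaling, and the zeros have codimension at most one in the radical. -/
theorem quadRank_le_rank_add_one [Finite K] (h2 : ringChar K = 2) (U : Matrix (Fin n) (Fin n) K) :
    quadRank U ≤ (U + Uᵀ).rank + 1 := by
  have h3 := finrank_ker_mulVecLin_add_rank (U + Uᵀ)
  have h4 := finrank_singularRadical_add U
  rw [Fintype.card_fin] at h3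
  suffices h : finrank K (LinearMap.ker (U + Uᵀ).mulVecLin) ≤ finrank K (singularRadical U) + 1 by
    omega
  by_cases hx : ∃ x, (U + Uᵀ) *ᵥ x = 0 ∧ x ⬝ᵥ U *ᵥ x ≠ 0
  · obtain ⟨x, hx, hx'⟩ := hx
    have hle : LinearMap.ker (U + Uᵀ).mulVecLin ≤ singularRadical U ⊔ Submodule.span K {x} := by
      intro y hy
      have hy' : (U + Uᵀ) *ᵥ y = 0 := hy
      obtain ⟨c, hc⟩ := FiniteField.isSquare_of_char_two h2 ((y ⬝ᵥ U *ᵥ y) / (x ⬝ᵥ U *ᵥ x))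
      have hc' : y ⬝ᵥ U *ᵥ y = c * c * (x ⬝ᵥ U *ᵥ x) := by rw [← hc, div_mul_cancel₀ _ hx']
      refine Submodule.mem_sup.2 ⟨y - c • x, ⟨?_, ?_⟩, c • x,
        Submodule.smul_mem _ _ (Submodule.mem_span_singleton_self x), sub_add_cancel _ _⟩
      · rw [mulVec_sub, mulVec_smul, hx, hy', smul_zero, sub_zero]
      · have hpol : x ⬝ᵥ U *ᵥ y + y ⬝ᵥ U *ᵥ x = 0 := by
          have h5 : x ⬝ᵥ (U + Uᵀ) *ᵥ y = 0 := by rw [hy', dotProduct_zero]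
          rwa [add_mulVec, dotProduct_add, mulVec_transpose, dotProduct_comm x (y ᵥ* U),
            ← dotProduct_mulVec] at h5
        have htwo : (2 : K) = 0 := by
          have := ringChar.Nat.cast_ringChar (R := K)
          rw [h2] at this
          exact_mod_cast this
        rw [mulVec_sub, dotProduct_sub, sub_dotProduct, sub_dotProduct, mulVec_smul,
          dotProduct_smul, dotProduct_smul, smul_dotProduct, smul_dotProduct]
        simp only [smul_eq_mul]
        linear_combination hc' - c * hpol + c * c * (x ⬝ᵥ U *ᵥ x) * htwo
    have h5 := Submodule.finrank_mono hle
    have h6 := Submodule.finrank_add_le_finrank_add_finrank (singularRadical U)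
      (Submodule.span K {x})
    have h7 : finrank K (Submodule.span K {x}) ≤ 1 := by
      simpa using finrank_span_le_card (R := K) ({x} : Set (Fin n → K))
    omega
  · push Not at hx
    have : LinearMap.ker (U + Uᵀ).mulVecLin ≤ singularRadical U := fun x hx' => ⟨hx', hx x hx'⟩
    have := Submodule.finrank_mono this
    omega

theorem eq_zero_of_quadRank_eq_zero {U : Matrix (Fin n) (Fin n) K} (hU : upperPart U = U)
    (h : quadRank U = 0) : U = 0 := by
  have h1 := finrank_singularRadical_add U
  have h2 : singularRadical U = ⊤ := by
    refine Submodule.eq_top_of_finrank_eq ?_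
    rw [finrank_fin_fun]
    omega
  rw [← hU, upperPart_eq_zero_iff]
  intro x
  have h3 : x ∈ singularRadical U := by rw [h2]; trivial
  exact h3.2

theorem apply_eq_of_polar_eq {U U' : Matrix (Fin n) (Fin n) K} (hU : upperPart U = U)
    (hU' : upperPart U' = U') (h : U + Uᵀ = U' + U'ᵀ) {i j : Fin n} (hij : i ≠ j) :
    U i j = U' i j := by
  have hlow : ∀ {V : Matrix (Fin n) (Fin n) K}, upperPart V = V → ∀ {i j : Fin n}, j < i →
      V i j = 0 := fun hV i j hij => by
    rw [← hV, upperPart_apply, if_neg hij.not_gt, if_neg hij.ne']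
  rcases lt_or_gt_of_ne hij with h1 | h1
  · have h2 := congr_fun₂ h i j
    simp only [Matrix.add_apply, transpose_apply] at h2
    rwa [hlow hU h1, hlow hU' h1, add_zero, add_zero] at h2
  · rw [hlow hU h1, hlow hU' h1]

theorem eq_of_polar_eq_of_diag_eq {U U' : Matrix (Fin n) (Fin n) K} (hU : upperPart U = U)
    (hU' : upperPart U' = U') (h : U + Uᵀ = U' + U'ᵀ) (hd : ∀ i, U i i = U' i i) : U = U' := by
  ext i j
  by_cases hij : i = j
  · rw [hij, hd]
  · exact apply_eq_of_polar_eq hU hU' h hij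

theorem quad_sub_quad_of_polar_eq {U U' : Matrix (Fin n) (Fin n) K} (hU : upperPart U = U)
    (hU' : upperPart U' = U') (h : U + Uᵀ = U' + U'ᵀ) (x : Fin n → K) :
    x ⬝ᵥ U *ᵥ x - x ⬝ᵥ U' *ᵥ x = ∑ i, (U i i - U' i i) * (x i * x i) := by
  rw [dotProduct_mulVec_eq_sum, dotProduct_mulVec_eq_sum, ← Finset.sum_sub_distrib]
  refine Finset.sum_congr rfl fun i _ => ?_
  rw [← Finset.sum_sub_distrib, Finset.sum_eq_single i]
  · ring
  · intro j _ hj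
    rw [apply_eq_of_polar_eq hU hU' h hj.symm, sub_self]
  · simp

theorem quad_eq_zero_of_quadRank_eq {U : Matrix (Fin n) (Fin n) K}
    (h : quadRank U = (U + Uᵀ).rank) {x : Fin n → K} (hx : (U + Uᵀ) *ᵥ x = 0) :
    x ⬝ᵥ U *ᵥ x = 0 := by
  have h3 := finrank_ker_mulVecLin_add_rank (U + Uᵀ)
  have h4 := finrank_singularRadical_add U
  rw [Fintype.card_fin] at h3
  have h5 := Submodule.eq_of_le_of_finrank_eq (singularRadical_le_ker U) (by omega)
  have h6 : x ∈ singularRadical U := by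
    rw [h5]
    exact hx
  exact h6.2

/-- If the quadratic form vanishes on the radical of its polar form `b`, it is determined by `b` and
the diagonal entries at a spanning set of rows of `b`. -/
theorem eq_of_polar_eq_of_quadRank_eq {U U' : Matrix (Fin n) (Fin n) K} (hU : upperPart U = U)
    (hU' : upperPart U' = U') (h : U + Uᵀ = U' + U'ᵀ) (hr : quadRank U = (U + Uᵀ).rank)
    (hr' : quadRank U' = (U' + U'ᵀ).rank) {I : Finset (Fin n)}
    (hI : ∀ i, (U + Uᵀ).row i ∈ Submodule.span K ((U + Uᵀ).row '' I))
    (hd : ∀ i ∈ I, U i i = U' i i) : U = U' := by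
  classical
  refine eq_of_polar_eq_of_diag_eq hU hU' h fun j => ?_
  by_cases hj : j ∈ I
  · exact hd j hj
  obtain ⟨e, he⟩ := mem_span_image_finset.1 (hI j)
  -- The relation expressing row `j` through the rows `I` becomes a vector of the radical, where
  -- both forms vanish. The forms differ by `∑ (U i i - U' i i) xᵢ²`, in which only `i = j`
  -- survives, with `xⱼ = 1`.
  set x : Fin n → K := Pi.single j 1 - ∑ l : I, e l • Pi.single (l : Fin n) 1 with hx
  have hsymm : (U + Uᵀ)ᵀ = U + Uᵀ := by rw [transpose_add, transpose_transpose, add_comm]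
  have hbx : (U + Uᵀ) *ᵥ x = 0 := by
    have hrow : ∀ i, (U + Uᵀ) *ᵥ Pi.single i 1 = (U + Uᵀ).row i := fun i => by
      rw [mulVec_single_one]
      ext l
      exact congr_fun₂ hsymm i l
    rw [hx, mulVec_sub, mulVec_sum, hrow, he, sub_eq_zero]
    refine Finset.sum_congr rfl fun l _ => ?_
    rw [mulVec_smul, hrow]
  have h1 := quad_sub_quad_of_polar_eq hU hU' h x
  rw [quad_eq_zero_of_quadRank_eq hr hbx, quad_eq_zero_of_quadRank_eq hr' (h ▸ hbx), sub_zero,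
    Finset.sum_eq_single j] at h1
  · have hxj : x j = 1 := by
      rw [hx, Pi.sub_apply, Finset.sum_apply, Finset.sum_eq_zero, Pi.single_eq_same, sub_zero]
      intro l _
      rw [Pi.smul_apply, Pi.single_eq_of_ne (fun h' : j = (l : Fin n) => hj (by rw [h']; exact l.2)), smul_zero]
    rw [hxj, mul_one, mul_one] at h1
    exact (sub_eq_zero.1 h1.symm)
  · intro i _ hij
    by_cases hi : i ∈ I
    · rw [hd i hi, sub_self, zero_mul]
    · have hxi : x i = 0 := by
        rw [hx, Pi.sub_apply, Finset.sum_apply, Finset.sum_eq_zero, Pi.single_eq_of_ne hij, sub_zero]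
        intro l _
        rw [Pi.smul_apply, Pi.single_eq_of_ne (fun h' : i = (l : Fin n) => hi (by rw [h']; exact l.2)), smul_zero]
      rw [hxi, mul_zero, mul_zero]
  · simp

end Diagonal

/-! ### Total weight of the quadratic forms with a given polar form. -/

section WeightSum

open Matrix Module

variable {K : Type*} [Field K] [Fintype K] {n : ℕ} {C : ℝ} {F : Fin n → Finset (Fin n)}
  {f : Fin n → Fin n → K → ℝ}

theorem weightProd_eq_offWeight_mul {K : Type*} [Field K] {f : Fin n → Fin n → K → ℝ} {U : Matrix (Fin n) (Fin n) K}
    (hU : upperPart U = U) :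
    weightProd f U = offWeight f (U + Uᵀ) * ∏ i, f i i (U i i) := by
  rw [weightProd, offWeight, upperPos, strictUpperPos,
    ← Finset.prod_filter_mul_prod_filter_not _ (fun p => p.1 < p.2), Finset.filter_filter,
    Finset.filter_filter]
  congr 1
  · have h1 : Finset.univ.filter (fun p : Fin n × Fin n => p.1 ≤ p.2 ∧ p.1 < p.2) =
        Finset.univ.filter fun p => p.1 < p.2 :=
      Finset.filter_congr fun p _ => ⟨fun h => h.2, fun h => ⟨h.le, h⟩⟩
    rw [h1]
    refine Finset.prod_congr rfl fun p hp => ?_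
    have hp' : p.1 < p.2 := (Finset.mem_filter.1 hp).2
    have h2 : U p.2 p.1 = 0 := by
      rw [← hU, upperPart_apply, if_neg hp'.not_gt, if_neg hp'.ne']
    rw [Matrix.add_apply, transpose_apply, h2, add_zero]
  · symm
    refine Finset.prod_bij (fun i _ => (i, i)) (fun i _ => by simp) (fun i _ j _ h => ?_)
      (fun p hp => ?_) fun i _ => rfl
    · exact (Prod.mk.inj h).1
    · simp only [Finset.mem_filter, Finset.mem_univ, true_and, not_lt] at hp
      exact ⟨p.1, Finset.mem_univ _, Prod.ext rfl (le_antisymm hp.1 hp.2)⟩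

open Classical in
theorem IsWeight.sum_weightProd_le (hf : IsWeight C F f) (s : Finset (Matrix (Fin n) (Fin n) K))
    (m : ℕ) (D : ℝ) (hs : ∀ U ∈ s, upperPart U = U ∧ (U + Uᵀ).rank = m)
    (hD : ∀ b : Matrix (Fin n) (Fin n) K, b.IsSymm → b.rank = m →
      ∑ U ∈ s with U + Uᵀ = b, ∏ i, f i i (U i i) ≤ D) :
    ∑ U ∈ s, weightProd f U ≤
      D * ∑ b : Matrix (Fin n) (Fin n) K with b.IsSymm ∧ b.rank = m, offWeight f b := by
  rw [← Finset.sum_fiberwise_of_maps_to (g := fun U : Matrix (Fin n) (Fin n) K => U + Uᵀ)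
    (t := Finset.univ.filter fun b : Matrix (Fin n) (Fin n) K => b.IsSymm ∧ b.rank = m),
    Finset.mul_sum]
  · refine Finset.sum_le_sum fun b hb => ?_
    obtain ⟨-, hb1, hb2⟩ := Finset.mem_filter.1 hb
    calc ∑ U ∈ s with U + Uᵀ = b, weightProd f U
        = ∑ U ∈ s with U + Uᵀ = b, offWeight f b * ∏ i, f i i (U i i) := by
          refine Finset.sum_congr rfl fun U hU => ?_
          obtain ⟨h1, h2⟩ := Finset.mem_filter.1 hU
          rw [weightProd_eq_offWeight_mul (hs U h1).1, h2]
      _ ≤ _ := by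
          rw [← Finset.mul_sum, mul_comm]
          exact mul_le_mul_of_nonneg_right (hD b hb1 hb2) (hf.offWeight_nonneg b)
  · intro U hU
    simp only [Finset.mem_filter, Finset.mem_univ, true_and]
    refine ⟨?_, (hs U hU).2⟩
    rw [Matrix.IsSymm, transpose_add, transpose_transpose, add_comm]

open Classical in
-- Only the diagonal entries at `m` spanning rows are free, so bounding all weights by one suffices;
-- diagonal positions may be exceptional here.
theorem IsWeight.sum_diag_le_of_quadRank_eq (hf : IsWeight C F f)
    (s : Finset (Matrix (Fin n) (Fin n) K)) (m : ℕ)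
    (hs : ∀ U ∈ s, upperPart U = U ∧ quadRank U = (U + Uᵀ).rank)
    (b : Matrix (Fin n) (Fin n) K) (hbm : b.rank = m) :
    ∑ U ∈ s with U + Uᵀ = b, ∏ i, f i i (U i i) ≤ (Fintype.card K : ℝ) ^ m := by
  obtain ⟨I, -, -, hspan, hIcard⟩ := exists_finset_basis K b.row Finset.univ
  rw [Finset.coe_univ, Set.image_univ, ← rank_eq_finrank_span_row, hbm] at hIcard
  refine (sum_le_sum_of_injOn_of_le _ (fun (U : Matrix (Fin n) (Fin n) K) (i : I) => U i i) ?_ _ (fun _ => 1)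
    (fun _ => zero_le_one) fun U _ => ?_).trans (le_of_eq ?_)
  · intro U hU U' hU' h
    obtain ⟨h1, h2⟩ := Finset.mem_filter.1 hU
    obtain ⟨h1', h2'⟩ := Finset.mem_filter.1 hU'
    refine eq_of_polar_eq_of_quadRank_eq (I := I) (hs U h1).1 (hs U' h1').1 (h2.trans h2'.symm)
      (hs U h1).2 (hs U' h1').2 (fun i => ?_) fun i hi => congr_fun h ⟨i, hi⟩
    rw [h2]
    exact hspan i (Finset.mem_univ i)
  · exact Finset.prod_le_one (fun _ _ => hf.nonneg _ _ _) fun _ _ => hf.le_one _ _ _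
  · simp [hIcard]

open Classical in
-- Here the whole diagonal is free. Regularity of the diagonal gives, by Cauchy–Schwarz, `√(q C)`
-- per entry instead of `q`; this saving is what the assumption for even `q` provides.
theorem IsWeight.sum_diag_le_of_regular (hf : IsWeight C F f) (hF : ∀ i, i ∉ F i)
    (s : Finset (Matrix (Fin n) (Fin n) K)) (hs : ∀ U ∈ s, upperPart U = U)
    (b : Matrix (Fin n) (Fin n) K) :
    ∑ U ∈ s with U + Uᵀ = b, ∏ i, f i i (U i i) ≤ √(Fintype.card K * C) ^ n := by
  refine (sum_le_sum_of_injOn_of_le _ (fun (U : Matrix (Fin n) (Fin n) K) (i : Fin n) => U i i) ?_ _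
    (fun d : Fin n → K => ∏ i, f i i (d i)) (fun d => Finset.prod_nonneg fun _ _ => hf.nonneg _ _ _)
    fun U _ => le_rfl).trans ?_
  · intro U hU U' hU' h
    obtain ⟨h1, h2⟩ := Finset.mem_filter.1 hU
    obtain ⟨h1', h2'⟩ := Finset.mem_filter.1 hU'
    exact eq_of_polar_eq_of_diag_eq (hs U h1) (hs U' h1') (h2.trans h2'.symm) fun i => congr_fun h i
  · rw [sum_prod_apply (fun i x => f i i x)]
    calc ∏ i : Fin n, ∑ x, f i i x ≤ ∏ _i : Fin n, √(Fintype.card K * C) := by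
          refine Finset.prod_le_prod (fun i _ => Finset.sum_nonneg fun x _ => hf.nonneg _ _ _)
            fun i _ => Real.le_sqrt_of_sq_le ?_
          have h := Finset.sum_mul_sq_le_sq_mul_sq Finset.univ (fun _ : K => (1 : ℝ)) (f i i)
          simp only [one_mul, one_pow, Finset.sum_const, Finset.card_univ, nsmul_eq_mul,
            mul_one] at h
          exact h.trans (mul_le_mul_of_nonneg_left (hf.sum_sq_le i i (hF i)) (by positivity))
      _ = _ := by simp

end WeightSum

/-! ### Bounds in powers of the field size -/

theorem pow_le_rpow_div {q C D : ℝ} (hq : 0 ≤ q) (hC : 0 ≤ C) (hCq : C ≤ q ^ (1 / D)) (N : ℕ) :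
    C ^ N ≤ q ^ (N / D) := by
  refine (pow_le_pow_left₀ hC hCq N).trans (le_of_eq ?_)
  rw [← Real.rpow_natCast, ← Real.rpow_mul hq]
  congr 1
  ring

theorem sqrt_le_rpow_half {q x e : ℝ} (hq : 0 ≤ q) (h : x ≤ q ^ e) : √x ≤ q ^ (e / 2) := by
  refine Real.sqrt_le_iff.2 ⟨Real.rpow_nonneg hq _, h.trans (le_of_eq ?_)⟩
  rw [← Real.rpow_natCast, ← Real.rpow_mul hq]
  congr 1
  push_cast
  ring

theorem Finset.sum_union_le_sum_add {α : Type*} [DecidableEq α] (s t : Finset α) {g : α → ℝ}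
    (hg : ∀ a, 0 ≤ g a) : ∑ a ∈ s ∪ t, g a ≤ ∑ a ∈ s, g a + ∑ a ∈ t, g a := by
  have h := Finset.sum_union_inter (s₁ := s) (s₂ := t) (f := g)
  have h' := Finset.sum_nonneg fun a (_ : a ∈ s ∩ t) => hg a
  linarith

theorem Finset.sum_biUnion_le_sum {ι α : Type*} [DecidableEq α] (s : Finset ι)
    (A : ι → Finset α) {g : α → ℝ} (hg : ∀ a, 0 ≤ g a) :
    ∑ a ∈ s.biUnion A, g a ≤ ∑ x ∈ s, ∑ a ∈ A x, g a := by
  classical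
  induction s using Finset.induction_on with
  | empty => simp
  | insert x s hx ih =>
    rw [Finset.biUnion_insert, Finset.sum_insert hx]
    exact (Finset.sum_union_le_sum_add _ _ hg).trans (add_le_add_right ih _)

/-! ### Total weight of the symmetric matrices of given rank. -/

section RankBound

open Matrix Module

variable {K : Type*} [Field K] [Fintype K] {n : ℕ} {C : ℝ} {F : Fin n → Finset (Fin n)}
  {f : Fin n → Fin n → K → ℝ}

theorem pow_mul_pow_sum_le {q : ℝ} (hq : 1 ≤ q) (hC : 1 ≤ C) (hCq : C ≤ q ^ (1 / 100 : ℝ))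
    (hF : ∀ i, ((F i).card : ℝ) ≤ n / 100) (S : Finset (Fin n)) :
    C ^ (S.card * n) * q ^ ∑ i ∈ S, (F i).card ≤ q ^ ((S.card : ℝ) * n / 50) := by
  have hq0 : 0 < q := by linarith
  have h1 : ((∑ i ∈ S, (F i).card : ℕ) : ℝ) ≤ S.card * (n / 100) := by
    push_cast
    exact (Finset.sum_le_sum fun i _ => hF i).trans (by simp)
  calc C ^ (S.card * n) * q ^ ∑ i ∈ S, (F i).card
      ≤ q ^ (((S.card * n : ℕ) : ℝ) / 100) * q ^ (S.card * (n / 100) : ℝ) := by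
        refine mul_le_mul (pow_le_rpow_div hq0.le (by linarith) hCq _) ?_ (by positivity)
          (by positivity)
        rw [← Real.rpow_natCast]
        exact Real.rpow_le_rpow_of_exponent_le hq h1
    _ = _ := by
        rw [← Real.rpow_add hq0]
        congr 1
        push_cast
        ring

open Classical in
-- A column costs exponent `(m - |J|) / 2 ≤ m / 4`, and in the small block case `|J| / 2 ≤ m / 4`:
-- the threshold `|J| = m / 2` balances the two. The constant `C` and the exceptional entries add at
-- most `2 m / 100`, whence `27 / 100`.
theorem IsWeight.sum_offWeight_large_le_rpow (hf : IsWeight C F f) (hC : 1 ≤ C)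
    (hCq : C ≤ (Fintype.card K : ℝ) ^ (1 / 100 : ℝ)) (hF : ∀ i, ((F i).card : ℝ) ≤ n / 100)
    {I J : Finset (Fin n)} {m : ℕ} (hI : I.card = m) (hIJ : Disjoint I J) (h1 : J.card ≤ I.card)
    (h2 : I.card ≤ 2 * J.card) :
    ∑ b : Matrix (Fin n) (Fin n) K with LargeBlock I J b, offWeight f b ≤
      (Fintype.card K : ℝ) ^ (2 * m * m + 27 / 100 * m * n : ℝ) := by
  have hq : (1 : ℝ) ≤ Fintype.card K := by exact_mod_cast Fintype.card_pos
  set q : ℝ := (Fintype.card K : ℝ)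
  have hq0 : 0 < q := by linarith
  have h3 : (I ∪ J).card = I.card + J.card := Finset.card_union_of_disjoint hIJ
  refine (hf.sum_offWeight_large_le hC hIJ).trans ?_
  have h4 : q ^ ((I.card - J.card) * n) * (C ^ ((I ∪ J).card * n) *
      q ^ ∑ i ∈ I ∪ J, (F i).card) ≤
        q ^ (((m : ℝ) - J.card) * n + (m + J.card) * n / 50) := by
    rw [Real.rpow_add hq0]
    refine mul_le_mul (le_of_eq ?_) ((pow_mul_pow_sum_le hq hC hCq hF _).trans (le_of_eq ?_))
      (by positivity) (by positivity)
    · rw [← Real.rpow_natCast, Nat.cast_mul, Nat.cast_sub h1, hI]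
    · rw [h3, hI]
      push_cast
      rfl
  refine (mul_le_mul_of_nonneg_left (sqrt_le_rpow_half hq0.le h4) (by positivity)).trans ?_
  rw [← Real.rpow_natCast, ← Real.rpow_add hq0]
  refine Real.rpow_le_rpow_of_exponent_le hq ?_
  have h5 : (J.card : ℝ) ≤ m := by exact_mod_cast hI ▸ h1
  have h6 : (m : ℝ) ≤ 2 * J.card := by exact_mod_cast hI ▸ h2
  have h7 : (0 : ℝ) ≤ n := n.cast_nonneg
  have h8 : (0 : ℝ) ≤ m := m.cast_nonneg
  push_cast [hI]
  nlinarith [mul_le_mul_of_nonneg_right h5 h8, mul_le_mul_of_nonneg_right h5 h7,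
    mul_le_mul_of_nonneg_right h6 h7]

open Classical in
theorem IsWeight.sum_offWeight_small_le_rpow (hf : IsWeight C F f) (hC : 1 ≤ C)
    (hCq : C ≤ (Fintype.card K : ℝ) ^ (1 / 100 : ℝ)) (hF : ∀ i, ((F i).card : ℝ) ≤ n / 100)
    {I J : Finset (Fin n)} {m : ℕ} (hI : I.card = m) (hJI : J ⊆ I)
    (h2 : 2 * J.card ≤ I.card) :
    ∑ b : Matrix (Fin n) (Fin n) K with SmallBlock I J b, offWeight f b ≤
      (Fintype.card K : ℝ) ^ (2 * m * m + 27 / 100 * m * n : ℝ) := by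
  have hq : (1 : ℝ) ≤ Fintype.card K := by exact_mod_cast Fintype.card_pos
  set q : ℝ := (Fintype.card K : ℝ)
  have hq0 : 0 < q := by linarith
  refine (hf.sum_offWeight_small_le hC hJI).trans ?_
  have h4 : q ^ (J.card * n) * (C ^ (J.card * n) * q ^ ∑ i ∈ J, (F i).card) ≤
        q ^ ((J.card : ℝ) * n + J.card * n / 50) := by
    rw [Real.rpow_add hq0]
    refine mul_le_mul (le_of_eq ?_) (pow_mul_pow_sum_le hq hC hCq hF _)
      (by positivity) (by positivity)
    rw [← Real.rpow_natCast]
    push_cast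
    rfl
  refine (mul_le_mul_of_nonneg_left (sqrt_le_rpow_half hq0.le h4) (by positivity)).trans ?_
  rw [← Real.rpow_natCast, ← Real.rpow_add hq0]
  refine Real.rpow_le_rpow_of_exponent_le hq ?_
  have h6 : 2 * (J.card : ℝ) ≤ m := by exact_mod_cast hI ▸ h2
  have h7 : (0 : ℝ) ≤ n := n.cast_nonneg
  have h8 : (0 : ℝ) ≤ m := m.cast_nonneg
  push_cast [hI]
  nlinarith [mul_le_mul_of_nonneg_right h6 h8, mul_le_mul_of_nonneg_right h6 h7,
    mul_nonneg h8 h8, mul_nonneg h8 h7]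

open Classical in
/-- The total weight of the symmetric matrices of rank `m`. -/
theorem IsWeight.sum_offWeight_rank_le (hf : IsWeight C F f) (hC : 1 ≤ C) (hn : n ≠ 0)
    (hCq : C ≤ (Fintype.card K : ℝ) ^ (1 / 100 : ℝ)) (hF : ∀ i, ((F i).card : ℝ) ≤ n / 100)
    (h8 : 8 ≤ (Fintype.card K : ℝ) ^ (1 / 100 : ℝ)) (m : ℕ) :
    ∑ b : Matrix (Fin n) (Fin n) K with b.IsSymm ∧ b.rank = m, offWeight f b ≤
      (Fintype.card K : ℝ) ^ ((n : ℝ) / 100 + (2 * m * m + 27 / 100 * m * n)) := by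
  have hq : (1 : ℝ) ≤ Fintype.card K := by exact_mod_cast Fintype.card_pos
  set q : ℝ := (Fintype.card K : ℝ)
  have hq0 : 0 < q := by linarith
  set B : ℝ := q ^ (2 * m * m + 27 / 100 * m * n : ℝ) with hB
  let A : Finset (Fin n) × Finset (Fin n) → Finset (Matrix (Fin n) (Fin n) K) := fun x =>
    (if x.1.card = m ∧ Disjoint x.1 x.2 ∧ x.2.card ≤ x.1.card ∧ x.1.card ≤ 2 * x.2.card then
      Finset.univ.filter fun b => LargeBlock x.1 x.2 b else ∅) ∪
    (if x.1.card = m ∧ x.2 ⊆ x.1 ∧ 2 * x.2.card ≤ x.1.card then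
      Finset.univ.filter fun b => SmallBlock x.1 x.2 b else ∅)
  have hsub : (Finset.univ.filter fun b : Matrix (Fin n) (Fin n) K => b.IsSymm ∧ b.rank = m) ⊆
      Finset.univ.biUnion A := by
    intro b hb
    obtain ⟨-, hb, hm⟩ := Finset.mem_filter.1 hb
    obtain ⟨I, J, hI, h⟩ := exists_block hb
    refine Finset.mem_biUnion.2 ⟨(I, J), Finset.mem_univ _, ?_⟩
    rcases h with ⟨h1, h2, h3, h4⟩ | ⟨h1, h2, h3⟩
    · refine Finset.mem_union_left _ ?_
      rw [if_pos ⟨hI.trans hm, h1, h2, h3⟩]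
      simpa using h4
    · refine Finset.mem_union_right _ ?_
      rw [if_pos ⟨hI.trans hm, h1, h2⟩]
      simpa using h3
  have h0 : ∀ b, 0 ≤ offWeight f b := hf.offWeight_nonneg
  have hA : ∀ x, ∑ b ∈ A x, offWeight f b ≤ 2 * B := by
    intro x
    refine (Finset.sum_union_le_sum_add _ _ h0).trans ?_
    rw [two_mul B]
    refine add_le_add ?_ ?_
    · split_ifs with h
      · exact hf.sum_offWeight_large_le_rpow hC hCq hF h.1 h.2.1 h.2.2.1 h.2.2.2
      · simpa using Real.rpow_nonneg hq0.le _
    · split_ifs with h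
      · exact hf.sum_offWeight_small_le_rpow hC hCq hF h.1 h.2.1 h.2.2
      · simpa using Real.rpow_nonneg hq0.le _
  calc ∑ b : Matrix (Fin n) (Fin n) K with b.IsSymm ∧ b.rank = m, offWeight f b
      ≤ ∑ b ∈ Finset.univ.biUnion A, offWeight f b :=
        Finset.sum_le_sum_of_subset_of_nonneg hsub fun b _ _ => h0 b
    _ ≤ ∑ x, ∑ b ∈ A x, offWeight f b := Finset.sum_biUnion_le_sum _ _ h0
    _ ≤ ∑ _x : Finset (Fin n) × Finset (Fin n), 2 * B := Finset.sum_le_sum fun x _ => hA x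
    _ = 2 * 4 ^ n * B := by
        rw [Finset.sum_const, Finset.card_univ, Fintype.card_prod, Fintype.card_finset,
          Fintype.card_fin, nsmul_eq_mul, show (4 : ℝ) = 2 * 2 by norm_num, mul_pow]
        push_cast
        ring
    -- The `4 ^ n` pairs `(I, J)` and the two alternatives together cost at most `8 ^ n`, as `n ≥
    -- 1`; this is absorbed into `q ^ (n / 100)`.
    _ ≤ 8 ^ n * B := by
        refine mul_le_mul_of_nonneg_right ?_ (by positivity)
        rw [show (8 : ℝ) = 2 * 4 by norm_num, mul_pow]
        exact mul_le_mul_of_nonneg_right (le_self_pow₀ one_le_two hn) (by positivity)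
    _ ≤ q ^ ((n : ℝ) / 100) * B :=
        mul_le_mul_of_nonneg_right (pow_le_rpow_div hq0.le (by norm_num) h8 n) (by positivity)
    _ = _ := (Real.rpow_add hq0 _ _).symm

end RankBound

/-! ### The error sum over nonzero quadratic forms. -/

section ErrorSum

open Matrix Module

variable {K : Type*} [Field K] [Fintype K] {n : ℕ} {C : ℝ} {F : Fin n → Finset (Fin n)}
  {f : Fin n → Fin n → K → ℝ}

theorem splitCount_le_rpow (k : ℕ) (U : Matrix (Fin n) (Fin n) K) {r m : ℕ}
    (hr : quadRank U = r) (hm : (U + Uᵀ).rank = m) :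
    (splitCount k U : ℝ) ≤ (Fintype.card K : ℝ) ^
      ((n : ℝ) * k + (k + r - n) * ((r - m / 2 : ℕ) : ℝ)) := by
  have hq0 : (0 : ℝ) < Fintype.card K := by exact_mod_cast Fintype.card_pos
  have h := pow_mul_splitCount_le k U (r - m / 2) (by rw [hr, hm])
  rw [hr] at h
  have h' : (Fintype.card K : ℝ) ^ (n * (r - m / 2)) * splitCount k U ≤
      (Fintype.card K : ℝ) ^ (n * k + k * (r - m / 2) + r * (r - m / 2)) := by exact_mod_cast h
  rw [← Real.rpow_natCast, ← Real.rpow_natCast, mul_comm, ← le_div_iff₀ (by positivity),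
    ← Real.rpow_sub hq0] at h'
  refine h'.trans (le_of_eq ?_)
  congr 1
  push_cast
  ring

open Classical in
-- Splitting gains at least `(n - k - m) m / 2 ≥ 0.4925 m n` in the exponent, because `k ≤ n / 200`
-- and `m ≤ n / 100`. The costs are `0.27 m n + 2 m² + m + n / 100`, where `2 m² ≤ 0.02 m n` and `m
-- ≤ 0.005 m n`. As `m ≥ 1`, at least `0.18 n` is left.
theorem IsWeight.sum_weightProd_mul_splitCount_le_of_rank (hf : IsWeight C F f) (hC : 1 ≤ C)
    (hCq : C ≤ (Fintype.card K : ℝ) ^ (1 / 100 : ℝ)) (hF : ∀ i, ((F i).card : ℝ) ≤ n / 100)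
    (h8 : 8 ≤ (Fintype.card K : ℝ) ^ (1 / 100 : ℝ)) (hn : 200 ≤ n) {k m : ℕ}
    (hk : 200 * k ≤ n) (hmk : m ≤ 2 * k) (hm : m ≠ 0) :
    ∑ U : Matrix (Fin n) (Fin n) K with
        upperPart U = U ∧ quadRank U = m ∧ (U + Uᵀ).rank = m,
      weightProd f U * splitCount k U ≤ (Fintype.card K : ℝ) ^ ((n : ℝ) * k - 18 / 100 * n) := by
  have hq : (1 : ℝ) ≤ Fintype.card K := by exact_mod_cast Fintype.card_pos
  set s := Finset.univ.filter fun U : Matrix (Fin n) (Fin n) K =>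
    upperPart U = U ∧ quadRank U = m ∧ (U + Uᵀ).rank = m with hs
  have hmem : ∀ U ∈ s, upperPart U = U ∧ quadRank U = m ∧ (U + Uᵀ).rank = m :=
    fun U hU => (Finset.mem_filter.1 hU).2
  have hw : ∀ U, 0 ≤ weightProd f U := fun U => Finset.prod_nonneg fun _ _ => hf.nonneg _ _ _
  have h1 := hf.sum_weightProd_le s m ((Fintype.card K : ℝ) ^ m)
    (fun U hU => ⟨(hmem U hU).1, (hmem U hU).2.2⟩)
    fun b _ hb => hf.sum_diag_le_of_quadRank_eq s m
      (fun U hU => ⟨(hmem U hU).1, (hmem U hU).2.1.trans (hmem U hU).2.2.symm⟩) b hb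
  have h2 := hf.sum_offWeight_rank_le hC (by omega) hCq hF h8 m
  set q : ℝ := (Fintype.card K : ℝ)
  have hq0 : 0 < q := by linarith
  calc ∑ U ∈ s, weightProd f U * splitCount k U
      ≤ ∑ U ∈ s, weightProd f U *
          q ^ ((n : ℝ) * k + (k + m - n) * ((m - m / 2 : ℕ) : ℝ)) :=
        Finset.sum_le_sum fun U hU => mul_le_mul_of_nonneg_left
          (splitCount_le_rpow k U (hmem U hU).2.1 (hmem U hU).2.2) (hw U)
    _ ≤ q ^ m * q ^ ((n : ℝ) / 100 + (2 * m * m + 27 / 100 * m * n)) *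
          q ^ ((n : ℝ) * k + (k + m - n) * ((m - m / 2 : ℕ) : ℝ)) := by
        rw [← Finset.sum_mul]
        exact mul_le_mul_of_nonneg_right
          (h1.trans (mul_le_mul_of_nonneg_left h2 (by positivity))) (by positivity)
    _ ≤ _ := by
        rw [← Real.rpow_natCast q m, ← Real.rpow_add hq0, ← Real.rpow_add hq0]
        refine Real.rpow_le_rpow_of_exponent_le hq ?_
        have h3 : (m : ℝ) ≤ 2 * ((m - m / 2 : ℕ) : ℝ) := by
          exact_mod_cast (by omega : m ≤ 2 * (m - m / 2))
        have h4 : 200 * (k : ℝ) ≤ n := by exact_mod_cast hk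
        have h5 : (m : ℝ) ≤ 2 * k := by exact_mod_cast hmk
        have h6 : (1 : ℝ) ≤ m := by exact_mod_cast Nat.one_le_iff_ne_zero.2 hm
        have h7 : (200 : ℝ) ≤ n := by exact_mod_cast hn
        nlinarith [mul_nonneg (sub_nonneg.2 h3) (by linarith : (0 : ℝ) ≤ n - k - m),
          mul_nonneg (sub_nonneg.2 h6) (by linarith : (0 : ℝ) ≤ n),
          mul_nonneg (by linarith : (0 : ℝ) ≤ m) (by linarith : (0 : ℝ) ≤ n / 100 - m),
          mul_nonneg (by linarith : (0 : ℝ) ≤ m) (by linarith : (0 : ℝ) ≤ n / 200 - k),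
          mul_nonneg (by linarith : (0 : ℝ) ≤ m) (by linarith : (0 : ℝ) ≤ n - 200)]

open Classical in
-- Now `h ≥ m / 2 + 1`. The additional unit gains at least `0.98 n`, which outweighs the diagonal
-- cost `0.505 n`, so even `m = 0` is harmless.
theorem IsWeight.sum_weightProd_mul_splitCount_le_of_quadRank_eq_succ (hf : IsWeight C F f)
    (hC : 1 ≤ C) (hCq : C ≤ (Fintype.card K : ℝ) ^ (1 / 100 : ℝ))
    (hF : ∀ i, ((F i).card : ℝ) ≤ n / 100) (hreg : ∀ i, i ∉ F i)
    (h8 : 8 ≤ (Fintype.card K : ℝ) ^ (1 / 100 : ℝ)) (hn : 200 ≤ n) {k m : ℕ}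
    (hk : 200 * k ≤ n) (hmk : m ≤ 2 * k) :
    ∑ U : Matrix (Fin n) (Fin n) K with
        upperPart U = U ∧ quadRank U = m + 1 ∧ (U + Uᵀ).rank = m,
      weightProd f U * splitCount k U ≤ (Fintype.card K : ℝ) ^ ((n : ℝ) * k - 18 / 100 * n) := by
  have hq : (1 : ℝ) ≤ Fintype.card K := by exact_mod_cast Fintype.card_pos
  set s := Finset.univ.filter fun U : Matrix (Fin n) (Fin n) K =>
    upperPart U = U ∧ quadRank U = m + 1 ∧ (U + Uᵀ).rank = m with hs
  have hmem : ∀ U ∈ s, upperPart U = U ∧ quadRank U = m + 1 ∧ (U + Uᵀ).rank = m :=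
    fun U hU => (Finset.mem_filter.1 hU).2
  have hw : ∀ U, 0 ≤ weightProd f U := fun U => Finset.prod_nonneg fun _ _ => hf.nonneg _ _ _
  have h1 := hf.sum_weightProd_le s m (√(Fintype.card K * C) ^ n)
    (fun U hU => ⟨(hmem U hU).1, (hmem U hU).2.2⟩)
    fun b _ _ => hf.sum_diag_le_of_regular hreg s (fun U hU => (hmem U hU).1) b
  have h2 := hf.sum_offWeight_rank_le hC (by omega) hCq hF h8 m
  set q : ℝ := (Fintype.card K : ℝ)
  have hq0 : 0 < q := by linarith
  have hsqrt : √(q * C) ^ n ≤ q ^ (101 / 200 * n : ℝ) := by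
    have h : √(q * C) ≤ q ^ ((1 + 1 / 100 : ℝ) / 2) := by
      refine sqrt_le_rpow_half hq0.le ?_
      rw [Real.rpow_add hq0, Real.rpow_one]
      exact mul_le_mul_of_nonneg_left hCq hq0.le
    refine (pow_le_pow_left₀ (Real.sqrt_nonneg _) h n).trans (le_of_eq ?_)
    rw [← Real.rpow_natCast, ← Real.rpow_mul hq0.le]
    congr 1
    ring
  calc ∑ U ∈ s, weightProd f U * splitCount k U
      ≤ ∑ U ∈ s, weightProd f U *
          q ^ ((n : ℝ) * k + (k + (m + 1 : ℕ) - n) * ((m + 1 - m / 2 : ℕ) : ℝ)) :=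
        Finset.sum_le_sum fun U hU => mul_le_mul_of_nonneg_left
          (splitCount_le_rpow k U (hmem U hU).2.1 (hmem U hU).2.2) (hw U)
    _ ≤ q ^ (101 / 200 * n : ℝ) * q ^ ((n : ℝ) / 100 + (2 * m * m + 27 / 100 * m * n)) *
          q ^ ((n : ℝ) * k + (k + (m + 1 : ℕ) - n) * ((m + 1 - m / 2 : ℕ) : ℝ)) := by
        rw [← Finset.sum_mul]
        exact mul_le_mul_of_nonneg_right
          (h1.trans (mul_le_mul hsqrt h2 (Finset.sum_nonneg fun b _ => hf.offWeight_nonneg b)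
            (by positivity))) (by positivity)
    _ ≤ _ := by
        rw [← Real.rpow_add hq0, ← Real.rpow_add hq0]
        refine Real.rpow_le_rpow_of_exponent_le hq ?_
        have h3 : (m : ℝ) + 2 ≤ 2 * ((m + 1 - m / 2 : ℕ) : ℝ) := by
          exact_mod_cast (by omega : m + 2 ≤ 2 * (m + 1 - m / 2))
        have h4 : 200 * (k : ℝ) ≤ n := by exact_mod_cast hk
        have h5 : (m : ℝ) ≤ 2 * k := by exact_mod_cast hmk
        have h6 : (0 : ℝ) ≤ m := m.cast_nonneg
        have h7 : (200 : ℝ) ≤ n := by exact_mod_cast hn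
        push_cast
        nlinarith [mul_nonneg (sub_nonneg.2 h3) (by linarith : (0 : ℝ) ≤ n - k - (m + 1)),
          mul_nonneg h6 (by linarith : (0 : ℝ) ≤ n),
          mul_nonneg h6 (by linarith : (0 : ℝ) ≤ n / 100 - m),
          mul_nonneg h6 (by linarith : (0 : ℝ) ≤ n / 200 - k),
          mul_nonneg h6 (by linarith : (0 : ℝ) ≤ n - 200)]

theorem quadRank_eq_rank_or (hchar : Odd (Fintype.card K) ∨ ∀ i, i ∉ F i)
    (U : Matrix (Fin n) (Fin n) K) :
    quadRank U = (U + Uᵀ).rank ∨ (quadRank U = (U + Uᵀ).rank + 1 ∧ ∀ i, i ∉ F i) := by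
  by_cases h2 : ringChar K = 2
  · have h3 := FiniteField.even_card_of_char_two h2
    have h4 : ∀ i, i ∉ F i := hchar.resolve_left fun h => by
      have := Nat.odd_iff.1 h
      omega
    have h5 := quadRank_le_rank_add_one h2 U
    have h6 := rank_le_quadRank U
    rcases Nat.lt_or_ge (U + Uᵀ).rank (quadRank U) with h | h
    · exact Or.inr ⟨by omega, h4⟩
    · exact Or.inl (by omega)
  · exact Or.inl (quadRank_eq_rank_of_two_ne_zero (Ring.two_ne_zero h2) U)

open Classical in
/-- The total contribution of the nonzero upper triangular matrices to the error terms. -/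
theorem IsWeight.sum_weightProd_mul_splitCount_le (hf : IsWeight C F f) (hC : 1 ≤ C)
    (hCq : C ≤ (Fintype.card K : ℝ) ^ (1 / 100 : ℝ)) (hF : ∀ i, ((F i).card : ℝ) ≤ n / 100)
    (hchar : Odd (Fintype.card K) ∨ ∀ i, i ∉ F i)
    (h8 : 8 ≤ (Fintype.card K : ℝ) ^ (1 / 100 : ℝ)) (hn : 200 ≤ n) {k : ℕ} (hk : 200 * k ≤ n) :
    ∑ U : Matrix (Fin n) (Fin n) K with upperPart U = U ∧ U ≠ 0,
      weightProd f U * splitCount k U ≤ (Fintype.card K : ℝ) ^ ((n : ℝ) * k - n / 10) := by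
  have hq : (1 : ℝ) ≤ Fintype.card K := by exact_mod_cast Fintype.card_pos
  have hw : ∀ U, 0 ≤ weightProd f U * splitCount k U := fun U =>
    mul_nonneg (Finset.prod_nonneg fun _ _ => hf.nonneg _ _ _) (Nat.cast_nonneg _)
  let A : ℕ → Finset (Matrix (Fin n) (Fin n) K) := fun m =>
    Finset.univ.filter fun U => upperPart U = U ∧ quadRank U = m ∧ (U + Uᵀ).rank = m
  let B : ℕ → Finset (Matrix (Fin n) (Fin n) K) := fun m => Finset.univ.filter fun U =>
    upperPart U = U ∧ quadRank U = m + 1 ∧ (U + Uᵀ).rank = m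
  let D : ℕ → Finset (Matrix (Fin n) (Fin n) K) := fun m =>
    (if m = 0 then ∅ else A m) ∪ if ∀ i, i ∉ F i then B m else ∅
  have hsub : ((Finset.univ.filter fun U : Matrix (Fin n) (Fin n) K => upperPart U = U ∧ U ≠ 0).filter
      fun U => weightProd f U * splitCount k U ≠ 0) ⊆ (Finset.range (2 * k + 1)).biUnion D := by
    intro U hU
    obtain ⟨hU, h0⟩ := Finset.mem_filter.1 hU
    obtain ⟨-, hup, hU0⟩ := Finset.mem_filter.1 hU
    have h1 : splitCount k U ≠ 0 := fun h => h0 (by rw [h, Nat.cast_zero, mul_zero])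
    have h2 := (exists_of_splitCount_ne_zero h1).2
    refine Finset.mem_biUnion.2 ⟨(U + Uᵀ).rank, Finset.mem_range.2 (by omega), ?_⟩
    rcases quadRank_eq_rank_or hchar U with h3 | ⟨h3, h4⟩
    · refine Finset.mem_union_left _ ?_
      rw [if_neg]
      · exact Finset.mem_filter.2 ⟨Finset.mem_univ _, hup, h3, rfl⟩
      · intro h
        exact hU0 (eq_zero_of_quadRank_eq_zero hup (h3.trans h))
    · refine Finset.mem_union_right _ ?_
      rw [if_pos h4]
      exact Finset.mem_filter.2 ⟨Finset.mem_univ _, hup, h3, rfl⟩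
  set q : ℝ := (Fintype.card K : ℝ) with hqdef
  have hq0 : 0 < q := by linarith
  set T : ℝ := q ^ ((n : ℝ) * k - 18 / 100 * n) with hT
  have hT0 : 0 ≤ T := Real.rpow_nonneg hq0.le _
  have hD : ∀ m ∈ Finset.range (2 * k + 1),
      ∑ U ∈ D m, weightProd f U * splitCount k U ≤ 2 * T := by
    intro m hm
    have hm' : m ≤ 2 * k := by
      have := Finset.mem_range.1 hm
      omega
    refine (Finset.sum_union_le_sum_add _ _ hw).trans ?_
    rw [two_mul T]
    refine add_le_add ?_ ?_
    · split_ifs with h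
      · simpa using hT0
      · exact hf.sum_weightProd_mul_splitCount_le_of_rank hC hCq hF h8 hn hk hm' h
    · split_ifs with h
      · exact hf.sum_weightProd_mul_splitCount_le_of_quadRank_eq_succ hC hCq hF h h8 hn hk hm'
      · simpa using hT0
  calc ∑ U : Matrix (Fin n) (Fin n) K with upperPart U = U ∧ U ≠ 0,
      weightProd f U * splitCount k U
      = ∑ U ∈ (Finset.univ.filter fun U : Matrix (Fin n) (Fin n) K =>
            upperPart U = U ∧ U ≠ 0).filter fun U => weightProd f U * splitCount k U ≠ 0,
          weightProd f U * splitCount k U := (Finset.sum_filter_ne_zero _).symm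
    _ ≤ ∑ U ∈ (Finset.range (2 * k + 1)).biUnion D, weightProd f U * splitCount k U :=
        Finset.sum_le_sum_of_subset_of_nonneg hsub fun U _ _ => hw U
    _ ≤ ∑ m ∈ Finset.range (2 * k + 1), ∑ U ∈ D m, weightProd f U * splitCount k U :=
        Finset.sum_biUnion_le_sum _ _ hw
    _ ≤ ∑ _m ∈ Finset.range (2 * k + 1), 2 * T := Finset.sum_le_sum hD
    _ = ((2 * k + 1) * 2 : ℕ) * T := by
        rw [Finset.sum_const, Finset.card_range, nsmul_eq_mul]
        push_cast
        ring
    _ ≤ 8 ^ n * T := by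
        refine mul_le_mul_of_nonneg_right ?_ hT0
        have h3 : n < 8 ^ n := Nat.lt_pow_self (by norm_num)
        exact_mod_cast (by omega : (2 * k + 1) * 2 ≤ 8 ^ n)
    _ ≤ q ^ ((n : ℝ) / 100) * T :=
        mul_le_mul_of_nonneg_right (pow_le_rpow_div hq0.le (by norm_num) h8 n) hT0
    _ ≤ _ := by
        rw [hT, ← Real.rpow_add hq0]
        refine Real.rpow_le_rpow_of_exponent_le hq ?_
        have h7 : (0 : ℝ) ≤ n := n.cast_nonneg
        linarith

end ErrorSum

/-! ### Moments of the corank -/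

section KernelCount

open Matrix Module

variable {K : Type*} [Field K] [Fintype K]

theorem card_linearIndependent_eq_indepCount {V : Type*} [AddCommGroup V] [Module K V] [Finite V]
    (k : ℕ) :
    (Nat.card {s : Fin k → V // LinearIndependent K s} : ℝ) =
      indepCount (Fintype.card K) k (finrank K V) := by
  classical
  have := Fintype.ofFinite V
  rcases Nat.lt_or_ge (finrank K V) k with h | h
  · rw [indepCount_eq_zero _ h]
    have : IsEmpty {s : Fin k → V // LinearIndependent K s} :=
      ⟨fun s => by
        have h1 := s.2.fintype_card_le_finrank
        rw [Fintype.card_fin] at h1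
        omega⟩
    simp
  · rw [card_linearIndependent h, indepCount,
      Fin.prod_univ_eq_prod_range (fun i => Fintype.card K ^ finrank K V - Fintype.card K ^ i)]
    push_cast
    refine Finset.prod_congr rfl fun i hi => ?_
    rw [Nat.cast_sub (Nat.pow_le_pow_right Fintype.card_pos
      (by have := Finset.mem_range.1 hi; omega))]
    push_cast
    rfl

open Classical in
theorem card_linearIndependent_kernel {n : ℕ} (A : Matrix (Fin n) (Fin n) K) (k : ℕ) :
    ((Finset.univ.filter fun W : Matrix (Fin n) (Fin k) K =>
      LinearIndependent K Wᵀ ∧ A * W = 0).card : ℝ) = indepCount (Fintype.card K) k (corank A) := by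
  have h1 : corank A = finrank K (LinearMap.ker A.mulVecLin) := by
    have h := finrank_ker_mulVecLin_add_rank A
    rw [Fintype.card_fin] at h
    rw [corank]
    omega
  rw [h1, ← card_linearIndependent_eq_indepCount, ← Fintype.card_subtype, ← Nat.card_eq_fintype_card]
  congr 1
  have hmem : ∀ W : Matrix (Fin n) (Fin k) K, A * W = 0 ↔
      ∀ j, Wᵀ j ∈ LinearMap.ker A.mulVecLin := fun W => by
    constructor
    · intro h j
      ext i
      exact congr_fun₂ h i j
    · intro h
      ext i j
      exact congr_fun (h j) i
  refine Nat.card_congr ⟨fun W => ⟨fun j => ⟨W.1ᵀ j, (hmem W.1).1 W.2.2 j⟩, ?_⟩,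
    fun s => ⟨Matrix.of fun i j => (s.1 j : Fin n → K) i, ?_, ?_⟩, ?_, ?_⟩
  · exact LinearIndependent.of_comp (LinearMap.ker A.mulVecLin).subtype W.2.1
  · exact s.2.map' (LinearMap.ker A.mulVecLin).subtype (Submodule.ker_subtype _)
  · exact (hmem _).2 fun j => (s.1 j).2
  · intro W
    rfl
  · intro s
    rfl

open Classical in
theorem card_linearIndependent_columns (n k : ℕ) :
    ((Finset.univ.filter fun W : Matrix (Fin n) (Fin k) K => LinearIndependent K Wᵀ).card : ℝ) =
      indepCount (Fintype.card K) k n := by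
  have h := card_linearIndependent_kernel (0 : Matrix (Fin n) (Fin n) K) k
  simpa [corank] using h

end KernelCount

/-! ### Fourier formula for the moments. -/

section Moments

open Matrix

variable {n : ℕ} {K : Type*} [Field K] [Fintype K] [MeasurableSpace K] [DiscreteMeasurableSpace K]
  {Ω : Type*} [MeasurableSpace Ω] {C : ℝ} {F : Fin n → Finset (Fin n)} {P : Measure Ω}
  {M : Ω → Matrix (Fin n) (Fin n) K}

namespace IsNearUniformSymm

theorem measurableSet_setOf (hM : IsNearUniformSymm C F P M)
    (Q : Matrix (Fin n) (Fin n) K → Prop) : MeasurableSet {ω | Q (M ω)} :=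
  measurableSet_setOfPred.2 (hM.measurable_comp Q)

open Classical in
theorem prob_eq_sum [IsProbabilityMeasure P] (hM : IsNearUniformSymm C F P M) (Q : Matrix (Fin n) (Fin n) K → Prop) :
    P.real {ω | Q (M ω)} = ∑ A with Q A, P.real {ω | M ω = A} := by
  have h : {ω | Q (M ω)} = ⋃ A ∈ Finset.univ.filter Q, {ω | M ω = A} := by
    ext ω
    simp
  rw [h, measureReal_biUnion_finset]
  · intro A _ B _ hAB
    exact Set.disjoint_left.2 fun ω h1 h2 => hAB (Eq.trans (Eq.symm h1) h2)
  · exact fun A _ => hM.measurableSet_setOf fun B => B = A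

theorem map_corank_real (hM : IsNearUniformSymm C F P M) (s : Set ℕ) :
    (P.map fun ω => corank (M ω)).real s = P.real {ω | corank (M ω) ∈ s} :=
  map_measureReal_apply (hM.measurable_comp corank) s.to_countable.measurableSet

open Classical in
-- The expected number of independent `k`-tuples in the kernel, computed once by conditioning on the
-- matrix and once by summing over tuples.
theorem hasSum_corank_mul_indepCount [IsProbabilityMeasure P] (hM : IsNearUniformSymm C F P M) (k : ℕ) :
    HasSum (fun r => (P.map fun ω => corank (M ω)).real {r} *
        indepCount (Fintype.card K) k r)
      (∑ W : Matrix (Fin n) (Fin k) K with LinearIndependent K Wᵀ, P.real {ω | M ω * W = 0}) := by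
  have h1 : ∀ A : Matrix (Fin n) (Fin n) K, HasSum
      (fun r => if corank A = r then P.real {ω | M ω = A} * indepCount (Fintype.card K) k r else 0)
      (P.real {ω | M ω = A} * indepCount (Fintype.card K) k (corank A)) := fun A => by
    have h := hasSum_single (f := fun r => if corank A = r then
      P.real {ω | M ω = A} * indepCount (Fintype.card K) k r else 0) (corank A)
      fun r hr => if_neg hr.symm
    simpa using h
  have h2 := hasSum_sum fun (A : Matrix (Fin n) (Fin n) K) (_ : A ∈ Finset.univ) => h1 A
  convert h2 using 1
  · ext r
    rw [hM.map_corank_real]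
    simp only [Set.mem_singleton_iff]
    rw [hM.prob_eq_sum fun A => corank A = r, Finset.sum_mul, Finset.sum_filter]
    exact Finset.sum_congr rfl fun A _ => by congr
  · simp only [← card_linearIndependent_kernel]
    have h3 : ∀ W : Matrix (Fin n) (Fin k) K, P.real {ω | M ω * W = 0} =
        ∑ A, if A * W = 0 then P.real {ω | M ω = A} else 0 := fun W => by
      rw [hM.prob_eq_sum fun A => A * W = 0, Finset.sum_filter]
      exact Finset.sum_congr rfl fun A _ => by congr
    simp only [h3]
    rw [Finset.sum_comm]
    refine Finset.sum_congr rfl fun A _ => ?_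
    rw [← Finset.sum_filter, Finset.filter_filter, Finset.sum_const, nsmul_eq_mul, mul_comm]

open Classical in
-- For each `W`, all nonempty fibres of `T ↦ upperPart (T Wᵀ)` have the size `q ^ (k.choose 2)` of
-- the kernel. Exchanging the sums over `W` and `U` counts, for each `U`, the `W` through which it
-- splits.
theorem abs_pow_mul_sum_prob_sub_le [IsProbabilityMeasure P] (hM : IsNearUniformSymm C F P M) {ψ : AddChar K ℂ}
    (hψ : ψ.IsPrimitive) (hF : ∀ i j, i ∈ F j ↔ j ∈ F i) (k : ℕ) :
    |(Fintype.card K : ℝ) ^ (n * k) *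
        (∑ W : Matrix (Fin n) (Fin k) K with LinearIndependent K Wᵀ, P.real {ω | M ω * W = 0}) -
      indepCount (Fintype.card K) k n * (Fintype.card K : ℝ) ^ k.choose 2| ≤
    (Fintype.card K : ℝ) ^ k.choose 2 *
      ∑ U : Matrix (Fin n) (Fin n) K with upperPart U = U ∧ U ≠ 0,
        weightProd (charWeight ψ F P M) U * splitCount k U := by
  have hw : ∀ U, 0 ≤ weightProd (charWeight ψ F P M) U := fun U =>
    Finset.prod_nonneg fun _ _ => (hM.isWeight_charWeight hF hψ).nonneg _ _ _
  have h1 : ∀ W : Matrix (Fin n) (Fin k) K, LinearIndependent K Wᵀ →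
      |(Fintype.card K : ℝ) ^ (n * k) * P.real {ω | M ω * W = 0} -
        (Fintype.card K : ℝ) ^ k.choose 2| ≤ (Fintype.card K : ℝ) ^ k.choose 2 *
          ∑ U : Matrix (Fin n) (Fin n) K with upperPart U = U ∧ U ≠ 0,
            if ∃ T : Matrix (Fin n) (Fin k) K, upperPart (T * Wᵀ) = U then
              weightProd (charWeight ψ F P M) U else 0 := by
    intro W hW
    have h := hM.abs_pow_mul_prob_sub_le hψ W
    rw [card_kernel_upperPart_mul_transpose hW] at h
    push_cast at h
    refine h.trans (le_of_eq ?_)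
    let g : Matrix (Fin n) (Fin k) K →+ Matrix (Fin n) (Fin n) K :=
      (upperPart (n := n) (K := K)).toAddMonoidHom.comp
        (AddMonoidHom.mk' (fun T => T * Wᵀ) fun T T' => Matrix.add_mul T T' Wᵀ)
    have hg : ∀ T, g T = upperPart (T * Wᵀ) := fun T => rfl
    have h2 := sum_comp_eq_card_kernel_mul g fun U =>
      if U ≠ 0 then weightProd (charWeight ψ F P M) U else 0
    simp only [hg] at h2
    rw [card_kernel_upperPart_mul_transpose hW, ← Finset.sum_filter] at h2
    rw [h2]
    push_cast
    congr 1
    rw [← Finset.sum_filter, ← Finset.sum_filter]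
    refine Finset.sum_congr ?_ fun _ _ => rfl
    ext U
    simp only [Finset.mem_filter, Finset.mem_image, Finset.mem_univ, true_and, hg]
    constructor
    · rintro ⟨⟨T, rfl⟩, h0⟩
      exact ⟨⟨upperPart_upperPart _, h0⟩, T, rfl⟩
    · rintro ⟨⟨-, h0⟩, hT⟩
      exact ⟨hT, h0⟩
  rw [← card_linearIndependent_columns, Finset.mul_sum, ← nsmul_eq_mul, ← Finset.sum_const,
    ← Finset.sum_sub_distrib]
  refine (Finset.abs_sum_le_sum_abs _ _).trans ((Finset.sum_le_sum fun W hW =>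
    h1 W (Finset.mem_filter.1 hW).2).trans (le_of_eq ?_))
  rw [← Finset.mul_sum, Finset.sum_comm]
  congr 1
  refine Finset.sum_congr rfl fun U _ => ?_
  rw [← Finset.sum_filter, Finset.filter_filter, Finset.sum_const, nsmul_eq_mul, mul_comm]
  rfl

end IsNearUniformSymm

end Moments

/-! ### Comparison with the limiting law for `n ≥ 200`. -/

section LargeSize

open Matrix

theorem sum_range_pow_le_pow {q : ℝ} (hq : 2 ≤ q) (k : ℕ) : ∑ i ∈ Finset.range k, q ^ i ≤ q ^ k := by
  induction k with
  | zero => simp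
  | succ k ih =>
    rw [Finset.sum_range_succ, pow_succ]
    nlinarith [pow_nonneg (by linarith : (0 : ℝ) ≤ q) k]

theorem pow_mul_one_sub_le_indepCount {q : ℝ} (hq : 2 ≤ q) {k n : ℕ} (hk : k ≤ n) :
    q ^ (n * k) * (1 - q ^ k / q ^ n) ≤ indepCount q k n := by
  have hq0 : 0 < q := by linarith
  have hn : 0 < q ^ n := by positivity
  have h1 : indepCount q k n = q ^ (n * k) * ∏ i ∈ Finset.range k, (1 - q ^ i / q ^ n) := by
    rw [indepCount, pow_mul, ← Finset.card_range k, ← Finset.prod_const, Finset.card_range,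
      ← Finset.prod_mul_distrib]
    exact Finset.prod_congr rfl fun i _ => by field_simp
  rw [h1]
  refine mul_le_mul_of_nonneg_left ?_ (by positivity)
  refine le_trans ?_ (one_sub_sum_le_prod_one_sub (Finset.range k) (fun i => q ^ i / q ^ n)
    (fun i _ => by positivity) fun i hi => ?_)
  · rw [← Finset.sum_div]
    exact sub_le_sub_left (div_le_div_of_nonneg_right (sum_range_pow_le_pow hq k) hn.le) 1
  · exact div_le_one_of_le₀ (pow_le_pow_right₀ (by linarith)
      ((Finset.mem_range.1 hi).le.trans hk)) hn.le

variable {n : ℕ} {K : Type*} [Field K] [Fintype K] [MeasurableSpace K] [DiscreteMeasurableSpace K]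
  {Ω : Type*} [MeasurableSpace Ω] {C : ℝ} {F : Fin n → Finset (Fin n)} {P : Measure Ω}
  [IsProbabilityMeasure P] {M : Ω → Matrix (Fin n) (Fin n) K}

namespace IsNearUniformSymm

open Classical in
-- Two relative errors of at most `q ^ (-n / 10)` occur: the proportion of `W` with dependent
-- columns, at most `q ^ (k - n)`, and the Fourier error.
theorem abs_moment_sub_le (hM : IsNearUniformSymm C F P M) (hF : ∀ i j, i ∈ F j ↔ j ∈ F i)
    (hC : 1 ≤ C) (hCq : C ≤ (Fintype.card K : ℝ) ^ (1 / 100 : ℝ))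
    (hFn : ∀ i, ((F i).card : ℝ) ≤ n / 100) (hchar : Odd (Fintype.card K) ∨ ∀ i, i ∉ F i)
    (h8 : 8 ≤ (Fintype.card K : ℝ) ^ (1 / 100 : ℝ)) (hn : 200 ≤ n) {k : ℕ} (hk : 200 * k ≤ n) :
    |∑ W : Matrix (Fin n) (Fin k) K with LinearIndependent K Wᵀ, P.real {ω | M ω * W = 0} -
        (Fintype.card K : ℝ) ^ k.choose 2| ≤
      2 * (Fintype.card K : ℝ) ^ (-(n / 10 : ℝ)) * (Fintype.card K : ℝ) ^ k.choose 2 := by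
  have hq : (2 : ℝ) ≤ Fintype.card K := by exact_mod_cast Fintype.one_lt_card
  obtain ⟨ψ, hψ⟩ := exists_isPrimitive_addChar K
  have h1 := hM.abs_pow_mul_sum_prob_sub_le hψ hF k
  have h2 := (hM.isWeight_charWeight hF hψ).sum_weightProd_mul_splitCount_le hC hCq hFn hchar h8
    hn hk
  set S := ∑ W : Matrix (Fin n) (Fin k) K with LinearIndependent K Wᵀ, P.real {ω | M ω * W = 0}
  set q : ℝ := (Fintype.card K : ℝ)
  have hq0 : 0 < q := by linarith
  set ε := q ^ (-(n / 10 : ℝ))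
  rw [sub_eq_add_neg, Real.rpow_add hq0, ← Nat.cast_mul, Real.rpow_natCast] at h2
  have h3 : q ^ (n * k) * (1 - ε) ≤ indepCount q k n := by
    refine le_trans ?_ (pow_mul_one_sub_le_indepCount hq (by omega))
    refine mul_le_mul_of_nonneg_left (sub_le_sub_left ?_ 1) (by positivity)
    rw [← Real.rpow_natCast, ← Real.rpow_natCast, ← Real.rpow_sub hq0]
    refine Real.rpow_le_rpow_of_exponent_le (by linarith) ?_
    have h4 : 200 * (k : ℝ) ≤ n := by exact_mod_cast hk
    have h5 : (0 : ℝ) ≤ n := n.cast_nonneg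
    linarith
  have h4 := indepCount_le_pow (by linarith : (1 : ℝ) ≤ q) (by omega : k ≤ n)
  have hX : 0 < q ^ (n * k) := by positivity
  have hY : 0 < q ^ k.choose 2 := by positivity
  have h5 := h1.trans (mul_le_mul_of_nonneg_left h2 hY.le)
  rw [abs_le] at h5 ⊢
  constructor
  · refine le_of_mul_le_mul_left ?_ hX
    nlinarith [mul_le_mul_of_nonneg_right h3 hY.le]
  · refine le_of_mul_le_mul_left ?_ hX
    have hε : 0 ≤ ε := by positivity
    nlinarith [mul_le_mul_of_nonneg_right h4 hY.le, mul_nonneg hX.le (mul_nonneg hε hY.le)]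

theorem tvDist_le_of_large (hM : IsNearUniformSymm C F P M) (hF : ∀ i j, i ∈ F j ↔ j ∈ F i)
    (hC : 1 ≤ C) (hCq : C ≤ (Fintype.card K : ℝ) ^ (1 / 100 : ℝ))
    (hFn : ∀ i, ((F i).card : ℝ) ≤ n / 100) (hchar : Odd (Fintype.card K) ∨ ∀ i, i ∉ F i)
    (h120 : 120 ≤ (Fintype.card K : ℝ) ^ (1 / 100 : ℝ)) (hn : 200 ≤ n) :
    tvDist (P.map fun ω => corank (M ω)) (symLimitLaw (Fintype.card K)) ≤
      (Fintype.card K : ℝ) ^ (-(n / 1000 : ℝ)) := by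
  classical
  have hq1 : 1 < Fintype.card K := Fintype.one_lt_card
  have hq0' : (0 : ℝ) < Fintype.card K := by exact_mod_cast Fintype.card_pos
  have : IsProbabilityMeasure (P.map fun ω => corank (M ω)) :=
    Measure.isProbabilityMeasure_map (hM.measurable_comp corank).aemeasurable
  have hn' : (200 : ℝ) ≤ n := by exact_mod_cast hn
  have hbig : (256 : ℝ) ≤ Fintype.card K := by
    have h1 := pow_le_pow_left₀ (by norm_num) h120 100
    rw [← Real.rpow_natCast (_ ^ _), ← Real.rpow_mul hq0'.le] at h1
    norm_num at h1 ⊢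
    linarith
  have hε1 : 2 * (Fintype.card K : ℝ) ^ (-(n / 10 : ℝ)) ≤ 1 := by
    have h1 : (Fintype.card K : ℝ) ^ (-(n / 10 : ℝ)) ≤ (Fintype.card K : ℝ) ^ (-1 : ℝ) :=
      Real.rpow_le_rpow_of_exponent_le (by linarith) (by linarith)
    rw [Real.rpow_neg_one] at h1
    have h2 : (Fintype.card K : ℝ)⁻¹ ≤ 256⁻¹ := inv_anti₀ (by norm_num) hbig
    norm_num at h2
    linarith
  have h1 := tsum_abs_sub_le_of_moments (q := (Fintype.card K : ℝ))
    (ε := 2 * (Fintype.card K : ℝ) ^ (-(n / 10 : ℝ))) (by linarith) (by positivity) hε1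
    (fun r => (P.map fun ω => corank (M ω)).real {r}) (symLimitProb (Fintype.card K))
    (fun r => measureReal_nonneg) (symLimitProb_nonneg hq1) (n / 200)
    (fun k => ∑ W : Matrix (Fin n) (Fin k) K with LinearIndependent K Wᵀ, P.real {ω | M ω * W = 0})
    (fun k _ => hM.hasSum_corank_mul_indepCount k)
    (fun k _ => hasSum_symLimitProb_mul_indepCount hq1 k)
    (fun k hk => hM.abs_moment_sub_le hF hC hCq hFn hchar (by linarith) hn (by omega))
  refine (tvDist_le_tsum _ hq1).trans (h1.trans ?_)
  clear h1
  set q : ℝ := (Fintype.card K : ℝ)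
  have h2 : (16 * q⁻¹) ^ (n / 200) ≤ q ^ (-(n / 800 : ℝ)) := by
    have h3 : 16 * q⁻¹ ≤ q ^ (-(1 / 2) : ℝ) := by
      rw [Real.rpow_neg hq0'.le, ← Real.sqrt_eq_rpow]
      have h4 : 16 ≤ √q := Real.le_sqrt_of_sq_le (by linarith)
      have h5 : q⁻¹ = (√q)⁻¹ * (√q)⁻¹ := by
        rw [← mul_inv, Real.mul_self_sqrt hq0'.le]
      rw [h5, ← mul_assoc]
      refine mul_le_of_le_one_left (by positivity) ?_
      rw [← div_eq_mul_inv]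
      exact div_le_one_of_le₀ h4 (by positivity)
    refine (pow_le_pow_left₀ (by positivity) h3 _).trans ?_
    rw [← Real.rpow_natCast, ← Real.rpow_mul hq0'.le]
    refine Real.rpow_le_rpow_of_exponent_le (by linarith) ?_
    -- The number `n / 200` of moments is rounded down; it is still at least `n / 400`, as `n ≥
    -- 200`.
    have h4 : (n : ℝ) ≤ 400 * (n / 200 : ℕ) := by exact_mod_cast (by omega : n ≤ 400 * (n / 200))
    linarith
  have h3 : q ^ (-(n / 10 : ℝ)) ≤ q ^ (-(n / 800 : ℝ)) :=
    Real.rpow_le_rpow_of_exponent_le (by linarith) (by linarith)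
  calc 40 * (2 * q ^ (-(n / 10 : ℝ)) + (16 * q⁻¹) ^ (n / 200))
      ≤ 120 * q ^ (-(n / 800 : ℝ)) := by linarith
    -- The constant `120 = 40 (2 + 1)` costs `1 / 100` in the exponent, which is less than `n / 800
    -- - n / 1000` for `n ≥ 200`.
    _ ≤ q ^ (1 / 100 : ℝ) * q ^ (-(n / 800 : ℝ)) :=
        mul_le_mul_of_nonneg_right h120 (by positivity)
    _ ≤ _ := by
        rw [← Real.rpow_add hq0']
        refine Real.rpow_le_rpow_of_exponent_le (by linarith) ?_
        linarith

end IsNearUniformSymm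

end LargeSize

/-! ### Matrices of bounded size -/

section SmallSize

open Matrix

theorem tsum_abs_sub_le_of_zero {p π : ℕ → ℝ} (hp0 : ∀ r, 0 ≤ p r) (hπ0 : ∀ r, 0 ≤ π r)
    (hp : HasSum p 1) (hπ : HasSum π 1) :
    ∑' r, |p r - π r| ≤ 2 * ((1 - p 0) + (1 - π 0)) := by
  have hs : Summable fun r => |p r - π r| := (hp.sub hπ).summable.abs
  rw [hs.tsum_eq_zero_add]
  have h1 := (hasSum_nat_add_iff' 1).2 hp
  have h2 := (hasSum_nat_add_iff' 1).2 hπ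
  rw [Finset.sum_range_one] at h1 h2
  have h3 : ∑' r, |p (r + 1) - π (r + 1)| ≤ (1 - p 0) + (1 - π 0) := by
    refine hasSum_le (fun r => ?_) ((summable_nat_add_iff 1).2 hs).hasSum (h1.add h2)
    exact (abs_sub _ _).trans (by rw [abs_of_nonneg (hp0 _), abs_of_nonneg (hπ0 _)])
  have h4 : |p 0 - π 0| ≤ (1 - p 0) + (1 - π 0) := by
    have h5 : p 0 ≤ 1 := le_hasSum hp 0 fun r _ => hp0 r
    have h6 : π 0 ≤ 1 := le_hasSum hπ 0 fun r _ => hπ0 r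
    rw [abs_le]
    constructor <;> linarith
  linarith

/-- Markov's inequality: a kernel of positive dimension contains at least `q - 1` nonzero vectors.
-/
theorem mul_one_sub_le_of_hasSum {q m : ℝ} (hq : 1 ≤ q) {p : ℕ → ℝ} (hp0 : ∀ r, 0 ≤ p r)
    (hp : HasSum p 1) (hm : HasSum (fun r => p r * indepCount q 1 r) m) :
    (q - 1) * (1 - p 0) ≤ m := by
  have h1 := ((hasSum_nat_add_iff' 1).2 hp).mul_left (q - 1)
  have h2 := (hasSum_nat_add_iff' 1).2 hm
  rw [Finset.sum_range_one] at h1 h2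
  rw [indepCount_eq_zero q Nat.zero_lt_one, mul_zero, sub_zero] at h2
  refine hasSum_le (fun r => ?_) h1 h2
  rw [mul_comm]
  refine mul_le_mul_of_nonneg_left ?_ (hp0 _)
  have h3 : q ≤ q ^ (r + 1) := le_self_pow₀ hq (Nat.succ_ne_zero r)
  simp only [indepCount, Finset.prod_range_one, pow_zero]
  linarith

/-- The symmetric matrices as an additive group. -/
def symmAddSubgroup (n : ℕ) (K : Type*) [Field K] : AddSubgroup (Matrix (Fin n) (Fin n) K) where
  carrier := {A | A.IsSymm}
  zero_mem' := Matrix.transpose_zero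
  add_mem' := fun hA hB => hA.add hB
  neg_mem' := fun hA => hA.neg

theorem exists_isSymm_mulVec_eq {n : ℕ} {K : Type*} [Field K] {w : Fin n → K} (hw : w ≠ 0)
    (y : Fin n → K) : ∃ A : Matrix (Fin n) (Fin n) K, A.IsSymm ∧ A *ᵥ w = y := by
  obtain ⟨i, hi⟩ := Function.ne_iff.1 hw
  set u : Fin n → K := Pi.single i (w i)⁻¹ with hu
  have huw : u ⬝ᵥ w = 1 := by
    rw [hu, single_dotProduct]
    exact inv_mul_cancel₀ hi
  -- With `u ⬝ w = 1`, the matrix `y uᵀ + u yᵀ` sends `w` to `y + (y ⬝ w) u`; the multiple of `u uᵀ`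
  -- removes the excess.
  refine ⟨vecMulVec y u + vecMulVec u y - (y ⬝ᵥ w) • vecMulVec u u, ?_, ?_⟩
  · rw [Matrix.IsSymm, transpose_sub, transpose_add, transpose_smul, transpose_vecMulVec,
      transpose_vecMulVec, transpose_vecMulVec, add_comm]
  · ext j
    simp only [sub_mulVec, add_mulVec, smul_mulVec, vecMulVec_mulVec, huw, Pi.sub_apply,
      Pi.add_apply, Pi.smul_apply, MulOpposite.op_one, one_smul, MulOpposite.smul_eq_mul_unop,
      MulOpposite.unop_op, smul_eq_mul]
    ring

open Classical in
theorem card_isSymm_mulVec_eq_zero_mul {n : ℕ} {K : Type*} [Field K] [Fintype K] {w : Fin n → K}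
    (hw : w ≠ 0) :
    (Finset.univ.filter fun A : Matrix (Fin n) (Fin n) K => A.IsSymm ∧ A *ᵥ w = 0).card *
        Fintype.card K ^ n ≤
      Fintype.card K ^ Fintype.card {p : Fin n × Fin n // p.1 ≤ p.2} := by
  let g : symmAddSubgroup n K →+ (Fin n → K) :=
    AddMonoidHom.mk' (fun A => A.1 *ᵥ w) fun A B => add_mulVec A.1 B.1 w
  have hg : Function.Surjective g := fun y => by
    obtain ⟨A, hA, hAw⟩ := exists_isSymm_mulVec_eq hw y
    exact ⟨⟨A, hA⟩, hAw⟩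
  have h := card_kernel_mul_card g hg
  rw [Fintype.card_fun, Fintype.card_fin] at h
  have h1 : (Finset.univ.filter fun A : Matrix (Fin n) (Fin n) K => A.IsSymm ∧ A *ᵥ w = 0).card =
      (Finset.univ.filter fun A => g A = 0).card := by
    refine (Finset.card_bij (fun A _ => A.1) ?_ ?_ ?_).symm
    · intro A hA
      exact Finset.mem_filter.2 ⟨Finset.mem_univ _, A.2, (Finset.mem_filter.1 hA).2⟩
    · intro A _ B _ h
      exact Subtype.ext h
    · intro A hA
      obtain ⟨-, h2, h3⟩ := Finset.mem_filter.1 hA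
      exact ⟨⟨A, h2⟩, Finset.mem_filter.2 ⟨Finset.mem_univ _, h3⟩, rfl⟩
  rw [h1, h, ← Fintype.card_fun]
  refine Fintype.card_le_of_injective
    (fun A (p : {p : Fin n × Fin n // p.1 ≤ p.2}) => A.1 p.1.1 p.1.2) fun A B h => ?_
  refine Subtype.ext (Matrix.ext fun i j => ?_)
  rcases le_total i j with hij | hij
  · exact congr_fun h ⟨(i, j), hij⟩
  · have h2 := congr_fun h ⟨(j, i), hij⟩
    rwa [← A.2.apply, ← B.2.apply]

variable {n : ℕ} {K : Type*} [Field K] [Fintype K] [MeasurableSpace K] [DiscreteMeasurableSpace K]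
  {Ω : Type*} [MeasurableSpace Ω] {C : ℝ} {F : Fin n → Finset (Fin n)} {P : Measure Ω}
  [IsProbabilityMeasure P] {M : Ω → Matrix (Fin n) (Fin n) K}

namespace IsNearUniformSymm

theorem prob_eq_le (hM : IsNearUniformSymm C F P M) (A : Matrix (Fin n) (Fin n) K) :
    P.real {ω | M ω = A} ≤ (C / Fintype.card K) ^ Fintype.card (RegularPos F) := by
  have h := hM.indep_regular.measure_inter_preimage_eq_mul Finset.univ
    (sets := fun p => {A p.1.1 p.1.2}) fun p _ => measurableSet_singleton _
  have hsub : {ω | M ω = A} ⊆ ⋂ p ∈ (Finset.univ : Finset (RegularPos F)),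
      (fun ω => M ω p.1.1 p.1.2) ⁻¹' {A p.1.1 p.1.2} := fun ω hω => by
    simp only [Set.mem_iInter]
    intro p _
    have : M ω = A := hω
    simp [this]
  refine (measureReal_mono hsub).trans ?_
  rw [Measure.real, h, ENNReal.toReal_prod, ← Finset.card_univ (α := RegularPos F), ← Finset.prod_const]
  exact Finset.prod_le_prod (fun _ _ => ENNReal.toReal_nonneg) fun p _ => hM.near_uniform p _

/-- With `N` free entries, a single matrix has probability at most `(C / q) ^ N`, and at most `q ^
(N - n)` symmetric matrices kill `w`, because `A ↦ A w` is onto. -/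
theorem prob_mulVec_eq_zero_le (hM : IsNearUniformSymm C F P M) (hC : 1 ≤ C) (hF : ∀ i, F i = ∅)
    {w : Fin n → K} (hw : w ≠ 0) :
    (Fintype.card K : ℝ) ^ n * P.real {ω | M ω *ᵥ w = 0} ≤ C ^ (n * n) := by
  classical
  have hq0 : (0 : ℝ) < Fintype.card K := by exact_mod_cast Fintype.card_pos
  have hN : Fintype.card (RegularPos F) = Fintype.card {p : Fin n × Fin n // p.1 ≤ p.2} :=
    Fintype.card_congr (Equiv.subtypeEquivRight fun p => by simp [hF])
  have h1 : {ω | M ω *ᵥ w = 0} = {ω | (M ω).IsSymm ∧ M ω *ᵥ w = 0} := by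
    ext ω
    simp [hM.isSymm ω]
  rw [h1]
  have h2 := card_isSymm_mulVec_eq_zero_mul hw
  have h3 := Finset.sum_le_card_nsmul
    (Finset.univ.filter fun A : Matrix (Fin n) (Fin n) K => A.IsSymm ∧ A *ᵥ w = 0) _ _
    fun A _ => hM.prob_eq_le A
  rw [nsmul_eq_mul, hN] at h3
  have h4 : P.real {ω | (M ω).IsSymm ∧ M ω *ᵥ w = 0} ≤ _ :=
    (hM.prob_eq_sum fun A => A.IsSymm ∧ A *ᵥ w = 0).trans_le (le_of_eq_of_le (by congr) h3)
  set N := Fintype.card {p : Fin n × Fin n // p.1 ≤ p.2} with hNdef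
  have hNn : N ≤ n * n := by
    refine (Fintype.card_subtype_le _).trans ?_
    rw [Fintype.card_prod, Fintype.card_fin]
  have h2' : ((Finset.univ.filter fun A : Matrix (Fin n) (Fin n) K =>
      A.IsSymm ∧ A *ᵥ w = 0).card : ℝ) * (Fintype.card K : ℝ) ^ n ≤ (Fintype.card K : ℝ) ^ N := by
    exact_mod_cast h2
  refine (mul_le_mul_of_nonneg_left h4
    (by positivity : (0 : ℝ) ≤ (Fintype.card K : ℝ) ^ n)).trans ?_
  rw [← mul_assoc, mul_comm ((Fintype.card K : ℝ) ^ n)]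
  refine (mul_le_mul_of_nonneg_right h2' (by positivity)).trans ?_
  rw [← mul_pow, mul_div_cancel₀ _ hq0.ne']
  exact pow_le_pow_right₀ hC hNn

/-- The first moments are at most `C ^ (n * n)` and equal to `1`, so both laws give nonzero corank
probability `O(1 / q)`. The factor `4` combines the `2` of the total variation bound with `q / (q -
1) ≤ 2`. -/
theorem tvDist_le_of_small (hM : IsNearUniformSymm C F P M) (hC : 1 ≤ C) (hF : ∀ i, F i = ∅) :
    tvDist (P.map fun ω => corank (M ω)) (symLimitLaw (Fintype.card K)) ≤
      4 * (C ^ (n * n) + 1) / Fintype.card K := by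
  classical
  have hq1 : 1 < Fintype.card K := Fintype.one_lt_card
  have hq : (2 : ℝ) ≤ Fintype.card K := by exact_mod_cast hq1
  have : IsProbabilityMeasure (P.map fun ω => corank (M ω)) :=
    Measure.isProbabilityMeasure_map (hM.measurable_comp corank).aemeasurable
  have hp := hasSum_real_singleton (P.map fun ω => corank (M ω))
  have hπ := hasSum_symLimitProb hq1
  have h1 := tsum_abs_sub_le_of_zero (fun r => measureReal_nonneg) (symLimitProb_nonneg hq1) hp hπ
  have h2 := mul_one_sub_le_of_hasSum (by linarith) (fun r => measureReal_nonneg) hp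
    (hM.hasSum_corank_mul_indepCount 1)
  have h3 := mul_one_sub_le_of_hasSum (by linarith) (symLimitProb_nonneg hq1) hπ
    (hasSum_symLimitProb_mul_indepCount hq1 1)
  have h4 : ∑ W : Matrix (Fin n) (Fin 1) K with LinearIndependent K Wᵀ, P.real {ω | M ω * W = 0} ≤
      C ^ (n * n) := by
    have hbound : ∀ W ∈ Finset.univ.filter fun W : Matrix (Fin n) (Fin 1) K =>
        LinearIndependent K Wᵀ, P.real {ω | M ω * W = 0} ≤ C ^ (n * n) / (Fintype.card K : ℝ) ^ n := by
      intro W hW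
      have hW0 : Wᵀ 0 ≠ 0 := (Finset.mem_filter.1 hW).2.ne_zero 0
      rw [le_div_iff₀ (by positivity), mul_comm]
      refine le_trans (le_of_eq ?_) (hM.prob_mulVec_eq_zero_le hC hF hW0)
      congr 2
      ext ω
      constructor
      · intro h
        ext i
        exact congr_fun₂ (h : M ω * W = 0) i 0
      · intro h
        ext i j
        rw [Subsingleton.elim j 0]
        exact congr_fun (h : M ω *ᵥ Wᵀ 0 = 0) i
    refine (Finset.sum_le_card_nsmul _ _ _ hbound).trans ?_
    rw [nsmul_eq_mul, card_linearIndependent_columns]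
    have h5 : indepCount (Fintype.card K) 1 n ≤ (Fintype.card K : ℝ) ^ n := by
      simp [indepCount]
    calc indepCount (Fintype.card K) 1 n * (C ^ (n * n) / (Fintype.card K : ℝ) ^ n)
        ≤ (Fintype.card K : ℝ) ^ n * (C ^ (n * n) / (Fintype.card K : ℝ) ^ n) :=
          mul_le_mul_of_nonneg_right h5 (by positivity)
      _ = _ := by field_simp
  refine (tvDist_le_tsum _ hq1).trans (h1.trans ?_)
  rw [le_div_iff₀ (by linarith)]
  norm_num at h3
  set x := 1 - (P.map fun ω => corank (M ω)).real {0}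
  set y := 1 - symLimitProb (Fintype.card K) 0
  have hx : 0 ≤ x := sub_nonneg.2 measureReal_le_one
  have hy : 0 ≤ y := sub_nonneg.2 (le_hasSum hπ 0 fun r _ => symLimitProb_nonneg hq1 r)
  nlinarith [h2.trans h4, mul_nonneg (by linarith : (0 : ℝ) ≤ Fintype.card K - 2) hx,
    mul_nonneg (by linarith : (0 : ℝ) ≤ Fintype.card K - 2) hy]

end IsNearUniformSymm

end SmallSize

/-! ### Choice of constants and conclusion. -/

theorem theorem1p5 :
    ∃ α₀ : ℝ, 0 < α₀ ∧ ∀ α : ℝ, 0 < α → α < α₀ → ∀ C : ℝ, 1 ≤ C →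
      ∃ C' c : ℝ, 0 < C' ∧ 0 < c ∧
        ∀ (n : ℕ) (K : Type*) [Field K] [Fintype K] [MeasurableSpace K]
          [DiscreteMeasurableSpace K]
          (F : Fin n → Finset (Fin n))
          (_hcard : ∀ i, ((F i).card : ℝ) < α * n)
          (_hsymm : ∀ i j, i ∈ F j ↔ j ∈ F i)
          (_hchar : Odd (Fintype.card K) ∨ ∀ i, i ∉ F i)
          (Ω : Type*) [MeasurableSpace Ω] (P : Measure Ω) [IsProbabilityMeasure P]
          (M : Ω → Matrix (Fin n) (Fin n) K) (_hM : IsNearUniformSymm C F P M),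
          tvDist (P.map fun ω => corank (M ω)) (symLimitLaw (Fintype.card K)) ≤
            (C' / (Fintype.card K : ℝ)) ^ (c * n) := by
  refine ⟨1 / 200, by norm_num, fun α _ hα C hC => ?_⟩
  have hC0 : 0 < C := by linarith
  -- For `q > B` the first summand gives `C + 120 ≤ q ^ (1 / 100)`, used when `n ≥ 200`; the second
  -- dominates the bound for `n < 200`, where `n² ≤ 40000`. For `q ≤ B` the claimed bound is at
  -- least one.
  set B : ℝ := (C + 120) ^ 100 + 4 * (C ^ 40000 + 1) with hB
  have hB0 : 0 < B := by positivity
  refine ⟨B, 1 / 1000, hB0, by norm_num, ?_⟩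
  intro n K _ _ _ _ F hcard hsymm hchar Ω _ P _ M hM
  have hq1 : 1 < Fintype.card K := Fintype.one_lt_card
  have hq0 : (0 : ℝ) < Fintype.card K := by exact_mod_cast Fintype.card_pos
  have : IsProbabilityMeasure (P.map fun ω => corank (M ω)) :=
    Measure.isProbabilityMeasure_map (hM.measurable_comp corank).aemeasurable
  have hn0 : (0 : ℝ) ≤ n := n.cast_nonneg
  rcases le_or_gt (Fintype.card K : ℝ) B with hqB | hqB
  · exact (tvDist_le_one _ hq1).trans (Real.one_le_rpow ((one_le_div hq0).2 hqB) (by positivity))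
  rcases Nat.eq_zero_or_pos n with rfl | hn
  · simpa using tvDist_le_one (P.map fun ω => corank (M ω)) hq1
  have hn1 : (1 : ℝ) ≤ n := by exact_mod_cast hn
  rcases Nat.lt_or_ge n 200 with hn2 | hn2
  · have hn3 : (n : ℝ) < 200 := by exact_mod_cast hn2
    -- Here `α n < 1`, so no exceptional positions exist. A bound of order `1 / q` is enough,
    -- because the exponent `n / 1000` is below one and `B / q ≤ 1`.
    have hF : ∀ i, F i = ∅ := fun i => by
      rw [← Finset.card_eq_zero]
      have h1 : ((F i).card : ℝ) < 1 := (hcard i).trans (by nlinarith)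
      have h2 : (F i).card < 1 := by exact_mod_cast h1
      omega
    calc tvDist (P.map fun ω => corank (M ω)) (symLimitLaw (Fintype.card K))
        ≤ 4 * (C ^ (n * n) + 1) / Fintype.card K := hM.tvDist_le_of_small hC hF
      _ ≤ B / Fintype.card K := by
          refine div_le_div_of_nonneg_right ?_ hq0.le
          have h1 : C ^ (n * n) ≤ C ^ 40000 := pow_le_pow_right₀ hC (by nlinarith)
          have h2 : 0 ≤ (C + 120) ^ 100 := by positivity
          linarith
      _ = (B / Fintype.card K) ^ (1 : ℝ) := (Real.rpow_one _).symm
      _ ≤ _ := by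
          refine Real.rpow_le_rpow_of_exponent_ge (by positivity)
            (div_le_one_of_le₀ hqB.le hq0.le) ?_
          linarith
  · have h1 : C + 120 ≤ (Fintype.card K : ℝ) ^ (1 / 100 : ℝ) := by
      have h2 : (C + 120) ^ 100 ≤ (Fintype.card K : ℝ) := by
        have h3 : 0 ≤ 4 * (C ^ 40000 + 1) := by positivity
        linarith
      have h4 := Real.rpow_le_rpow (by positivity) h2 (by norm_num : (0 : ℝ) ≤ 1 / 100)
      refine le_trans (le_of_eq ?_) h4
      rw [← Real.rpow_natCast, ← Real.rpow_mul (by positivity)]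
      norm_num
    have hB1 : 1 ≤ B := by
      have h2 : 1 ≤ (C + 120) ^ 100 := one_le_pow₀ (by linarith)
      have h3 : 0 ≤ 4 * (C ^ 40000 + 1) := by positivity
      linarith
    calc tvDist (P.map fun ω => corank (M ω)) (symLimitLaw (Fintype.card K))
        ≤ (Fintype.card K : ℝ) ^ (-(n / 1000 : ℝ)) :=
          hM.tvDist_le_of_large hsymm hC (by linarith)
            (fun i => (hcard i).le.trans (by nlinarith)) hchar (by linarith) hn2
      _ = (1 / (Fintype.card K : ℝ)) ^ (1 / 1000 * n : ℝ) := by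
          rw [Real.rpow_neg hq0.le, one_div (Fintype.card K : ℝ), Real.inv_rpow hq0.le]
          congr 2
          ring
      _ ≤ _ := Real.rpow_le_rpow (by positivity) (div_le_div_of_nonneg_right hB1 hq0.le)
          (by positivity)
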